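/- **Theorem 3.1 (uniqueness for the inverse problem).** Fix $T>0$. Let $L$ be the boundary value problem $$-y''(x)+q(x)y(x)=\lambda r(x)y(x),\quad 0<x<T, \tag{1.1}$$ $$U(y):=y'(0)-hy(0)=0,\qquad V(y):=y'(T)+Hy(T)=0, \tag{1.2}$$ $$y(b+0)=d_1y(b-0),\qquad y'(b+0)=y'(b-0)/d_1+d_2\,y(b-0), \tag{1.3}$$ where $0<b<T$, $q\in L(0,T)$ is complex-valued, $r(x)=a_1^2$ on $(0,b)$ and $r(x)=a_2^2$ on $(b,T)$, and $h,H,a_1,a_2,d_1,d_2$ are complex numbers with $a_1,a_2,d_1\neq0$, $\arg d_1\in[0,\pi)$, $0\le\arg a_2<\arg a_1<\pi$ and $d_1a_2\pm a_1/d_1\ne0$. Solutions are understood to satisfy (1.1) almost everywhere, $y$ and $y'$ being absolutely continuous on $[0,b]$ and on $[b,T]$ (with one-sided limits as values at $b$), and to satisfy (1.3). Let $\varphi(x,\lambda)$ be the solution with $\varphi(0,\lambda)=1$, $\varphi'(0,\lambda)=h$, and let $\Delta(\lambda):=-V(\varphi(\cdot,\lambda))$, an entire function whose zeros are the eigenvalues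 of $L$. For $\Delta(\lambda)\neq0$ let $\Phi(x,\lambda)$ be the solution with $U(\Phi)=1$, $V(\Phi)=0$. The *Weyl function* is the meromorphic function $M(\lambda):=\Phi(0,\lambda)$. The *spectral data* are $W=\{\lambda_k,M_k\}_{k\ge0}$, where $\{\lambda_k\}_{k\ge 0}$ lists the zeros of $\Delta$, each repeated according to its multiplicity and with equal ones adjacent, and where, if $\lambda_k=\dots=\lambda_{k+m-1}$ are all the copies of an eigenvalue of multiplicity $m$, the sum $\sum_{\nu=0}^{m-1}M_{k+\nu}(\lambda-\lambda_k)^{-\nu-1}$ is the principal part of $M$ at $\lambda_k$. Let $\tilde L$ be another problem of the same form on the same interval, with data $\tilde q,\tilde r,\tilde b,\tilde a_1,\tilde a_2,\tilde h,\tilde H,\tilde d_1,\tilde d_2$ subject to the same conditions. Then $M\equiv\tilde M$ if and only if $W=\tilde W$ (that is, the two problems have the same spectral data for a suitable numbering of the eigenvalues). If $M\equiv\tilde M$, or if $W=\tilde W$, then $L=\tilde L$: $q=\tilde q$ almost everywhere on $(0,T)$, $r=\tilde r$, $b=\tilde b$, $a_1=\tilde a_1$, $a_2=\tilde a_2$,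 $h=\tilde h$, $H=\tilde H$, $d_1=\tilde d_1$ and $d_2=\tilde d_2$. -/

import Mathlib

open Set Filter Topology MeasureTheory

/-- The data of a boundary value problem `L` on `(0, T)`:
`-y'' + q y = lam r y`, `y'(0) - h y(0) = 0`, `y'(T) + H y(T) = 0`,
`y(b+0) = d₁ y(b-0)`, `y'(b+0) = y'(b-0) / d₁ + d₂ y(b-0)`,
where the weight `r` equals `a₁ ^ 2` on `(0, b)` and `a₂ ^ 2` on `(b, T)`. -/
structure BVP where
  q : ℝ → ℂ
  b : ℝ
  a₁ : ℂ
  a₂ : ℂ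
  h : ℂ
  H : ℂ
  d₁ : ℂ
  d₂ : ℂ

namespace BVP

/-- The weight function `r`; its value at the single point `b` plays no role. -/
noncomputable def r (L : BVP) (x : ℝ) : ℂ := if x < L.b then L.a₁ ^ 2 else L.a₂ ^ 2

/-- The standing assumptions on the data of a boundary value problem on `(0, T)`. -/
structure Admissible (T : ℝ) (L : BVP) : Prop where
  q_integrable : IntegrableOn L.q (Ioo 0 T)
  b_pos : 0 < L.b
  b_lt : L.b < T
  a₁_ne : L.a₁ ≠ 0
  a₂_ne : L.a₂ ≠ 0
  d₁_ne : L.d₁ ≠ 0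
  arg_d₁_nonneg : 0 ≤ L.d₁.arg
  arg_d₁_lt : L.d₁.arg < Real.pi
  arg_a₂_nonneg : 0 ≤ L.a₂.arg
  arg_a₂_lt : L.a₂.arg < L.a₁.arg
  arg_a₁_lt : L.a₁.arg < Real.pi
  omega_plus_ne : L.d₁ * L.a₂ + L.a₁ / L.d₁ ≠ 0
  omega_minus_ne : L.d₁ * L.a₂ - L.a₁ / L.d₁ ≠ 0

/-- `y` with derivative `dy` is a (Carathéodory) solution of `-y'' + q y = lam r y` on `[α, β]`:
`y` is differentiable with derivative `dy` (one-sided at the end points), `dy` is absolutely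
continuous, and the equation holds almost everywhere. -/
structure SolvesOn (L : BVP) (lam : ℂ) (α β : ℝ) (y dy : ℝ → ℂ) : Prop where
  hasDeriv : ∀ x ∈ Icc α β, HasDerivWithinAt y (dy x) (Icc α β) x
  absCont : AbsolutelyContinuousOnInterval dy α β
  equation : ∀ᵐ x ∂(volume.restrict (Ioo α β)), HasDerivAt dy (L.q x * y x - lam * L.r x * y x) x

/-- A function on `[0, T]` with a possible jump at `b`, together with its derivative:
`y`, `dy` represent it on `[0, b]` and `Y`, `dY` represent it on `[b, T]`, so that `y b`, `dy b`
are the limits at `b - 0` and `Y b`, `dY b` the limits at `b + 0`. -/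
structure Pieces where
  y : ℝ → ℂ
  dy : ℝ → ℂ
  Y : ℝ → ℂ
  dY : ℝ → ℂ

instance : Nonempty Pieces := ⟨⟨0, 0, 0, 0⟩⟩

/-- `u` solves the differential equation on `(0, b)` and on `(b, T)` and satisfies the jump
conditions at `b`. -/
structure IsSolution (T : ℝ) (L : BVP) (lam : ℂ) (u : Pieces) : Prop where
  left : L.SolvesOn lam 0 L.b u.y u.dy
  right : L.SolvesOn lam L.b T u.Y u.dY
  jump : u.Y L.b = L.d₁ * u.y L.b
  jump_deriv : u.dY L.b = u.dy L.b / L.d₁ + L.d₂ * u.y L.b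

/-- The boundary form `U(u) = u'(0) - h u(0)`. -/
def U (L : BVP) (u : Pieces) : ℂ := u.dy 0 - L.h * u.y 0

/-- The boundary form `V(u) = u'(T) + H u(T)`. -/
def V (T : ℝ) (L : BVP) (u : Pieces) : ℂ := u.dY T + L.H * u.Y T

/-- The solution `φ(·, lam)` with `φ(0, lam) = 1`, `φ'(0, lam) = h`. It exists and is unique on
`[0, T]`, so the choice made here is immaterial. -/
noncomputable def phi (T : ℝ) (L : BVP) (lam : ℂ) : Pieces :=
  Classical.epsilon fun u => L.IsSolution T lam u ∧ u.y 0 = 1 ∧ u.dy 0 = L.h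

/-- The characteristic function `Δ(lam) = -V(φ(·, lam))`; its zeros are the eigenvalues. -/
noncomputable def charFun (T : ℝ) (L : BVP) (lam : ℂ) : ℂ := -L.V T (L.phi T lam)

/-- The Weyl solution `Φ(·, lam)`: `U(Φ) = 1`, `V(Φ) = 0`. It exists and is unique on `[0, T]` if
and only if `lam` is not an eigenvalue. -/
noncomputable def weylSol (T : ℝ) (L : BVP) (lam : ℂ) : Pieces :=
  Classical.epsilon fun u => L.IsSolution T lam u ∧ L.U u = 1 ∧ L.V T u = 0

/-- The Weyl function `M(lam) = Φ(0, lam)`; meaningful when `lam` is not an eigenvalue. -/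
noncomputable def weyl (T : ℝ) (L : BVP) (lam : ℂ) : ℂ := (L.weylSol T lam).y 0

/-- `M ≡ M'` as meromorphic functions: equality at every point which is an eigenvalue of neither
problem. -/
def SameWeyl (T : ℝ) (L L' : BVP) : Prop :=
  ∀ lam : ℂ, L.charFun T lam ≠ 0 → L'.charFun T lam ≠ 0 → L.weyl T lam = L'.weyl T lam

/-- `{ev k, M k}` is the spectral data of `L`: `ev` lists the eigenvalues, each one repeated
according to its multiplicity as a zero of `Δ`, equal eigenvalues being adjacent; and if the block
of the eigenvalue `ev k`, of multiplicity `m`, starts at the index `k`, then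
`∑_{ν < m} M (k + ν) / (lam - ev k) ^ (ν + 1)` is the principal part of the Weyl function
at `ev k`. -/
structure IsSpectralData (T : ℝ) (L : BVP) (ev M : ℕ → ℂ) : Prop where
  multiplicity : ∀ μ : ℂ, {k | ev k = μ}.encard = analyticOrderAt (L.charFun T) μ
  adjacent : ∀ i j k : ℕ, i ≤ j → j ≤ k → ev i = ev k → ev j = ev i
  principal_part : ∀ k : ℕ, (k = 0 ∨ ev (k - 1) ≠ ev k) →
    ∃ g : ℂ → ℂ, AnalyticAt ℂ g (ev k) ∧ ∀ᶠ lam in 𝓝[≠] (ev k),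
      L.weyl T lam = (∑ ν ∈ Finset.range (analyticOrderNatAt (L.charFun T) (ev k)),
        M (k + ν) / (lam - ev k) ^ (ν + 1)) + g lam

/-- `W = W'`: with a suitable numbering, the two problems have the same spectral data. -/
def SameSpectralData (T : ℝ) (L L' : BVP) : Prop :=
  ∃ ev M : ℕ → ℂ, L.IsSpectralData T ev M ∧ L'.IsSpectralData T ev M

end BVP

/-! Along a ray `lam = (t ω) ^ 2`, `t → ∞`, on which neither `ω a₁` nor `ω a₂` is real (`Generic`),
a solution satisfying the boundary condition at `T` is asymptotically a pure decaying exponential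
away from the left end of each smooth piece. Everything is read off from these asymptotics together
with a Phragmén–Lindelöf theorem for entire functions of order `1 / 2`: such a function which tends
to `0` along two opposite rays vanishes (`OrderHalf.eq_zero_of_tendsto`). Replacing `ω` by `i ω`
turns one ray of the `lam`-plane into the opposite one.

Local uniqueness (`RayPair.eq_of_opposite`): write `Φ = s + M φ`, with `s` the solution having `s =
0`, `s' = 1` at the left end. If `M = M'`, the entire function `s φ' - φ s'` (primes for the second
problem) equals `Φ φ' - φ Φ'`; growth and decay cancel and it is `O(M)`, so it tends to `0` on both
rays and vanishes identically. With the two Wronskians this gives `φ ^ 2 = φ' ^ 2`, hence equal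
potentials and equal boundary coefficients (`potential_eq_of_cross_eq`).

The parameters come from logarithmic derivatives. The limit of `t M` gives `a₁`. At an interior
point of the left piece `Φ' / (t Φ)` tends to `-ν(ω a₁)`, but at `b - 0` it tends to `-d₁² ν(ω a₂)`;
these differ because `d₁ a₂ ± a₁ / d₁ ≠ 0`, which locates `b`. Equality of `d₁² ν(ω a₂)` for all
generic `ω` fixes `a₂` up to a positive factor `c`, because `ν(ω a₂)` changes branch exactly where
`ω a₂` is real. Stretching the right piece of one problem by `c` puts both right pieces in the
situation of local uniqueness, with `d₂ / d₁` in the role of `h`. If `c ≠ 1`, the boundary condition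
at `T` is transported to an interior point and contradicts the asymptotics there; so `c = 1`, and
`H`, `d₁`, `d₂` follow.

Equal spectral data make `M - M'` an entire function. A quotient of order-`1 / 2` functions, if
entire, has again order `1 / 2` (`OrderHalf.of_mul_eq`), and `M`, `M'` tend to `0` on generic rays,
so `M = M'`. Conversely `M = M'` identifies the problems, and it remains to know that spectral data
exist; this needs infinitely many eigenvalues, which follows from the same Phragmén–Lindelöf
argument applied to the reciprocal of a zero-free factor of `Δ`. -/

/-! ### Entire functions of order one half -/

/-- Entire functions of order at most `1 / 2` and finite type. -/
structure OrderHalf (f : ℂ → ℂ) : Prop where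
  differentiable : Differentiable ℂ f
  growth : ∃ C : ℝ, 0 ≤ C ∧ ∀ z, ‖f z‖ ≤ Real.exp (C * (1 + √‖z‖))

namespace OrderHalf

variable {f g : ℂ → ℂ}

theorem of_le {C D : ℝ} (hf : Differentiable ℂ f)
    (h : ∀ z, ‖f z‖ ≤ D * Real.exp (C * (1 + √‖z‖))) : OrderHalf f := by
  refine ⟨hf, |C| + |D|, by positivity, fun z => (h z).trans ?_⟩
  have h1 : D ≤ Real.exp |D| := (le_abs_self D).trans
    (by linarith [Real.add_one_le_exp |D|])
  calc D * Real.exp (C * (1 + √‖z‖))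
      ≤ Real.exp |D| * Real.exp (|C| * (1 + √‖z‖)) := by
        gcongr
        exact le_abs_self C
    _ = Real.exp (|D| + |C| * (1 + √‖z‖)) := (Real.exp_add _ _).symm
    _ ≤ _ := by
        apply Real.exp_le_exp.2
        nlinarith [abs_nonneg D, Real.sqrt_nonneg ‖z‖, mul_nonneg (abs_nonneg D) (Real.sqrt_nonneg ‖z‖)]

theorem const (c : ℂ) : OrderHalf fun _ => c :=
  of_le (C := 0) (D := ‖c‖) (differentiable_const c) (by simp)

theorem add (hf : OrderHalf f) (hg : OrderHalf g) : OrderHalf fun z => f z + g z := by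
  obtain ⟨C, hC, hf'⟩ := hf.growth
  obtain ⟨D, hD, hg'⟩ := hg.growth
  refine of_le (C := C + D) (D := 2) (hf.differentiable.add hg.differentiable) fun z => ?_
  have h0 := Real.sqrt_nonneg ‖z‖
  have h1 : Real.exp (C * (1 + √‖z‖)) ≤ Real.exp ((C + D) * (1 + √‖z‖)) := by gcongr; linarith
  have h2 : Real.exp (D * (1 + √‖z‖)) ≤ Real.exp ((C + D) * (1 + √‖z‖)) := by gcongr; linarith
  linarith [norm_add_le (f z) (g z), hf' z, hg' z]

theorem mul (hf : OrderHalf f) (hg : OrderHalf g) : OrderHalf fun z => f z * g z := by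
  obtain ⟨C, hC, hf'⟩ := hf.growth
  obtain ⟨D, hD, hg'⟩ := hg.growth
  refine ⟨hf.differentiable.mul hg.differentiable, C + D, by positivity, fun z => ?_⟩
  rw [norm_mul, add_mul, Real.exp_add]
  gcongr
  · exact hf' z
  · exact hg' z

theorem neg (hf : OrderHalf f) : OrderHalf fun z => -f z :=
  ⟨hf.differentiable.neg, by simpa using hf.growth⟩

theorem sub (hf : OrderHalf f) (hg : OrderHalf g) : OrderHalf fun z => f z - g z := by
  simpa [sub_eq_add_neg] using hf.add hg.neg

theorem id : OrderHalf fun z => z := by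
  refine of_le (C := 2) (D := 1) differentiable_id fun z => ?_
  have h := Real.add_one_le_exp √‖z‖
  calc ‖z‖ = √‖z‖ * √‖z‖ := (Real.mul_self_sqrt (norm_nonneg z)).symm
    _ ≤ Real.exp √‖z‖ * Real.exp √‖z‖ := by gcongr <;> linarith
    _ = Real.exp (2 * √‖z‖) := by rw [← Real.exp_add]; ring_nf
    _ ≤ 1 * Real.exp (2 * (1 + √‖z‖)) := by rw [one_mul]; gcongr; linarith

theorem comp_add (hf : OrderHalf f) (c : ℂ) : OrderHalf fun z => f (z + c) := by
  obtain ⟨C, hC, hf'⟩ := hf.growth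
  refine ⟨hf.differentiable.comp (differentiable_id.add_const c), C * (1 + √‖c‖), by positivity,
    fun z => (hf' _).trans ?_⟩
  have h1 : √‖z + c‖ ≤ √‖z‖ + √‖c‖ :=
    Real.sqrt_le_iff.2 ⟨by positivity, by
      nlinarith [norm_add_le z c, Real.sq_sqrt (norm_nonneg z), Real.sq_sqrt (norm_nonneg c),
        mul_nonneg (Real.sqrt_nonneg ‖z‖) (Real.sqrt_nonneg ‖c‖)]⟩
  apply Real.exp_le_exp.2
  rw [mul_assoc]
  gcongr
  nlinarith [Real.sqrt_nonneg ‖z‖, Real.sqrt_nonneg ‖c‖,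
    mul_nonneg (Real.sqrt_nonneg ‖z‖) (Real.sqrt_nonneg ‖c‖)]

theorem comp_mul (hf : OrderHalf f) (c : ℂ) : OrderHalf fun z => f (z * c) := by
  obtain ⟨C, hC, hf'⟩ := hf.growth
  refine ⟨hf.differentiable.comp (differentiable_id.mul_const c), C * (1 + √‖c‖), by positivity,
    fun z => (hf' _).trans ?_⟩
  rw [norm_mul, Real.sqrt_mul (norm_nonneg z)]
  apply Real.exp_le_exp.2
  rw [mul_assoc]
  gcongr
  nlinarith [Real.sqrt_nonneg ‖z‖, Real.sqrt_nonneg ‖c‖,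
    mul_nonneg (Real.sqrt_nonneg ‖z‖) (Real.sqrt_nonneg ‖c‖)]

end OrderHalf

/-- A continuous function on `[0, ∞)` with a limit at infinity is bounded. -/
theorem exists_norm_le_of_tendsto_atTop {f : ℝ → ℂ} (hf : Continuous f) {a : ℂ}
    (h : Tendsto f atTop (𝓝 a)) : ∃ C, ∀ t, 0 ≤ t → ‖f t‖ ≤ C := by
  obtain ⟨R, hR⟩ := eventually_atTop.1 (h.norm.eventually (gt_mem_nhds (lt_add_one ‖a‖)))
  obtain ⟨C, hC⟩ := (isCompact_Icc (a := (0 : ℝ)) (b := R)).exists_bound_of_continuousOn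
    hf.continuousOn
  refine ⟨max C (‖a‖ + 1), fun t ht => ?_⟩
  rcases le_total t R with h1 | h1
  · exact (hC t ⟨ht, h1⟩).trans (le_max_left _ _)
  · exact (hR t h1).le.trans (le_max_right _ _)

open Complex in
/-- **Phragmén–Lindelöf** for functions of order `1 / 2` on the two sides of a line. -/
theorem OrderHalf.eq_zero_of_tendsto {f : ℂ → ℂ} (hf : OrderHalf f) {u : ℂ} (hu : u ≠ 0)
    (h1 : Tendsto (fun t : ℝ => f (u * t ^ 2)) atTop (𝓝 0))
    (h2 : Tendsto (fun t : ℝ => f (-u * t ^ 2)) atTop (𝓝 0)) (z : ℂ) : f z = 0 := by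
  have hfc := hf.differentiable.continuous
  obtain ⟨C₁, hC₁⟩ := exists_norm_le_of_tendsto_atTop (by fun_prop) h1
  obtain ⟨C₂, hC₂⟩ := exists_norm_le_of_tendsto_atTop (by fun_prop) h2
  obtain ⟨A, hA, hgr⟩ := hf.growth
  set C := max C₁ C₂ with hC
  -- The substitution `ζ ^ 2` turns order `1 / 2` into order `1`, below the critical exponent `2` of
  -- a quadrant, and turns the two opposite rays into the real and imaginary axes. Evenness of `F`
  -- then covers the lower half-plane.
  set F : ℂ → ℂ := fun ζ => f (u * ζ ^ 2) with hF
  have hFd : Differentiable ℂ F := hf.differentiable.comp (by fun_prop)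
  have hO : ∀ l : Filter ℂ, F =O[Bornology.cobounded ℂ ⊓ l] fun ζ => Real.exp ((A * (1 + √‖u‖)) * ‖ζ‖ ^ (1 : ℝ)) := by
    intro l
    refine Asymptotics.IsBigO.of_bound (Real.exp A) (.filter_mono inf_le_left (Eventually.of_forall fun ζ => ?_))
    rw [Real.norm_of_nonneg (Real.exp_pos _).le, ← Real.exp_add, Real.rpow_one]
    refine (hgr _).trans (Real.exp_le_exp.2 ?_)
    rw [norm_mul, norm_pow, Real.sqrt_mul (norm_nonneg u), Real.sqrt_sq (norm_nonneg ζ)]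
    nlinarith [mul_nonneg hA (norm_nonneg ζ)]
  have hre : ∀ x : ℝ, ‖F x‖ ≤ C := fun x => by
    have := hC₁ |x| (abs_nonneg x)
    rw [← ofReal_pow, sq_abs] at this
    refine le_trans (le_of_eq ?_) (this.trans (le_max_left _ _))
    simp [hF]
  have him : ∀ x : ℝ, ‖F (x * I)‖ ≤ C := fun x => by
    have := hC₂ |x| (abs_nonneg x)
    rw [← ofReal_pow, sq_abs] at this
    refine le_trans (le_of_eq ?_) (this.trans (le_max_right _ _))
    simp [hF, mul_pow]
  have hup : ∀ ζ : ℂ, 0 ≤ ζ.im → ‖F ζ‖ ≤ C := by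
    intro ζ hζ
    rcases le_total 0 ζ.re with hr | hr
    · exact PhragmenLindelof.quadrant_I hFd.diffContOnCl ⟨1, by norm_num, _, hO _⟩
        (fun x _ => hre x) (fun x _ => him x) hr hζ
    · exact PhragmenLindelof.quadrant_II hFd.diffContOnCl ⟨1, by norm_num, _, hO _⟩
        (fun x _ => hre x) (fun x _ => him x) hr hζ
  have hall : ∀ ζ : ℂ, ‖F ζ‖ ≤ C := by
    intro ζ
    rcases le_total 0 ζ.im with h | h
    · exact hup ζ h
    · simpa [hF] using hup (-ζ) (by simpa using h)
  have hb : ∀ w, ‖f w‖ ≤ C := by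
    intro w
    obtain ⟨ζ, hζ⟩ := IsAlgClosed.exists_pow_nat_eq (w / u) (n := 2) (by norm_num)
    have := hall ζ
    simp only [hF, hζ] at this
    rwa [mul_div_cancel₀ _ hu] at this
  obtain ⟨c, hc⟩ := hf.differentiable.exists_const_forall_eq_of_bounded
    (isBounded_iff_forall_norm_le.2 ⟨C, by rintro _ ⟨w, rfl⟩; exact hb w⟩)
  have : Tendsto (fun t : ℝ => f (u * t ^ 2)) atTop (𝓝 c) := by simp [hc]
  rw [hc, tendsto_nhds_unique this h1]

/-! ### Dividing out zeros; quotients of functions of order one half -/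

/-- The zeros of an entire function lying in a finite set can be divided out. -/
theorem exists_eq_prod_mul_of_finset {G : ℂ → ℂ} (hG : Differentiable ℂ G) (h0 : G ≠ 0)
    (s : Finset ℂ) :
    ∃ (l : Multiset ℂ) (H : ℂ → ℂ), (∀ w ∈ l, w ∈ s) ∧ Differentiable ℂ H ∧
      (∀ z, G z = (l.map fun w => z - w).prod * H z) ∧ ∀ w ∈ s, H w ≠ 0 := by
  classical
  have key : ∀ (w : ℂ) (n : ℕ) (F : ℂ → ℂ), Differentiable ℂ F → F ≠ 0 →
      analyticOrderNatAt F w = n → ∃ H : ℂ → ℂ, Differentiable ℂ H ∧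
        (∀ z, F z = (z - w) ^ n * H z) ∧ H w ≠ 0 := by
    intro w n
    induction n with
    | zero =>
      intro F hF hF0 hn
      refine ⟨F, hF, by simp, ?_⟩
      have htop : analyticOrderAt F w ≠ ⊤ := fun h => hF0
        ((AnalyticOnNhd.analyticOrderAt_eq_top_iff_eq_zero w fun z => hF.analyticAt z).1 h)
      rw [← (hF.analyticAt w).analyticOrderAt_eq_zero, ← Nat.cast_analyticOrderNatAt htop, hn]
      rfl
    | succ n ih =>
      intro F hF hF0 hn
      have hFw : F w = 0 := apply_eq_zero_of_analyticOrderNatAt_ne_zero (by omega)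
      have hd : Differentiable ℂ (dslope F w) := by
        rw [← differentiableOn_univ]
        exact (Complex.differentiableOn_dslope univ_mem).2 hF.differentiableOn
      have heq : ∀ z, F z = (z - w) * dslope F w z := fun z => by
        have := sub_smul_dslope F w z
        simpa [hFw] using this.symm
      have hd0 : dslope F w ≠ 0 := fun h => hF0 (by ext z; rw [heq z, h]; simp)
      have htop : analyticOrderAt (dslope F w) w ≠ ⊤ := fun h => hd0
        ((AnalyticOnNhd.analyticOrderAt_eq_top_iff_eq_zero w fun z => hd.analyticAt z).1 h)
      have hord : analyticOrderNatAt F w = 1 + analyticOrderNatAt (dslope F w) w := by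
        have h1 : F = (fun z => z - w) * dslope F w := funext heq
        have h2 : analyticOrderAt (fun z : ℂ => z - w) w = 1 := analyticOrderAt_id_sub_const_self
        conv_lhs => rw [h1]
        rw [analyticOrderNatAt_mul (by fun_prop) (hd.analyticAt w) (by rw [h2]; simp) htop]
        congr 1
        simp [analyticOrderNatAt, h2]
      obtain ⟨H, hH, hH1, hH2⟩ := ih _ hd hd0 (by omega)
      exact ⟨H, hH, fun z => by rw [heq z, hH1 z]; ring, hH2⟩
  induction s using Finset.induction_on with
  | empty => exact ⟨0, G, by simp, hG, by simp, by simp⟩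
  | insert w s hw ih =>
    obtain ⟨l, H, hl, hH, hGH, hHs⟩ := ih
    have hH0 : H ≠ 0 := fun h => h0 (by ext z; rw [hGH z, h]; simp)
    obtain ⟨H', hH', h1, h2⟩ := key w _ H hH hH0 rfl
    refine ⟨Multiset.replicate (analyticOrderNatAt H w) w + l, H', ?_, hH', fun z => ?_, ?_⟩
    · intro v hv
      rcases Multiset.mem_add.1 hv with h | h
      · rw [Multiset.eq_of_mem_replicate h]; exact Finset.mem_insert_self _ _
      · exact Finset.mem_insert_of_mem (hl v h)
    · rw [hGH z, h1 z]
      simp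
      ring
    · intro v hv
      rcases Finset.mem_insert.1 hv with rfl | h
      · exact h2
      · intro h3
        exact hHs v h (by rw [h1 v, h3, mul_zero])

theorem finite_zeros_inter_closedBall {G : ℂ → ℂ} (hG : Differentiable ℂ G) (h0 : G ≠ 0) (R : ℝ) :
    {z | z ∈ Metric.closedBall (0 : ℂ) R ∧ G z = 0}.Finite := by
  obtain ⟨x, hx⟩ : ∃ x, G x ≠ 0 := Function.ne_iff.1 h0
  have h1 := AnalyticOnNhd.preimage_zero_mem_codiscrete (f := G) (fun z _ => hG.analyticAt z) hx
  have h2 := (isCompact_closedBall (0 : ℂ) R).finite_sdiff_of_mem_codiscreteWithin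
    (codiscreteWithin_mono (subset_univ _) h1)
  refine h2.subset fun z hz => ⟨hz.1, ?_⟩
  simpa using hz.2

/-- Lower bound for a zero-free holomorphic function in a disc. -/
theorem norm_le_norm_mul_exp_of_zeroFree {G : ℂ → ℂ} (hG : Differentiable ℂ G) {R : ℝ} (hR : 0 < R)
    (hne : ∀ z ∈ Metric.ball (0 : ℂ) R, G z ≠ 0) {M : ℝ} (hM : 0 < M)
    (hle : ∀ z ∈ Metric.ball (0 : ℂ) R, ‖G z‖ ≤ ‖G 0‖ * Real.exp M) {z : ℂ} (hz : ‖z‖ ≤ R / 2) :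
    ‖G 0‖ ≤ ‖G z‖ * Real.exp (2 * M) := by
  have h0 : (0 : ℂ) ∈ Metric.ball (0 : ℂ) R := Metric.mem_ball_self hR
  have hzb : z ∈ Metric.ball (0 : ℂ) R := by simpa using lt_of_le_of_lt hz (by linarith)
  have hd : DifferentiableOn ℂ (fun z => deriv G z / G z) (Metric.ball 0 R) :=
    (hG.contDiff (n := 2) |>.differentiable_deriv_two.differentiableOn).div hG.differentiableOn hne
  -- `g` is a logarithm of `G / G 0`, obtained as a primitive of `G' / G`; the upper bound on `‖G‖`
  -- bounds its real part, and Borel–Carathéodory turns this into a lower bound.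
  obtain ⟨g, hg0, hg⟩ := hd.isExactOn_ball.with_val_at 0 0
  have hgd : DifferentiableOn ℂ g (Metric.ball 0 R) :=
    fun z hz => (hg z hz).differentiableAt.differentiableWithinAt
  have hexp : ∀ z ∈ Metric.ball (0 : ℂ) R, G z = G 0 * Complex.exp (g z) := by
    have hc : ∀ z ∈ Metric.ball (0 : ℂ) R, HasDerivAt (fun z => G z * Complex.exp (-g z)) 0 z := by
      intro z hz
      refine ((hG z).hasDerivAt.mul ((hg z hz).neg.cexp)).congr_deriv ?_
      rw [mul_neg, mul_comm (Complex.exp _) (_ / _), mul_neg, ← mul_assoc,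
        mul_div_cancel₀ _ (hne z hz), add_neg_cancel]
    have := fun z hz => (convex_ball (0 : ℂ) R).is_const_of_fderivWithin_eq_zero (𝕜 := ℂ)
      (f := fun z => G z * Complex.exp (-g z))
      (fun z hz => (hc z hz).differentiableAt.differentiableWithinAt)
      (fun z hz => by
        rw [fderivWithin_of_isOpen Metric.isOpen_ball hz]
        simpa using (hc z hz).hasFDerivAt.fderiv) h0 (y := z) hz
    intro z hz
    have h := this z hz
    simp only [hg0, neg_zero, Complex.exp_zero, mul_one] at h
    rw [h, mul_assoc, ← Complex.exp_add]
    simp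
  have hG0 : 0 < ‖G 0‖ := norm_pos_iff.2 (hne 0 h0)
  have hre : MapsTo g (Metric.ball 0 R) {z | z.re ≤ M} := by
    intro z hz
    have := hle z hz
    rw [hexp z hz, norm_mul, Complex.norm_exp] at this
    exact Real.exp_le_exp.1 (le_of_mul_le_mul_left this hG0)
  have hbc := Complex.borelCaratheodory_zero hM hgd hre hR hzb hg0
  have h2 : 2 * M * ‖z‖ / (R - ‖z‖) ≤ 2 * M := by
    rw [div_le_iff₀ (by linarith)]
    nlinarith
  rw [hexp z hzb, norm_mul, Complex.norm_exp, mul_assoc, ← Real.exp_add]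
  have h3 : -(g z).re ≤ 2 * M := by
    linarith [neg_abs_le (g z).re, Complex.abs_re_le_norm (g z), neg_le_abs (g z).re]
  have : 1 ≤ Real.exp ((g z).re + 2 * M) := Real.one_le_exp (by linarith)
  nlinarith

open Complex ComplexConjugate in
-- On the circle `‖z‖ = R` one has `R² = conj z * z`. Thus the reflected factor `(R² - conj w * z) /
-- R` has the same modulus there as `z - w`.
theorem norm_sq_sub_conj_mul {R : ℝ} (w z : ℂ) (hz : ‖z‖ = R) :
    ‖(R : ℂ) ^ 2 - conj w * z‖ = R * ‖z - w‖ := by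
  have : (R : ℂ) ^ 2 - conj w * z = conj (z - w) * z := by
    rw [← hz, ← ofReal_pow, ← normSq_eq_norm_sq, normSq_eq_conj_mul_self, map_sub]
    ring
  rw [this, norm_mul, norm_conj, hz, mul_comm]

open ComplexConjugate in
/-- Division of holomorphic functions in a disc: the quotient is controlled by the bounds of the
numerator and the denominator on the circle and by the value of the denominator at the center. -/
theorem norm_quotient_le {E F G : ℂ → ℂ} (hE : Differentiable ℂ E) (hG : Differentiable ℂ G)
    (hF : ∀ z, F z = E z * G z) (hG0 : G 0 ≠ 0) {R M : ℝ} (hR : 0 < R) (hM : 0 < M)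
    (hFR : ∀ z, ‖z‖ = R → ‖F z‖ ≤ ‖G 0‖ * Real.exp M)
    (hGR : ∀ z, ‖z‖ = R → ‖G z‖ ≤ ‖G 0‖ * Real.exp M) {z : ℂ} (hz : ‖z‖ ≤ R / 2) :
    ‖E z‖ ≤ Real.exp (3 * M) := by
  have hGne : G ≠ 0 := fun h => hG0 (by simp [h])
  set s := (finite_zeros_inter_closedBall hG hGne R).toFinset with hs
  have hsm : ∀ w, w ∈ s ↔ ‖w‖ ≤ R ∧ G w = 0 := by intro w; simp [hs]
  obtain ⟨l, H, hl, hH, hGH, hHs⟩ := exists_eq_prod_mul_of_finset hG hGne s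
  have hHne : ∀ z, ‖z‖ ≤ R → H z ≠ 0 := by
    intro z hz h
    have : G z = 0 := by rw [hGH, h, mul_zero]
    exact hHs z ((hsm z).2 ⟨hz, this⟩) h
  -- Each factor `z - w` is replaced by its Blaschke reflection: same modulus on the circle, no zero
  -- in the open disc, and a modulus at `0` that is at least as large. Hence `B * H` is zero-free
  -- inside, keeps the bounds of `G` on the circle and does not decrease the value at the center.
  set B : ℂ → ℂ := fun z => (l.map fun w => ((R : ℂ) ^ 2 - conj w * z) / R).prod with hB
  have hBd : Differentiable ℂ B := by
    have : ∀ m : Multiset ℂ,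
        Differentiable ℂ fun z => (m.map fun w => ((R : ℂ) ^ 2 - conj w * z) / R).prod := by
      intro m
      induction m using Multiset.induction_on with
      | empty => simp
      | cons a m ih =>
        simp only [Multiset.map_cons, Multiset.prod_cons]
        exact Differentiable.mul (by fun_prop) ih
    exact this l
  have hR' : (R : ℂ) ≠ 0 := by exact_mod_cast hR.ne'
  have hBnorm : ∀ z, ‖z‖ = R → ‖B z‖ = ‖(l.map fun w => z - w).prod‖ := by
    intro z hz
    have : ∀ m : Multiset ℂ, ‖(m.map fun w => ((R : ℂ) ^ 2 - conj w * z) / R).prod‖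
        = ‖(m.map fun w => z - w).prod‖ := by
      intro m
      induction m using Multiset.induction_on with
      | empty => simp
      | cons a m ih =>
        simp only [Multiset.map_cons, Multiset.prod_cons, norm_mul, ih, norm_div,
          norm_sq_sub_conj_mul a z hz]
        rw [Complex.norm_real, Real.norm_of_nonneg hR.le, mul_div_cancel_left₀ _ hR.ne']
    exact this l
  have hB0 : ‖(l.map fun w => (0 : ℂ) - w).prod‖ ≤ ‖B 0‖ := by
    have : ∀ m : Multiset ℂ, (∀ w ∈ m, ‖w‖ ≤ R) → ‖(m.map fun w => (0 : ℂ) - w).prod‖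
        ≤ ‖(m.map fun w => ((R : ℂ) ^ 2 - conj w * 0) / R).prod‖ := by
      intro m
      induction m using Multiset.induction_on with
      | empty => simp
      | cons a m ih =>
        intro h
        simp only [Multiset.map_cons, Multiset.prod_cons, norm_mul]
        gcongr
        · rw [mul_zero, sub_zero, zero_sub, norm_neg, norm_div, norm_pow, Complex.norm_real,
            Real.norm_of_nonneg hR.le, pow_two, mul_div_cancel_left₀ _ hR.ne']
          exact h a (Multiset.mem_cons_self a m)
        · exact ih fun w hw => h w (Multiset.mem_cons_of_mem hw)
    exact this l fun w hw => ((hsm w).1 (hl w hw)).1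
  have hlt : ∀ w ∈ l, ‖w‖ ≤ R := fun w hw => ((hsm w).1 (hl w hw)).1
  have hBne : ∀ z ∈ Metric.ball (0 : ℂ) R, B z ≠ 0 := by
    intro z hz hBz
    have hz' : ‖z‖ < R := by simpa using hz
    obtain ⟨w, hw, h⟩ := Multiset.mem_map.1 (Multiset.prod_eq_zero_iff.1 hBz)
    rw [div_eq_zero_iff, or_iff_left hR', sub_eq_zero] at h
    have : R ^ 2 = ‖w‖ * ‖z‖ := by
      have := congrArg norm h
      simpa [abs_of_pos hR] using this
    nlinarith [hlt w hw, norm_nonneg z, norm_nonneg w]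
  set G₁ : ℂ → ℂ := fun z => B z * H z with hG₁
  have hG₁d : Differentiable ℂ G₁ := hBd.mul hH
  have hG₁0 : ‖G 0‖ ≤ ‖G₁ 0‖ := by
    rw [hGH 0, norm_mul, hG₁, norm_mul]
    gcongr
  have hfr : frontier (Metric.ball (0 : ℂ) R) ⊆ {z | ‖z‖ = R} := by
    intro z hz
    simpa using Metric.frontier_ball_subset_sphere hz
  have hG₁le : ∀ z ∈ closure (Metric.ball (0 : ℂ) R), ‖G₁ z‖ ≤ ‖G 0‖ * Real.exp M := fun z hz =>
    Complex.norm_le_of_forall_mem_frontier_norm_le Metric.isBounded_ball hG₁d.diffContOnCl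
      (fun z hz => by
        have h1 := hGR z (hfr hz)
        rw [hGH z, norm_mul, ← hBnorm z (hfr hz), ← norm_mul] at h1
        exact h1) hz
  have hF₁le : ∀ z ∈ closure (Metric.ball (0 : ℂ) R), ‖E z * G₁ z‖ ≤ ‖G 0‖ * Real.exp M :=
    fun z hz =>
    Complex.norm_le_of_forall_mem_frontier_norm_le Metric.isBounded_ball
      (hE.mul hG₁d).diffContOnCl
      (fun z hz => by
        have h1 := hFR z (hfr hz)
        rw [hF z, hGH z, norm_mul, norm_mul, ← hBnorm z (hfr hz), ← norm_mul, ← norm_mul] at h1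
        exact h1) hz
  have hzb : z ∈ Metric.ball (0 : ℂ) R := by simpa using lt_of_le_of_lt hz (by linarith)
  have hlow := norm_le_norm_mul_exp_of_zeroFree hG₁d hR
    (fun z hz => mul_ne_zero (hBne z hz) (hHne z (by simpa using (Metric.mem_ball.1 hz).le))) hM
    (fun z hz => (hG₁le z (subset_closure hz)).trans (by gcongr)) hz
  have hup := hF₁le z (subset_closure hzb)
  rw [norm_mul] at hup
  have hGpos : 0 < ‖G 0‖ := norm_pos_iff.2 hG0
  have hG₁pos : 0 < ‖G₁ z‖ := by
    by_contra h
    have : ‖G₁ z‖ = 0 := le_antisymm (not_lt.1 h) (norm_nonneg _)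
    rw [this, zero_mul] at hlow
    linarith
  -- The maximum principle for `E * G₁` costs one `M`, the lower bound for the zero-free `G₁` costs
  -- `2 * M`.
  refine le_of_mul_le_mul_right ?_ hG₁pos
  calc ‖E z‖ * ‖G₁ z‖ ≤ ‖G 0‖ * Real.exp M := hup
    _ ≤ (‖G₁ z‖ * Real.exp (2 * M)) * Real.exp M := by gcongr; exact hG₁0.trans hlow
    _ = Real.exp (3 * M) * ‖G₁ z‖ := by
      rw [mul_assoc, ← Real.exp_add]; ring_nf

/-- The disc estimate `norm_quotient_le` is applied around a point `c` where `G` does not vanish,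
with radius `2 ‖z‖ + 1`. Since `√R ≤ 2 √‖z‖ + 1`, the order is preserved; the constant `|log ‖G c‖|`
absorbs the normalization by `‖G c‖`. -/
theorem OrderHalf.of_mul_eq {E F G : ℂ → ℂ} (hE : Differentiable ℂ E) (hF : OrderHalf F)
    (hG : OrderHalf G) (h : ∀ z, F z = E z * G z) (h0 : G ≠ 0) : OrderHalf E := by
  obtain ⟨c, hc⟩ : ∃ x, G x ≠ 0 := Function.ne_iff.1 h0
  have hc' : 0 < ‖G c‖ := norm_pos_iff.2 hc
  suffices hs : OrderHalf fun z => E (z + c) by simpa using hs.comp_add (-c)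
  obtain ⟨A, hA, hFA⟩ := (hF.comp_add c).growth
  obtain ⟨D, hD, hGD⟩ := (hG.comp_add c).growth
  set a := |Real.log ‖G c‖| with ha
  refine ⟨hE.comp (differentiable_id.add_const c), 3 * (3 * (A + D) + a + 1), by positivity,
    fun z => ?_⟩
  set R := 2 * ‖z‖ + 1 with hR
  have hz0 := norm_nonneg z
  have hlog : 1 ≤ ‖G c‖ * Real.exp a := by
    calc (1 : ℝ) = ‖G c‖ * Real.exp (-Real.log ‖G c‖) := by
          rw [Real.exp_neg, Real.exp_log hc', mul_inv_cancel₀ hc'.ne']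
      _ ≤ _ := by gcongr; exact neg_le_abs _
  have hsq : √R ≤ 2 * √‖z‖ + 1 := by
    rw [Real.sqrt_le_iff]
    exact ⟨by positivity, by nlinarith [Real.sq_sqrt hz0, Real.sqrt_nonneg ‖z‖]⟩
  have hbound : ∀ K : ℝ, 0 ≤ K → K ≤ A + D → Real.exp (K * (1 + √R)) ≤
      ‖G c‖ * Real.exp ((3 * (A + D) + a + 1) * (1 + √‖z‖)) := by
    intro K hK hK'
    calc Real.exp (K * (1 + √R)) ≤ (‖G c‖ * Real.exp a) * Real.exp (K * (1 + √R)) := by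
          nlinarith [Real.exp_pos (K * (1 + √R))]
      _ = ‖G c‖ * Real.exp (a + K * (1 + √R)) := by rw [Real.exp_add]; ring
      _ ≤ _ := by
        gcongr
        have ha0 : 0 ≤ a := abs_nonneg _
        have hs0 := Real.sqrt_nonneg ‖z‖
        have h1 : K * (1 + √R) ≤ (A + D) * (2 * √‖z‖ + 2) := by
          apply mul_le_mul hK' (by linarith) (by positivity) (by positivity)
        nlinarith [mul_nonneg ha0 hs0, mul_nonneg hA hs0, mul_nonneg hD hs0]
  have := norm_quotient_le (E := fun z => E (z + c)) (F := fun z => F (z + c))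
    (G := fun z => G (z + c)) (hE.comp (differentiable_id.add_const c))
    (hG.differentiable.comp (differentiable_id.add_const c)) (fun z => h _) (by simpa using hc)
    (R := R) (M := (3 * (A + D) + a + 1) * (1 + √‖z‖)) (by positivity) (by positivity)
    (fun w hw => by
      rw [zero_add]
      exact (hFA w).trans (by rw [hw]; exact hbound A hA (by linarith)))
    (fun w hw => by
      rw [zero_add]
      exact (hGD w).trans (by rw [hw]; exact hbound D hD (by linarith)))
    (z := z) (by rw [hR]; linarith)
  rwa [← mul_assoc] at this

theorem OrderHalf.multiset_prod (l : Multiset ℂ) :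
    OrderHalf fun z => (l.map fun w => z - w).prod := by
  induction l using Multiset.induction_on with
  | empty => simpa using OrderHalf.const 1
  | cons a l ih =>
    simp only [Multiset.map_cons, Multiset.prod_cons]
    exact (OrderHalf.id.sub (.const a)).mul ih

/-- An entire function of order at most `1 / 2` which grows faster than any polynomial on two
opposite rays has infinitely many zeros. -/
theorem OrderHalf.infinite_zeros {f : ℂ → ℂ} (hf : OrderHalf f) {u : ℂ} (hu : u ≠ 0)
    (h1 : ∀ n : ℕ, Tendsto (fun t : ℝ => (t : ℂ) ^ n / f (u * t ^ 2)) atTop (𝓝 0))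
    (h2 : ∀ n : ℕ, Tendsto (fun t : ℝ => (t : ℂ) ^ n / f (-u * t ^ 2)) atTop (𝓝 0))
    (h0 : f ≠ 0) : {z | f z = 0}.Infinite := by
  intro hfin
  obtain ⟨l, H, hl, hH, hfH, hHs⟩ := exists_eq_prod_mul_of_finset hf.differentiable h0 hfin.toFinset
  have hHne : ∀ z, H z ≠ 0 := by
    intro z h
    exact hHs z (by simp [hfH z, h]) h
  -- If there were finitely many zeros, `f` would be a polynomial times a zero-free `H`, and `1 / H
  -- = polynomial / f` would have order `1 / 2` and tend to `0` along both rays, hence vanish.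
  have hInv : OrderHalf fun z => (H z)⁻¹ := by
    refine OrderHalf.of_mul_eq (hH.inv hHne) (OrderHalf.multiset_prod l) hf (fun z => ?_) h0
    rw [hfH z]
    field_simp [hHne z]
  have hray : ∀ v : ℂ, v ≠ 0 → (∀ n : ℕ, Tendsto (fun t : ℝ => (t : ℂ) ^ n / f (v * t ^ 2)) atTop (𝓝 0)) →
      Tendsto (fun t : ℝ => (H (v * t ^ 2))⁻¹) atTop (𝓝 0) := by
    intro v hv0 hv
    have hprod : ∀ (m : Multiset ℂ) (n : ℕ), Tendsto (fun t : ℝ =>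
        (t : ℂ) ^ n * (m.map fun w => v * t ^ 2 - w).prod / f (v * t ^ 2)) atTop (𝓝 0) := by
      intro m
      induction m using Multiset.induction_on with
      | empty => simpa using hv
      | cons a m ih =>
        intro n
        have := ((ih (n + 2)).const_mul v).sub ((ih n).const_mul a)
        simp only [mul_zero, sub_zero] at this
        refine this.congr fun t => ?_
        simp only [Multiset.map_cons, Multiset.prod_cons]
        ring
    have hne : ∀ᶠ t : ℝ in atTop, f (v * t ^ 2) ≠ 0 := by
      obtain ⟨D, hD⟩ := isBounded_iff_forall_norm_le.1 hfin.isBounded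
      have h3 : Tendsto (fun t : ℝ => ‖v‖ * t ^ 2) atTop atTop :=
        (tendsto_pow_atTop two_ne_zero).const_mul_atTop (norm_pos_iff.2 hv0)
      filter_upwards [h3.eventually_gt_atTop D] with t ht hft
      have := hD _ hft
      rw [norm_mul, norm_pow, Complex.norm_real, Real.norm_eq_abs, sq_abs] at this
      linarith
    refine (hprod l 0).congr' ?_
    filter_upwards [hne] with t ht
    rw [hfH] at ht ⊢
    have := left_ne_zero_of_mul ht
    have := hHne (v * t ^ 2)
    field_simp
  have hz := hInv.eq_zero_of_tendsto hu (hray u hu h1) (hray (-u) (neg_ne_zero.2 hu) h2) 0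
  exact hHne 0 (inv_eq_zero.1 hz)

/-! ### Absolutely continuous functions and their integrals -/

section AbsolutelyContinuous

variable {f g : ℝ → ℂ} {α β : ℝ}

theorem AbsolutelyContinuousOnInterval.congr (hf : AbsolutelyContinuousOnInterval f α β)
    (h : EqOn f g (uIcc α β)) : AbsolutelyContinuousOnInterval g α β := by
  rw [absolutelyContinuousOnInterval_iff] at hf ⊢
  intro ε hε
  obtain ⟨δ, hδ, H⟩ := hf ε hε
  refine ⟨δ, hδ, fun E hE hs => ?_⟩
  have := H E hE hs
  rwa [Finset.sum_congr rfl fun i hi => by rw [h (hE.1 i hi).1, h (hE.1 i hi).2]] at this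

/-- Increments of the integral of `f` are dominated by those of the integral of the real function
`‖f‖`. -/
theorem IntervalIntegrable.absolutelyContinuousOnInterval_complex
    (hf : IntervalIntegrable f volume α β) (c : ℂ) :
    AbsolutelyContinuousOnInterval (fun x => c + ∫ t in α..x, f t) α β := by
  have h := hf.norm.absolutelyContinuousOnInterval_intervalIntegral (c := α) left_mem_uIcc
  rw [absolutelyContinuousOnInterval_iff] at h ⊢
  intro ε hε
  obtain ⟨δ, hδ, H⟩ := h ε hε
  refine ⟨δ, hδ, fun E hE hs => lt_of_le_of_lt (Finset.sum_le_sum fun i hi => ?_) (H E hE hs)⟩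
  have hsub : ∀ {x y}, x ∈ uIcc α β → y ∈ uIcc α β → IntervalIntegrable f volume x y :=
    fun hx hy => hf.mono_set (uIcc_subset_uIcc hx hy)
  have h1 := (hE.1 i hi).1
  have h2 := (hE.1 i hi).2
  rw [dist_add_left, dist_eq_norm, dist_eq_norm,
    intervalIntegral.integral_interval_sub_left (hsub left_mem_uIcc h1) (hsub left_mem_uIcc h2),
    intervalIntegral.integral_interval_sub_left (hsub left_mem_uIcc h1).norm
      (hsub left_mem_uIcc h2).norm, Real.norm_eq_abs]
  exact intervalIntegral.norm_integral_le_abs_integral_norm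

theorem IntervalIntegrable.ae_hasDerivAt_add_integral (hab : α ≤ β)
    (hf : IntervalIntegrable f volume α β) (c : ℂ) :
    ∀ᵐ x ∂(volume.restrict (Ioo α β)), HasDerivAt (fun x => c + ∫ t in α..x, f t) (f x) x := by
  rw [ae_restrict_iff' measurableSet_Ioo]
  filter_upwards [hf.ae_hasDerivAt_integral] with x hx hxI
  exact (hx (by rw [uIcc_of_le hab]; exact Ioo_subset_Icc_self hxI) α left_mem_uIcc).const_add c

/-- The difference of `f` and the primitive of `g` is absolutely continuous with derivative zero
almost everywhere, hence constant. -/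
theorem AbsolutelyContinuousOnInterval.eq_add_integral (hab : α ≤ β)
    (hf : AbsolutelyContinuousOnInterval f α β) (hg : IntervalIntegrable g volume α β)
    (hd : ∀ᵐ x ∂(volume.restrict (Ioo α β)), HasDerivAt f (g x) x) :
    ∀ x ∈ Icc α β, f x = f α + ∫ t in α..x, g t := by
  have h1 := hf.sub (hg.absolutelyContinuousOnInterval_complex 0)
  obtain ⟨C, hC⟩ := h1.const_of_ae_hasDerivAt_zero (by
    have h2 := hg.ae_hasDerivAt_add_integral hab 0
    rw [ae_restrict_iff' measurableSet_Ioo] at hd h2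
    filter_upwards [hd, h2, compl_mem_ae_iff.2 (measure_singleton α),
      compl_mem_ae_iff.2 (measure_singleton β)] with x hx1 hx2 hx3 hx4 hx
    rw [uIcc_of_le hab] at hx
    have hxI : x ∈ Ioo α β := ⟨lt_of_le_of_ne hx.1 (Ne.symm hx3), lt_of_le_of_ne hx.2 hx4⟩
    simpa using (hx1 hxI).sub (hx2 hxI))
  intro x hx
  rw [← uIcc_of_le hab] at hx
  have e1 := hC x hx
  have e2 := hC α left_mem_uIcc
  simp only [Pi.sub_apply, zero_add, intervalIntegral.integral_same, sub_zero] at e1 e2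
  rw [e2, ← e1]
  ring

/-- A `C¹` function is the integral of its derivative. -/
theorem eq_add_integral_of_hasDerivWithinAt
    (hd : ∀ x ∈ Icc α β, HasDerivWithinAt f (g x) (Icc α β) x) (hg : ContinuousOn g (Icc α β)) :
    ∀ x ∈ Icc α β, f x = f α + ∫ t in α..x, g t := by
  intro x hx
  have hsub : Icc α x ⊆ Icc α β := Icc_subset_Icc_right hx.2
  have hc : ContinuousOn f (Icc α x) := fun z hz => (hd z (hsub hz)).continuousWithinAt.mono hsub
  rw [intervalIntegral.integral_eq_sub_of_hasDerivAt_of_le hx.1 hc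
    (fun z hz => (hd z (hsub (Ioo_subset_Icc_self hz))).hasDerivAt
      (Icc_mem_nhds hz.1 (hz.2.trans_le hx.2)))
    ((hg.mono hsub).intervalIntegrable_of_Icc hx.1)]
  ring

theorem absolutelyContinuousOnInterval_of_hasDerivWithinAt (hab : α ≤ β)
    (hd : ∀ x ∈ Icc α β, HasDerivWithinAt f (g x) (Icc α β) x) (hg : ContinuousOn g (Icc α β)) :
    AbsolutelyContinuousOnInterval f α β :=
  ((hg.intervalIntegrable_of_Icc hab).absolutelyContinuousOnInterval_complex (f α)).congr
    fun x hx => (eq_add_integral_of_hasDerivWithinAt hd hg x (by rwa [← uIcc_of_le hab])).symm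

theorem hasDerivWithinAt_add_integral (hab : α ≤ β) (hg : ContinuousOn g (Icc α β)) (c : ℂ) :
    ∀ x ∈ Icc α β, HasDerivWithinAt (fun x => c + ∫ t in α..x, g t) (g x) (Icc α β) x := by
  intro x hx
  have hgi : IntervalIntegrable g volume α β := hg.intervalIntegrable_of_Icc hab
  have : Fact (x ∈ Icc α β) := ⟨hx⟩
  refine HasDerivWithinAt.const_add c ?_
  exact intervalIntegral.integral_hasDerivWithinAt_right
    (hgi.mono_set (uIcc_subset_uIcc left_mem_uIcc (by rwa [uIcc_of_le hab])))
    (hg.stronglyMeasurableAtFilter_nhdsWithin measurableSet_Icc x) (hg x hx)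

end AbsolutelyContinuous

theorem hasDerivAt_ofReal_sub (α x : ℝ) :
    HasDerivAt (fun x : ℝ => ((x - α : ℝ) : ℂ)) 1 x := by
  have h : HasDerivAt (fun x : ℝ => x - α) 1 x := (hasDerivAt_id' x).sub_const α
  simpa using h.ofReal_comp

/-- Integration by parts: `(x - α) ∫ g - ∫ (t - α) g` is absolutely continuous with derivative `∫
g`. This links the second-order Volterra equation to the equation for the derivative. -/
theorem integral_sub_mul_eq_integral_integral {g : ℝ → ℂ} {α β : ℝ} (hab : α ≤ β)
    (hg : IntervalIntegrable g volume α β) {x : ℝ} (hx : x ∈ Icc α β) :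
    ∫ t in α..x, ((x - t : ℝ) : ℂ) * g t = ∫ t in α..x, ∫ s in α..t, g s := by
  have hx' : x ∈ uIcc α β := by rwa [uIcc_of_le hab]
  have hsub : ∀ {k : ℝ → ℂ}, IntervalIntegrable k volume α β → IntervalIntegrable k volume α x :=
    fun hk => hk.mono_set (uIcc_subset_uIcc left_mem_uIcc hx')
  have hti : IntervalIntegrable (fun t : ℝ => ((t - α : ℝ) : ℂ) * g t) volume α β :=
    hg.continuousOn_mul (by fun_prop)
  have hac := hg.absolutelyContinuousOnInterval_complex 0
  have hac' := hti.absolutelyContinuousOnInterval_complex 0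
  have hae := hg.ae_hasDerivAt_add_integral hab 0
  have hae' := hti.ae_hasDerivAt_add_integral hab 0
  have hlin : AbsolutelyContinuousOnInterval (fun x : ℝ => ((x - α : ℝ) : ℂ)) α β :=
    absolutelyContinuousOnInterval_of_hasDerivWithinAt (g := fun _ => 1) hab
      (fun x _ => (hasDerivAt_ofReal_sub α x).hasDerivWithinAt) continuousOn_const
  set G : ℝ → ℂ := fun x => 0 + ∫ t in α..x, g t with hG
  set K : ℝ → ℂ := fun x => 0 + ∫ t in α..x, ((t - α : ℝ) : ℂ) * g t with hK
  have hGi : IntervalIntegrable G volume α β := by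
    refine ContinuousOn.intervalIntegrable_of_Icc hab ?_
    simpa [uIcc_of_le hab] using hac.continuousOn
  have h1 : AbsolutelyContinuousOnInterval (fun x : ℝ => ((x - α : ℝ) : ℂ) * G x - K x) α β :=
    (hlin.smul hac).sub hac'
  have h2 := h1.eq_add_integral (g := G) hab hGi (by
    filter_upwards [hae, hae'] with t h3 h4
    exact (((hasDerivAt_ofReal_sub α t).mul h3).sub h4).congr_deriv (by ring)) x hx
  simp only [hG, hK, intervalIntegral.integral_same, sub_self, Complex.ofReal_zero, zero_mul,
    zero_add] at h2
  rw [← h2, ← intervalIntegral.integral_const_mul, ← intervalIntegral.integral_sub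
    ((hsub hg).const_mul _) (hsub hti)]
  refine intervalIntegral.integral_congr fun t _ => ?_
  push_cast
  ring

/-! ### Carathéodory solutions on an interval with constant weight -/

/-- `y`, with derivative `dy`, solves `y'' = (q - w) y` on `[α, β]`. -/
structure Sol (q : ℝ → ℂ) (w : ℂ) (α β : ℝ) (y dy : ℝ → ℂ) : Prop where
  hasDeriv : ∀ x ∈ Icc α β, HasDerivWithinAt y (dy x) (Icc α β) x
  absCont : AbsolutelyContinuousOnInterval dy α β
  equation : ∀ᵐ x ∂(volume.restrict (Ioo α β)), HasDerivAt dy ((q x - w) * y x) x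

namespace Sol

variable {q p : ℝ → ℂ} {w : ℂ} {α β : ℝ} {y dy z dz : ℝ → ℂ}

theorem continuousOn (h : Sol q w α β y dy) : ContinuousOn y (Icc α β) :=
  fun x hx => (h.hasDeriv x hx).continuousWithinAt

theorem continuousOn_deriv (hab : α ≤ β) (h : Sol q w α β y dy) : ContinuousOn dy (Icc α β) := by
  simpa [uIcc_of_le hab] using h.absCont.continuousOn

theorem hasDerivAt (h : Sol q w α β y dy) {x : ℝ} (hx : x ∈ Ioo α β) : HasDerivAt y (dy x) x :=
  (h.hasDeriv x (Ioo_subset_Icc_self hx)).hasDerivAt (Icc_mem_nhds hx.1 hx.2)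

theorem absCont_self (hab : α ≤ β) (h : Sol q w α β y dy) :
    AbsolutelyContinuousOnInterval y α β :=
  absolutelyContinuousOnInterval_of_hasDerivWithinAt hab h.hasDeriv (h.continuousOn_deriv hab)

theorem intervalIntegrable (hab : α ≤ β) (hq : IntervalIntegrable q volume α β)
    (h : Sol q w α β y dy) : IntervalIntegrable (fun x => (q x - w) * y x) volume α β :=
  (hq.sub intervalIntegrable_const).mul_continuousOn (by rw [uIcc_of_le hab]; exact h.continuousOn)

theorem lin (h : Sol q w α β y dy) (h' : Sol q w α β z dz) (c d : ℂ) :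
    Sol q w α β (fun x => c * y x + d * z x) (fun x => c * dy x + d * dz x) where
  hasDeriv x hx := ((h.hasDeriv x hx).const_mul c).add ((h'.hasDeriv x hx).const_mul d)
  absCont := (h.absCont.const_smul c).add (h'.absCont.const_smul d)
  equation := by
    filter_upwards [h.equation, h'.equation] with x h1 h2
    exact ((h1.const_mul c).add (h2.const_mul d)).congr_deriv (by ring)

theorem congr_ae (h : Sol q w α β y dy) (hqp : q =ᵐ[volume.restrict (Ioo α β)] p) :
    Sol p w α β y dy where
  hasDeriv := h.hasDeriv
  absCont := h.absCont
  equation := by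
    filter_upwards [h.equation, hqp] with x h1 h2
    rwa [← h2]

theorem mono (h : Sol q w α β y dy) {a b : ℝ} (ha : α ≤ a) (hab : a ≤ b) (hb : b ≤ β) :
    Sol q w a b y dy where
  hasDeriv x hx := (h.hasDeriv x (Icc_subset_Icc ha hb hx)).mono (Icc_subset_Icc ha hb)
  absCont := h.absCont.mono (by
    rw [uIcc_of_le hab, uIcc_of_le (ha.trans (hab.trans hb))]; exact Icc_subset_Icc ha hb)
  equation := ae_mono (Measure.restrict_mono (Ioo_subset_Ioo ha hb) le_rfl) h.equation

/-- Constancy of the Wronskian. -/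
theorem wronskian (hab : α ≤ β) (h : Sol q w α β y dy) (h' : Sol q w α β z dz) :
    ∀ x ∈ Icc α β, y x * dz x - z x * dy x = y α * dz α - z α * dy α := by
  have hac : AbsolutelyContinuousOnInterval (fun x => y x * dz x - z x * dy x) α β :=
    ((h.absCont_self hab).smul h'.absCont).sub ((h'.absCont_self hab).smul h.absCont)
  intro x hx
  have := hac.eq_add_integral (g := fun _ => 0) hab intervalIntegrable_const (by
    have hm : ∀ᵐ x ∂(volume.restrict (Ioo α β)), x ∈ Ioo α β := ae_restrict_mem measurableSet_Ioo
    filter_upwards [h.equation, h'.equation, hm] with x h1 h2 hx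
    exact (((h.hasDerivAt hx).mul h2).sub ((h'.hasDerivAt hx).mul h1)).congr_deriv (by ring)) x hx
  simpa using this

theorem deriv_eq (hab : α ≤ β) (hq : IntervalIntegrable q volume α β) (h : Sol q w α β y dy) :
    ∀ x ∈ Icc α β, dy x = dy α + ∫ t in α..x, (q t - w) * y t :=
  h.absCont.eq_add_integral hab (h.intervalIntegrable hab hq) h.equation

/-- Construction of a solution from an integrated equation. -/
theorem of_integral (hab : α ≤ β) (hq : IntervalIntegrable q volume α β)
    (hy : ContinuousOn y (Icc α β)) {c₀ c₁ : ℂ}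
    (hint : ∀ x ∈ Icc α β, y x = c₀ + c₁ * ((x - α : ℝ) : ℂ)
      + ∫ t in α..x, ((x - t : ℝ) : ℂ) * ((q t - w) * y t)) :
    Sol q w α β y (fun x => c₁ + ∫ t in α..x, (q t - w) * y t) := by
  have hgi : IntervalIntegrable (fun t => (q t - w) * y t) volume α β :=
    (hq.sub intervalIntegrable_const).mul_continuousOn (by rwa [uIcc_of_le hab])
  have hac := hgi.absolutelyContinuousOnInterval_complex c₁
  have hac0 := hgi.absolutelyContinuousOnInterval_complex 0
  have hdc : ContinuousOn (fun x => c₁ + ∫ t in α..x, (q t - w) * y t) (Icc α β) := by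
    simpa [uIcc_of_le hab] using hac.continuousOn
  have hdc0 : ContinuousOn (fun x => ∫ t in α..x, (q t - w) * y t) (Icc α β) := by
    simpa [uIcc_of_le hab] using hac0.continuousOn
  have key : ∀ x ∈ Icc α β, y x = c₀ + ∫ t in α..x, (c₁ + ∫ s in α..t, (q s - w) * y s) := by
    intro x hx
    have hsub : Icc α x ⊆ Icc α β := Icc_subset_Icc_right hx.2
    rw [hint x hx, integral_sub_mul_eq_integral_integral hab hgi hx,
      intervalIntegral.integral_add intervalIntegrable_const
        ((hdc0.mono hsub).intervalIntegrable_of_Icc hx.1), intervalIntegral.integral_const,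
      Complex.real_smul]
    ring
  refine ⟨fun x hx => ?_, hac, hgi.ae_hasDerivAt_add_integral hab c₁⟩
  exact (hasDerivWithinAt_add_integral hab hdc c₀ x hx).congr key (key x hx)

end Sol

/-! ### Existence and holomorphy in the spectral parameter -/

open scoped BoundedContinuousFunction

/-- The kernel `u ↦ u⁺ exp (-N u⁺)`. -/
noncomputable def rampKernel (N u : ℝ) : ℝ := max u 0 * Real.exp (-(N * max u 0))

theorem continuous_rampKernel (N : ℝ) : Continuous (rampKernel N) := by
  unfold rampKernel
  fun_prop

theorem rampKernel_nonneg (N u : ℝ) : 0 ≤ rampKernel N u := by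
  unfold rampKernel
  positivity

theorem rampKernel_le {N : ℝ} (hN : 0 < N) (u : ℝ) : rampKernel N u ≤ 1 / N := by
  unfold rampKernel
  have h := Real.add_one_le_exp (N * max u 0)
  rw [Real.exp_neg, ← div_eq_mul_inv, div_le_div_iff₀ (Real.exp_pos _) hN]
  linarith

theorem rampKernel_of_nonpos (N : ℝ) {u : ℝ} (hu : u ≤ 0) : rampKernel N u = 0 := by
  simp [rampKernel, hu]

theorem rampKernel_of_nonneg (N : ℝ) {u : ℝ} (hu : 0 ≤ u) :
    rampKernel N u = u * Real.exp (-(N * u)) := by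
  simp [rampKernel, hu]

/-- The kernel is at most `1 / N`, so the weight `exp (-N ·)` makes the operator norm as small as
desired without iterating. Clipping `x` to `[α, β]` makes the image a bounded continuous function on
the whole line. -/
theorem exists_volterra {p : ℝ → ℂ} {α β : ℝ} (hab : α ≤ β) (hp : IntervalIntegrable p volume α β)
    {N : ℝ} (hN : 0 < N) : ∃ K : (ℝ →ᵇ ℂ) →L[ℂ] (ℝ →ᵇ ℂ),
      ‖K‖ ≤ 1 / N * ∫ t in α..β, ‖p t‖ ∧ ∀ (y : ℝ →ᵇ ℂ) (x : ℝ), K y x =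
        ∫ t in α..β, (rampKernel N (max α (min x β) - t) : ℂ) * (p t * y t) := by
  have hpy : ∀ y : ℝ →ᵇ ℂ, IntervalIntegrable (fun t => p t * y t) volume α β :=
    fun y => hp.mul_continuousOn y.continuous.continuousOn
  have hk : ∀ x : ℝ, Continuous fun t => (rampKernel N (max α (min x β) - t) : ℂ) := fun x =>
    Complex.continuous_ofReal.comp ((continuous_rampKernel N).comp (by fun_prop))
  have hint : ∀ (y : ℝ →ᵇ ℂ) (x : ℝ), IntervalIntegrable (fun t =>
      (rampKernel N (max α (min x β) - t) : ℂ) * (p t * y t)) volume α β := fun y x =>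
    (hpy y).continuousOn_mul (hk x).continuousOn
  have hb : ∀ (y : ℝ →ᵇ ℂ) (x t : ℝ), ‖(rampKernel N (max α (min x β) - t) : ℂ) * (p t * y t)‖ ≤
      1 / N * (‖p t‖ * ‖y‖) := fun y x t => by
    rw [norm_mul, norm_mul, Complex.norm_real, Real.norm_of_nonneg (rampKernel_nonneg _ _)]
    gcongr
    · exact rampKernel_le hN _
    · exact y.norm_coe_le_norm t
  have hbi : ∀ y : ℝ →ᵇ ℂ, IntervalIntegrable (fun t => 1 / N * (‖p t‖ * ‖y‖)) volume α β :=
    fun y => (hp.norm.mul_const _).const_mul _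
  have hbound : ∀ (y : ℝ →ᵇ ℂ) (x : ℝ), ‖∫ t in α..β,
      (rampKernel N (max α (min x β) - t) : ℂ) * (p t * y t)‖
        ≤ (1 / N * ∫ t in α..β, ‖p t‖) * ‖y‖ := fun y x => by
    refine (intervalIntegral.norm_integral_le_of_norm_le hab
      (Eventually.of_forall fun t _ => hb y x t) (hbi y)).trans (le_of_eq ?_)
    rw [intervalIntegral.integral_const_mul, intervalIntegral.integral_mul_const, mul_assoc]
  have hcont : ∀ y : ℝ →ᵇ ℂ, Continuous fun x => ∫ t in α..β,
      (rampKernel N (max α (min x β) - t) : ℂ) * (p t * y t) := fun y => by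
    refine intervalIntegral.continuous_of_dominated_interval
      (bound := fun t => 1 / N * (‖p t‖ * ‖y‖)) (fun x => ?_)
      (fun x => Eventually.of_forall fun t _ => hb y x t) (hbi y)
      (Eventually.of_forall fun t _ => ?_)
    · exact (hint y x).def'.aestronglyMeasurable
    · exact (Complex.continuous_ofReal.comp ((continuous_rampKernel N).comp (by fun_prop))).mul
        continuous_const
  have hnn : 0 ≤ ∫ t in α..β, ‖p t‖ :=
    intervalIntegral.integral_nonneg hab fun _ _ => norm_nonneg _
  let K₀ : (ℝ →ᵇ ℂ) →ₗ[ℂ] (ℝ →ᵇ ℂ) :=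
    { toFun := fun y => BoundedContinuousFunction.ofNormedAddCommGroup _ (hcont y) _ (hbound y)
      map_add' := fun y z => by
        ext x
        simp only [BoundedContinuousFunction.coe_ofNormedAddCommGroup,
          BoundedContinuousFunction.coe_add, Pi.add_apply]
        rw [← intervalIntegral.integral_add (hint y x) (hint z x)]
        refine intervalIntegral.integral_congr fun t _ => ?_
        ring
      map_smul' := fun c y => by
        ext x
        simp only [BoundedContinuousFunction.coe_ofNormedAddCommGroup,
          BoundedContinuousFunction.coe_smul, smul_eq_mul, RingHom.id_apply]
        rw [← intervalIntegral.integral_const_mul]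
        refine intervalIntegral.integral_congr fun t _ => ?_
        ring }
  refine ⟨K₀.mkContinuous (1 / N * ∫ t in α..β, ‖p t‖) fun y => ?_,
    LinearMap.mkContinuous_norm_le _ (by positivity) _, fun y x => rfl⟩
  exact (BoundedContinuousFunction.norm_le (by positivity)).2 (hbound y)

/-- Composed with a holomorphic family of functions, such a functional gives a holomorphic function;
this is how derivatives of solutions are seen to be holomorphic in the parameter. -/
theorem exists_integral_functional {p : ℝ → ℂ} {α x : ℝ} (hab : α ≤ x)
    (hp : IntervalIntegrable p volume α x) :
    ∃ F : (ℝ →ᵇ ℂ) →L[ℂ] ℂ, ∀ y : ℝ →ᵇ ℂ, F y = ∫ t in α..x, p t * y t := by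
  have hpy : ∀ y : ℝ →ᵇ ℂ, IntervalIntegrable (fun t => p t * y t) volume α x :=
    fun y => hp.mul_continuousOn y.continuous.continuousOn
  let F₀ : (ℝ →ᵇ ℂ) →ₗ[ℂ] ℂ :=
    { toFun := fun y => ∫ t in α..x, p t * y t
      map_add' := fun y z => by
        rw [← intervalIntegral.integral_add (hpy y) (hpy z)]
        refine intervalIntegral.integral_congr fun t _ => ?_
        simp only [BoundedContinuousFunction.coe_add, Pi.add_apply]
        ring
      map_smul' := fun c y => by
        rw [RingHom.id_apply, smul_eq_mul, ← intervalIntegral.integral_const_mul]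
        refine intervalIntegral.integral_congr fun t _ => ?_
        simp only [BoundedContinuousFunction.coe_smul, smul_eq_mul]
        ring }
  refine ⟨F₀.mkContinuous (∫ t in α..x, ‖p t‖) fun y => ?_, fun y => rfl⟩
  rw [← intervalIntegral.integral_mul_const]
  refine intervalIntegral.norm_integral_le_of_norm_le hab
    (Eventually.of_forall fun t _ => ?_) (hp.norm.mul_const _)
  rw [norm_mul]
  gcongr
  exact y.norm_coe_le_norm t

theorem integral_rampKernel {g : ℝ → ℂ} {α β N : ℝ} (hg : IntervalIntegrable g volume α β)
    {x : ℝ} (hx : x ∈ Icc α β) :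
    ∫ t in α..β, (rampKernel N (x - t) : ℂ) * g t =
      ∫ t in α..x, ((x - t : ℝ) : ℂ) * (Complex.exp (-(N * (x - t : ℝ))) * g t) := by
  have hab := hx.1.trans hx.2
  have hk : Continuous fun t => (rampKernel N (x - t) : ℂ) :=
    Complex.continuous_ofReal.comp ((continuous_rampKernel N).comp (by fun_prop))
  have hi := hg.continuousOn_mul hk.continuousOn
  have hx' : x ∈ uIcc α β := by rwa [uIcc_of_le hab]
  rw [← intervalIntegral.integral_add_adjacent_intervals
    (hi.mono_set (uIcc_subset_uIcc left_mem_uIcc hx'))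
    (hi.mono_set (uIcc_subset_uIcc hx' right_mem_uIcc))]
  have h2 : ∫ t in x..β, (rampKernel N (x - t) : ℂ) * g t = 0 := by
    rw [intervalIntegral.integral_congr (g := fun _ => 0)]
    · simp
    · intro t ht
      rw [uIcc_of_le hx.2] at ht
      simp [rampKernel_of_nonpos N (sub_nonpos.2 ht.1)]
  rw [h2, add_zero]
  refine intervalIntegral.integral_congr fun t ht => ?_
  rw [uIcc_of_le hx.1] at ht
  simp only [rampKernel_of_nonneg N (sub_nonneg.2 ht.2)]
  push_cast
  ring

/-- Holomorphic dependence on the parameter for the equation `z = f + K z - w J z`. -/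
theorem exists_fixedPoint_near {E : Type*} [NormedAddCommGroup E] [NormedSpace ℂ E] [CompleteSpace E]
    (K J : E →L[ℂ] E) {w₀ : ℂ} (h : ‖K‖ + ‖w₀‖ * ‖J‖ < 1) (f : E) :
    ∃ Z : ℂ → E, DifferentiableAt ℂ Z w₀ ∧ ∀ᶠ w in 𝓝 w₀, Z w = f + (K (Z w) - w • J (Z w)) := by
  have hnorm : ‖K - w₀ • J‖ < 1 := (norm_sub_le _ _).trans_lt (by rwa [norm_smul])
  set S : ℂ → (E →L[ℂ] E) := fun w => 1 - (K - w • J) with hS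
  have hSd : Differentiable ℂ S :=
    (differentiable_const _).sub ((differentiable_const _).sub (differentiable_id.smul_const J))
  have hunit : IsUnit (S w₀) := isUnit_one_sub_of_norm_lt_one hnorm
  have hev : ∀ᶠ w in 𝓝 w₀, IsUnit (S w) :=
    hSd.continuous.continuousAt.eventually (Units.isOpen.mem_nhds hunit)
  refine ⟨fun w => Ring.inverse (S w) f, ?_, ?_⟩
  · have h1 : DifferentiableAt ℂ (fun w => Ring.inverse (S w)) w₀ :=
      (differentiableAt_inverse hunit).comp w₀ (hSd w₀)
    exact h1.clm_apply (differentiableAt_const f)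
  · filter_upwards [hev] with w hw
    have h1 := congrArg (fun A : E →L[ℂ] E => A f) (Ring.mul_inverse_cancel _ hw)
    have h2 : Ring.inverse (S w) f - (K (Ring.inverse (S w) f) - w • J (Ring.inverse (S w) f)) = f :=
      h1
    exact sub_eq_iff_eq_add.1 h2

/-- Existence of solutions of the initial value problem, with holomorphic dependence on the
spectral parameter near a given point. -/
theorem exists_sol_near {q : ℝ → ℂ} {α β : ℝ} (hab : α ≤ β)
    (hq : IntervalIntegrable q volume α β) (c₀ c₁ w₀ : ℂ) :
    ∃ Y dY : ℂ → ℝ → ℂ, (∀ᶠ w in 𝓝 w₀, Sol q w α β (Y w) (dY w) ∧ Y w α = c₀ ∧ dY w α = c₁) ∧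
      ∀ x ∈ Icc α β, DifferentiableAt ℂ (fun w => Y w x) w₀ ∧
        DifferentiableAt ℂ (fun w => dY w x) w₀ := by
  set Q := ∫ t in α..β, ‖q t‖ with hQ
  set Q₁ := ∫ t in α..β, ‖(fun _ => (1 : ℂ)) t‖ with hQ₁
  have hQ0 : 0 ≤ Q := intervalIntegral.integral_nonneg hab fun _ _ => norm_nonneg _
  have hQ₁0 : 0 ≤ Q₁ := intervalIntegral.integral_nonneg hab fun _ _ => norm_nonneg _
  -- The weight is tuned to `w₀`, so that the integral operator at `w₀` is a strict contraction;
  -- this is why the construction is only local in the parameter.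
  set N := Q + ‖w₀‖ * Q₁ + 1 with hN
  have hNpos : 0 < N := by positivity
  obtain ⟨K, hKn, hK⟩ := exists_volterra hab hq hNpos
  obtain ⟨J, hJn, hJ⟩ := exists_volterra (p := fun _ => 1) hab intervalIntegrable_const hNpos
  have hnorm : ‖K‖ + ‖w₀‖ * ‖J‖ < 1 := by
    calc ‖K‖ + ‖w₀‖ * ‖J‖ ≤ 1 / N * Q + ‖w₀‖ * (1 / N * Q₁) := by gcongr
      _ = (Q + ‖w₀‖ * Q₁) / N := by ring
      _ < 1 := by rw [div_lt_one hNpos]; linarith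
  have hfc : Continuous fun x : ℝ => Complex.exp (-(N * (max α (min x β) - α : ℝ))) *
      (c₀ + c₁ * ((max α (min x β) - α : ℝ) : ℂ)) := by fun_prop
  have hclip : ∀ x : ℝ, |max α (min x β) - α| ≤ β - α := fun x => by
    rw [abs_of_nonneg (by simp)]
    exact sub_le_sub_right (max_le hab (min_le_right _ _)) _
  have hfb : ∀ x : ℝ, ‖Complex.exp (-(N * (max α (min x β) - α : ℝ))) *
      (c₀ + c₁ * ((max α (min x β) - α : ℝ) : ℂ))‖ ≤ 1 * (‖c₀‖ + ‖c₁‖ * (β - α)) := fun x => by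
    have h0 : 0 ≤ max α (min x β) - α := by simp
    rw [norm_mul]
    gcongr
    · rw [Complex.norm_exp]
      apply Real.exp_le_one_iff.2
      simp only [Complex.neg_re, Complex.re_ofReal_mul, Complex.ofReal_re]
      have := mul_nonneg hNpos.le h0
      linarith
    · refine (norm_add_le _ _).trans ?_
      rw [norm_mul, Complex.norm_real, Real.norm_eq_abs]
      gcongr
      exact hclip x
  set f : ℝ →ᵇ ℂ := BoundedContinuousFunction.ofNormedAddCommGroup _ hfc _ hfb with hf
  obtain ⟨Z, hZd, hev⟩ := exists_fixedPoint_near K J hnorm f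
  -- Undoing the weight: `Z` solves the equation for `exp (-N (x - α)) y`.
  set Y : ℂ → ℝ → ℂ := fun w x => Complex.exp (N * (x - α : ℝ)) * Z w x with hY
  have hYc : ∀ w, Continuous (Y w) := fun w => by
    have := (Z w).continuous
    rw [hY]; fun_prop
  refine ⟨Y, fun w x => c₁ + ∫ t in α..x, (q t - w) * Y w t, ?_, fun x hx => ⟨?_, ?_⟩⟩
  · filter_upwards [hev] with w hw
    have hZw : ∀ x, Z w x = f x + (K (Z w) x - w * J (Z w) x) := by
      intro x
      exact congrArg (fun g : ℝ →ᵇ ℂ => g x) hw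
    have hint : ∀ x ∈ Icc α β, Y w x = c₀ + c₁ * ((x - α : ℝ) : ℂ)
        + ∫ t in α..x, ((x - t : ℝ) : ℂ) * ((q t - w) * Y w t) := by
      intro x hx
      have hcx : max α (min x β) = x := by rw [min_eq_left hx.2, max_eq_right hx.1]
      have hqZ : IntervalIntegrable (fun t => q t * Z w t) volume α β :=
        hq.mul_continuousOn (Z w).continuous.continuousOn
      have h1Z : IntervalIntegrable (fun t => (1 : ℂ) * Z w t) volume α β :=
        (continuous_const.mul (Z w).continuous).intervalIntegrable _ _
      have e1 : K (Z w) x - w * J (Z w) x = ∫ t in α..x, ((x - t : ℝ) : ℂ) *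
          (Complex.exp (-(N * (x - t : ℝ))) * ((q t - w) * Z w t)) := by
        rw [← integral_rampKernel ((hq.sub intervalIntegrable_const).mul_continuousOn
          (Z w).continuous.continuousOn) hx, hK, hJ, hcx, ← intervalIntegral.integral_const_mul,
          ← intervalIntegral.integral_sub]
        · refine intervalIntegral.integral_congr fun t _ => ?_
          ring
        · exact hqZ.continuousOn_mul (Complex.continuous_ofReal.comp
            ((continuous_rampKernel N).comp (by fun_prop))).continuousOn
        · exact (h1Z.continuousOn_mul (Complex.continuous_ofReal.comp
            ((continuous_rampKernel N).comp (by fun_prop))).continuousOn).const_mul _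
      have e2 : f x = Complex.exp (-(N * (x - α : ℝ))) * (c₀ + c₁ * ((x - α : ℝ) : ℂ)) := by
        rw [hf, BoundedContinuousFunction.coe_ofNormedAddCommGroup, hcx]
      simp only [hY]
      rw [hZw x, e1, e2, mul_add, ← mul_assoc, ← Complex.exp_add, add_neg_cancel, Complex.exp_zero,
        one_mul, ← intervalIntegral.integral_const_mul]
      congr 1
      refine intervalIntegral.integral_congr fun t _ => ?_
      have e3 : Complex.exp (N * (t - α : ℝ)) = Complex.exp (N * (x - α : ℝ)) *
          Complex.exp (-(N * (x - t : ℝ))) := by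
        rw [← Complex.exp_add]
        congr 1
        push_cast
        ring
      simp only [e3]
      ring
    refine ⟨Sol.of_integral hab hq (hYc w).continuousOn hint, ?_, by simp⟩
    rw [hint α (left_mem_Icc.2 hab)]
    simp
  · exact ((BoundedContinuousFunction.evalCLM ℂ x).differentiableAt.comp w₀ hZd).const_mul _
  · have hx' : x ∈ uIcc α β := by rwa [uIcc_of_le hab]
    have hqx := hq.mono_set (uIcc_subset_uIcc left_mem_uIcc hx')
    obtain ⟨F, hF⟩ := exists_integral_functional hx.1
      (p := fun t => q t * Complex.exp (N * (t - α : ℝ)))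
      (hqx.mul_continuousOn (by fun_prop))
    obtain ⟨F₁, hF₁⟩ := exists_integral_functional (α := α) (x := x) hx.1
      (p := fun t => Complex.exp (N * (t - α : ℝ)))
      (Continuous.intervalIntegrable (by fun_prop) _ _)
    have e : ∀ w, c₁ + ∫ t in α..x, (q t - w) * Y w t = c₁ + (F (Z w) - w * F₁ (Z w)) := by
      intro w
      rw [hF, hF₁, ← intervalIntegral.integral_const_mul, ← intervalIntegral.integral_sub]
      · congr 1
        refine intervalIntegral.integral_congr fun t _ => ?_
        simp only [hY]
        ring
      · exact (hqx.mul_continuousOn (by fun_prop)).mul_continuousOn (Z w).continuous.continuousOn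
      · have := (Z w).continuous
        exact Continuous.intervalIntegrable (by fun_prop) _ _
    simp only [e]
    exact ((F.differentiableAt.comp w₀ hZd).sub
      (differentiableAt_id.mul (F₁.differentiableAt.comp w₀ hZd))).const_add c₁

/-! ### Uniqueness, fundamental system and first-order factorization -/

/-- The solution of `y'' = (q - w) y` on `[α, β]` with `y(α) = c₀`, `y'(α) = c₁`, together with its
derivative. -/
noncomputable def solPair (q : ℝ → ℂ) (α β : ℝ) (c₀ c₁ w : ℂ) : (ℝ → ℂ) × (ℝ → ℂ) :=
  Classical.epsilon fun p => Sol q w α β p.1 p.2 ∧ p.1 α = c₀ ∧ p.2 α = c₁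

noncomputable def solY (q : ℝ → ℂ) (α β : ℝ) (c₀ c₁ w : ℂ) : ℝ → ℂ := (solPair q α β c₀ c₁ w).1

noncomputable def solD (q : ℝ → ℂ) (α β : ℝ) (c₀ c₁ w : ℂ) : ℝ → ℂ := (solPair q α β c₀ c₁ w).2

section

variable {q : ℝ → ℂ} {α β : ℝ} {w : ℂ} {y dy z dz : ℝ → ℂ}

theorem sol_spec (hab : α ≤ β) (hq : IntervalIntegrable q volume α β) (c₀ c₁ w : ℂ) :
    Sol q w α β (solY q α β c₀ c₁ w) (solD q α β c₀ c₁ w) ∧ solY q α β c₀ c₁ w α = c₀ ∧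
      solD q α β c₀ c₁ w α = c₁ := by
  obtain ⟨Y, dY, h, -⟩ := exists_sol_near hab hq c₀ c₁ w
  exact Classical.epsilon_spec (p := fun p : (ℝ → ℂ) × (ℝ → ℂ) =>
    Sol q w α β p.1 p.2 ∧ p.1 α = c₀ ∧ p.2 α = c₁) ⟨(Y w, dY w), h.self_of_nhds⟩

/-- The Wronskians of the difference with the two fundamental solutions are constant and vanish at
`x₀`; since the fundamental solutions have Wronskian `1`, they recover the difference and its
derivative. The point `x₀` is arbitrary, so the lemma also serves from the right end point. -/
theorem Sol.unique (hab : α ≤ β) (hq : IntervalIntegrable q volume α β) (h : Sol q w α β y dy)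
    (h' : Sol q w α β z dz) {x₀ : ℝ} (hx₀ : x₀ ∈ Icc α β) (e₀ : y x₀ = z x₀) (e₁ : dy x₀ = dz x₀) :
    ∀ x ∈ Icc α β, y x = z x ∧ dy x = dz x := by
  intro x hx
  obtain ⟨hC, hC0, hC1⟩ := sol_spec hab hq 1 0 w
  obtain ⟨hS, hS0, hS1⟩ := sol_spec hab hq 0 1 w
  have hd := h.lin h' 1 (-1)
  have w1 := hC.wronskian hab hS x hx
  rw [hC0, hC1, hS0, hS1] at w1
  have w2 := (hd.wronskian hab hC x hx).trans (hd.wronskian hab hC x₀ hx₀).symm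
  have w3 := (hd.wronskian hab hS x hx).trans (hd.wronskian hab hS x₀ hx₀).symm
  simp only [e₀, e₁] at w2 w3
  constructor
  · linear_combination (-(y x - z x)) * w1 - solY q α β 0 1 w x * w2 + solY q α β 1 0 w x * w3
  · linear_combination (-(dy x - dz x)) * w1 - solD q α β 0 1 w x * w2 + solD q α β 1 0 w x * w3

theorem Sol.eq_comb (hab : α ≤ β) (hq : IntervalIntegrable q volume α β) (h : Sol q w α β y dy) :
    ∀ x ∈ Icc α β,
      y x = y α * solY q α β 1 0 w x + dy α * solY q α β 0 1 w x ∧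
      dy x = y α * solD q α β 1 0 w x + dy α * solD q α β 0 1 w x := by
  obtain ⟨hC, hC0, hC1⟩ := sol_spec hab hq 1 0 w
  obtain ⟨hS, hS0, hS1⟩ := sol_spec hab hq 0 1 w
  exact h.unique hab hq (hC.lin hS (y α) (dy α)) (left_mem_Icc.2 hab) (by simp [hC0, hS0])
    (by simp [hC1, hS1])

/-- By uniqueness the chosen solutions coincide with the local holomorphic families near each
parameter value. -/
theorem differentiable_sol (hab : α ≤ β) (hq : IntervalIntegrable q volume α β) (c₀ c₁ : ℂ) {x : ℝ}
    (hx : x ∈ Icc α β) : Differentiable ℂ (fun w => solY q α β c₀ c₁ w x) ∧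
      Differentiable ℂ (fun w => solD q α β c₀ c₁ w x) := by
  have key : ∀ w₀, ∃ Y dY : ℂ → ℝ → ℂ, (∀ᶠ w in 𝓝 w₀, solY q α β c₀ c₁ w x = Y w x ∧
      solD q α β c₀ c₁ w x = dY w x) ∧ DifferentiableAt ℂ (fun w => Y w x) w₀ ∧
        DifferentiableAt ℂ (fun w => dY w x) w₀ := by
    intro w₀
    obtain ⟨Y, dY, h, hd⟩ := exists_sol_near hab hq c₀ c₁ w₀
    refine ⟨Y, dY, ?_, hd x hx⟩
    filter_upwards [h] with w hw
    obtain ⟨h1, h2, h3⟩ := sol_spec hab hq c₀ c₁ w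
    exact h1.unique hab hq hw.1 (left_mem_Icc.2 hab) (by rw [h2, hw.2.1]) (by rw [h3, hw.2.2]) x hx
  refine ⟨fun w₀ => ?_, fun w₀ => ?_⟩
  · obtain ⟨Y, dY, h, hd, -⟩ := key w₀
    exact hd.congr_of_eventuallyEq (h.mono fun w hw => hw.1)
  · obtain ⟨Y, dY, h, -, hd⟩ := key w₀
    exact hd.congr_of_eventuallyEq (h.mono fun w hw => hw.2)

/-- The first order factor of the equation, in integrated form. -/
theorem Sol.exp_mul_eq (hab : α ≤ β) (hq : IntervalIntegrable q volume α β)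
    (h : Sol q w α β y dy) {ν : ℂ} (hν : ν ^ 2 = -w) : ∀ x ∈ Icc α β,
      Complex.exp (ν * (x - α : ℝ)) * (dy x - ν * y x) =
        (dy α - ν * y α) + ∫ t in α..x, Complex.exp (ν * (t - α : ℝ)) * (q t * y t) := by
  have hE : ∀ x : ℝ, HasDerivAt (fun x : ℝ => Complex.exp (ν * (x - α : ℝ)))
      (ν * Complex.exp (ν * (x - α : ℝ))) x := fun x =>
    (((hasDerivAt_ofReal_sub α x).const_mul ν).cexp).congr_deriv (by ring)
  have hEac : AbsolutelyContinuousOnInterval (fun x : ℝ => Complex.exp (ν * (x - α : ℝ))) α β :=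
    absolutelyContinuousOnInterval_of_hasDerivWithinAt hab
      (fun x _ => (hE x).hasDerivWithinAt) (by fun_prop)
  have hac : AbsolutelyContinuousOnInterval
      (fun x : ℝ => Complex.exp (ν * (x - α : ℝ)) * (dy x - ν * y x)) α β :=
    hEac.smul (h.absCont.sub ((h.absCont_self hab).const_smul ν))
  have hint : IntervalIntegrable (fun t => Complex.exp (ν * (t - α : ℝ)) * (q t * y t)) volume α β :=
    (hq.mul_continuousOn (by rw [uIcc_of_le hab]; exact h.continuousOn)).continuousOn_mul
      (by fun_prop)
  have := hac.eq_add_integral hab hint (by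
    have hm : ∀ᵐ x ∂(volume.restrict (Ioo α β)), x ∈ Ioo α β := ae_restrict_mem measurableSet_Ioo
    filter_upwards [h.equation, hm] with x h1 hx
    refine ((hE x).mul (h1.sub ((h.hasDerivAt hx).const_mul ν))).congr_deriv ?_
    simp only [Pi.sub_apply]
    linear_combination (-Complex.exp (ν * (x - α : ℝ)) * y x) * hν)
  simpa using this

theorem Sol.exp_mul_eq_right (hab : α ≤ β) (hq : IntervalIntegrable q volume α β)
    (h : Sol q w α β y dy) {ν : ℂ} (hν : ν ^ 2 = -w) : ∀ x ∈ Icc α β,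
      Complex.exp (-ν * (β - x : ℝ)) * (dy x - ν * y x) =
        (dy β - ν * y β) - ∫ t in x..β, Complex.exp (-ν * (β - t : ℝ)) * (q t * y t) := by
  intro x hx
  have hx' : x ∈ uIcc α β := by rwa [uIcc_of_le hab]
  have h1 := h.exp_mul_eq hab hq hν x hx
  have h2 := h.exp_mul_eq hab hq hν β (right_mem_Icc.2 hab)
  have hint : IntervalIntegrable (fun t => Complex.exp (ν * (t - α : ℝ)) * (q t * y t)) volume α β :=
    (hq.mul_continuousOn (by rw [uIcc_of_le hab]; exact h.continuousOn)).continuousOn_mul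
      (by fun_prop)
  have h3 := intervalIntegral.integral_add_adjacent_intervals
    (hint.mono_set (uIcc_subset_uIcc left_mem_uIcc hx'))
    (hint.mono_set (uIcc_subset_uIcc hx' right_mem_uIcc))
  have hexp : ∀ t : ℝ, Complex.exp (-ν * (β - t : ℝ)) =
      Complex.exp (-ν * (β - α : ℝ)) * Complex.exp (ν * (t - α : ℝ)) := fun t => by
    rw [← Complex.exp_add]
    congr 1
    push_cast
    ring
  have hβ : Complex.exp (-ν * (β - α : ℝ)) * Complex.exp (ν * (β - α : ℝ)) = 1 := by
    rw [← hexp]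
    simp
  have h4 : ∫ t in x..β, Complex.exp (-ν * (β - t : ℝ)) * (q t * y t) =
      Complex.exp (-ν * (β - α : ℝ)) *
        ∫ t in x..β, Complex.exp (ν * (t - α : ℝ)) * (q t * y t) := by
    rw [← intervalIntegral.integral_const_mul]
    refine intervalIntegral.integral_congr fun t _ => ?_
    simp only [hexp t]
    ring
  rw [h4, hexp x]
  linear_combination Complex.exp (-ν * (β - α : ℝ)) * (h1 - h2 + h3) + (dy β - ν * y β) * hβ

end

/-! ### Exponential asymptotics and growth of solutions -/

theorem norm_exp_neg_mul_le_one {μ : ℂ} (hμ : 0 ≤ μ.re) {s : ℝ} (hs : 0 ≤ s) :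
    ‖Complex.exp (-μ * s)‖ ≤ 1 := by
  rw [Complex.norm_exp]
  apply Real.exp_le_one_iff.2
  simp only [Complex.mul_re, Complex.neg_re, Complex.ofReal_re, Complex.ofReal_im, mul_zero,
    sub_zero]
  nlinarith [mul_nonneg hμ hs]

theorem norm_integral_mul_le {q k D : ℝ → ℂ} {a b α β N : ℝ} (ha : α ≤ a) (hab : a ≤ b) (hb : b ≤ β)
    (hq : IntervalIntegrable q volume α β) (hk : ∀ t ∈ Icc a b, ‖k t‖ ≤ 1)
    (hD : ∀ t ∈ Icc a b, ‖D t‖ ≤ N) :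
    ‖∫ t in a..b, k t * (q t * D t)‖ ≤ (∫ t in α..β, ‖q t‖) * N := by
  rcases hab.eq_or_lt with rfl | hlt
  · simp only [intervalIntegral.integral_same, norm_zero]
    exact mul_nonneg (intervalIntegral.integral_nonneg (ha.trans hb) fun _ _ => norm_nonneg _)
      ((norm_nonneg _).trans (hD a (left_mem_Icc.2 le_rfl)))
  have hN : 0 ≤ N := (norm_nonneg _).trans (hD a (left_mem_Icc.2 hab))
  have hqi := hq.norm
  have hqs : IntervalIntegrable (fun t => ‖q t‖) volume a b := hqi.mono_set (by
    rw [uIcc_of_le hab, uIcc_of_le (ha.trans (hab.trans hb))]; exact Icc_subset_Icc ha hb)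
  calc ‖∫ t in a..b, k t * (q t * D t)‖ ≤ ∫ t in a..b, ‖q t‖ * N := by
        refine intervalIntegral.norm_integral_le_of_norm_le hab
          (Eventually.of_forall fun t ht => ?_) (hqs.mul_const N)
        rw [norm_mul, norm_mul]
        have h1 := hk t (Ioc_subset_Icc_self ht)
        have h2 := hD t (Ioc_subset_Icc_self ht)
        calc ‖k t‖ * (‖q t‖ * ‖D t‖) ≤ 1 * (‖q t‖ * N) := by gcongr
          _ = _ := one_mul _
    _ = (∫ t in a..b, ‖q t‖) * N := intervalIntegral.integral_mul_const _ _
    _ ≤ _ := by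
      gcongr
      exact intervalIntegral.integral_mono_interval ha hab hb
        (Eventually.of_forall fun _ => norm_nonneg _) hqi

section

variable {q : ℝ → ℂ} {α β : ℝ} {w μ : ℂ} {y dy : ℝ → ℂ}

/-- Approximation of a solution by exponentials, from data at the left end point. -/
theorem Sol.norm_forward_le (hab : α ≤ β) (hq : IntervalIntegrable q volume α β)
    (h : Sol q w α β y dy) (hμ : μ ^ 2 = -w) (hre : 0 ≤ μ.re) (hμ0 : μ ≠ 0)
    (hQ : 2 * ∫ t in α..β, ‖q t‖ ≤ ‖μ‖) {A : ℝ}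
    (hA : A = ‖dy α + μ * y α‖ + ‖dy α - μ * y α‖) : ∀ x ∈ Icc α β,
      ‖Complex.exp (-μ * (x - α : ℝ)) * (dy x + μ * y x) - (dy α + μ * y α)‖
          ≤ (∫ t in α..β, ‖q t‖) * A / ‖μ‖ ∧
      ‖Complex.exp (-μ * (x - α : ℝ)) * (dy x - μ * y x)
          - Complex.exp (-(2 * μ) * (x - α : ℝ)) * (dy α - μ * y α)‖
          ≤ (∫ t in α..β, ‖q t‖) * A / ‖μ‖ := by
  set Q := ∫ t in α..β, ‖q t‖ with hQdef
  set D : ℝ → ℂ := fun x => Complex.exp (-μ * (x - α : ℝ)) * y x with hD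
  have hμpos : 0 < ‖μ‖ := norm_pos_iff.2 hμ0
  have hre2 : 0 ≤ (2 * μ).re := by simpa using hre
  have hDc : ContinuousOn D (Icc α β) :=
    ContinuousOn.mul (by fun_prop) h.continuousOn
  obtain ⟨x₀, hx₀, hmax⟩ := isCompact_Icc.exists_isMaxOn (nonempty_Icc.2 hab) hDc.norm
  set N := ‖D x₀‖ with hN
  have hDN : ∀ t ∈ Icc α β, ‖D t‖ ≤ N := fun t ht => hmax ht
  have e1 : ∀ x ∈ Icc α β, Complex.exp (-μ * (x - α : ℝ)) * (dy x + μ * y x) - (dy α + μ * y α)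
      = ∫ t in α..x, 1 * (q t * D t) := by
    intro x hx
    have := h.exp_mul_eq hab hq (ν := -μ) (by rw [← hμ]; ring) x hx
    simp only [neg_mul, sub_neg_eq_add] at this ⊢
    rw [this, add_sub_cancel_left]
    refine intervalIntegral.integral_congr fun t _ => ?_
    simp only [hD, neg_mul]
    ring
  have e2 : ∀ x ∈ Icc α β, Complex.exp (-μ * (x - α : ℝ)) * (dy x - μ * y x)
          - Complex.exp (-(2 * μ) * (x - α : ℝ)) * (dy α - μ * y α)
      = ∫ t in α..x, Complex.exp (-(2 * μ) * (x - t : ℝ)) * (q t * D t) := by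
    intro x hx
    have h1 := h.exp_mul_eq hab hq hμ x hx
    have h2 : Complex.exp (-μ * (x - α : ℝ)) =
        Complex.exp (-(2 * μ) * (x - α : ℝ)) * Complex.exp (μ * (x - α : ℝ)) := by
      rw [← Complex.exp_add]; congr 1; ring
    rw [h2, mul_assoc, h1, mul_add, add_sub_cancel_left, ← intervalIntegral.integral_const_mul]
    refine intervalIntegral.integral_congr fun t _ => ?_
    have h3 : Complex.exp (-(2 * μ) * (x - α : ℝ)) * Complex.exp (μ * (t - α : ℝ)) =
        Complex.exp (-(2 * μ) * (x - t : ℝ)) * Complex.exp (-μ * (t - α : ℝ)) := by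
      rw [← Complex.exp_add, ← Complex.exp_add]
      congr 1
      push_cast
      ring
    simp only [hD]
    linear_combination (q t * y t) * h3
  have b1 : ∀ x ∈ Icc α β,
      ‖Complex.exp (-μ * (x - α : ℝ)) * (dy x + μ * y x) - (dy α + μ * y α)‖ ≤ Q * N := by
    intro x hx
    rw [e1 x hx]
    exact norm_integral_mul_le le_rfl hx.1 hx.2 hq (fun _ _ => by simp)
      fun t ht => hDN t ⟨ht.1, ht.2.trans hx.2⟩
  have b2 : ∀ x ∈ Icc α β, ‖Complex.exp (-μ * (x - α : ℝ)) * (dy x - μ * y x)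
          - Complex.exp (-(2 * μ) * (x - α : ℝ)) * (dy α - μ * y α)‖ ≤ Q * N := by
    intro x hx
    rw [e2 x hx]
    exact norm_integral_mul_le le_rfl hx.1 hx.2 hq
      (fun t ht => norm_exp_neg_mul_le_one hre2 (sub_nonneg.2 ht.2))
      fun t ht => hDN t ⟨ht.1, ht.2.trans hx.2⟩
  -- Bootstrap: both first-order combinations are known up to `Q * N`, and their difference is `2 μ
  -- D`. So `2 ‖μ‖ N ≤ 2 Q N + A`, and `2 Q ≤ ‖μ‖` absorbs the term in `N`.
  have hNA : N ≤ A / ‖μ‖ := by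
    have h1 : 2 * μ * D x₀ = (Complex.exp (-μ * (x₀ - α : ℝ)) * (dy x₀ + μ * y x₀)
        - (dy α + μ * y α)) - (Complex.exp (-μ * (x₀ - α : ℝ)) * (dy x₀ - μ * y x₀)
          - Complex.exp (-(2 * μ) * (x₀ - α : ℝ)) * (dy α - μ * y α)) + (dy α + μ * y α)
          - Complex.exp (-(2 * μ) * (x₀ - α : ℝ)) * (dy α - μ * y α) := by
      simp only [hD]; ring
    have h2 : 2 * ‖μ‖ * N ≤ Q * N + Q * N + ‖dy α + μ * y α‖ + 1 * ‖dy α - μ * y α‖ := by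
      calc 2 * ‖μ‖ * N = ‖2 * μ * D x₀‖ := by simp [hN]
        _ ≤ _ := by
          rw [h1]
          refine (norm_sub_le _ _).trans (add_le_add ((norm_add_le _ _).trans (add_le_add
            ((norm_sub_le _ _).trans (add_le_add (b1 x₀ hx₀) (b2 x₀ hx₀))) le_rfl)) ?_)
          rw [norm_mul]
          gcongr
          exact norm_exp_neg_mul_le_one hre2 (sub_nonneg.2 hx₀.1)
    have hN0 : 0 ≤ N := norm_nonneg _
    rw [le_div_iff₀ hμpos]
    nlinarith
  have hQ0 : 0 ≤ Q := intervalIntegral.integral_nonneg hab fun _ _ => norm_nonneg _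
  have hfin : Q * N ≤ Q * A / ‖μ‖ := by
    rw [mul_div_assoc]
    gcongr
  exact fun x hx => ⟨(b1 x hx).trans hfin, (b2 x hx).trans hfin⟩

/-- Approximation of a solution by exponentials, from data at the right end point. -/
theorem Sol.norm_backward_le (hab : α ≤ β) (hq : IntervalIntegrable q volume α β)
    (h : Sol q w α β y dy) (hμ : μ ^ 2 = -w) (hre : 0 ≤ μ.re) (hμ0 : μ ≠ 0)
    (hQ : 2 * ∫ t in α..β, ‖q t‖ ≤ ‖μ‖) {A : ℝ}
    (hA : A = ‖dy β + μ * y β‖ + ‖dy β - μ * y β‖) : ∀ x ∈ Icc α β,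
      ‖Complex.exp (-μ * (β - x : ℝ)) * (dy x - μ * y x) - (dy β - μ * y β)‖
          ≤ (∫ t in α..β, ‖q t‖) * A / ‖μ‖ ∧
      ‖Complex.exp (-μ * (β - x : ℝ)) * (dy x + μ * y x)
          - Complex.exp (-(2 * μ) * (β - x : ℝ)) * (dy β + μ * y β)‖
          ≤ (∫ t in α..β, ‖q t‖) * A / ‖μ‖ := by
  set Q := ∫ t in α..β, ‖q t‖ with hQdef
  set D : ℝ → ℂ := fun x => Complex.exp (-μ * (β - x : ℝ)) * y x with hD
  have hμpos : 0 < ‖μ‖ := norm_pos_iff.2 hμ0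
  have hre2 : 0 ≤ (2 * μ).re := by simpa using hre
  have hDc : ContinuousOn D (Icc α β) :=
    ContinuousOn.mul (by fun_prop) h.continuousOn
  obtain ⟨x₀, hx₀, hmax⟩ := isCompact_Icc.exists_isMaxOn (nonempty_Icc.2 hab) hDc.norm
  set N := ‖D x₀‖ with hN
  have hDN : ∀ t ∈ Icc α β, ‖D t‖ ≤ N := fun t ht => hmax ht
  have e1 : ∀ x ∈ Icc α β, Complex.exp (-μ * (β - x : ℝ)) * (dy x - μ * y x) - (dy β - μ * y β)
      = -∫ t in x..β, 1 * (q t * D t) := by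
    intro x hx
    rw [h.exp_mul_eq_right hab hq hμ x hx, sub_sub_cancel_left]
    congr 1
    refine intervalIntegral.integral_congr fun t _ => ?_
    simp only [hD]
    ring
  have e2 : ∀ x ∈ Icc α β, Complex.exp (-μ * (β - x : ℝ)) * (dy x + μ * y x)
          - Complex.exp (-(2 * μ) * (β - x : ℝ)) * (dy β + μ * y β)
      = -∫ t in x..β, Complex.exp (-(2 * μ) * (t - x : ℝ)) * (q t * D t) := by
    intro x hx
    have h1 := h.exp_mul_eq_right hab hq (ν := -μ) (by rw [← hμ]; ring) x hx
    simp only [neg_mul, sub_neg_eq_add, neg_neg] at h1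
    have h2 : Complex.exp (-μ * (β - x : ℝ)) =
        Complex.exp (-(2 * μ) * (β - x : ℝ)) * Complex.exp (μ * (β - x : ℝ)) := by
      rw [← Complex.exp_add]; congr 1; ring
    rw [h2, mul_assoc, h1, mul_sub, sub_sub_cancel_left, ← intervalIntegral.integral_const_mul]
    congr 1
    refine intervalIntegral.integral_congr fun t _ => ?_
    have h3 : Complex.exp (-(2 * μ) * (β - x : ℝ)) * Complex.exp (μ * (β - t : ℝ)) =
        Complex.exp (-(2 * μ) * (t - x : ℝ)) * Complex.exp (-μ * (β - t : ℝ)) := by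
      rw [← Complex.exp_add, ← Complex.exp_add]
      congr 1
      push_cast
      ring
    simp only [hD]
    linear_combination (q t * y t) * h3
  have b1 : ∀ x ∈ Icc α β,
      ‖Complex.exp (-μ * (β - x : ℝ)) * (dy x - μ * y x) - (dy β - μ * y β)‖ ≤ Q * N := by
    intro x hx
    rw [e1 x hx, norm_neg]
    exact norm_integral_mul_le hx.1 hx.2 le_rfl hq (fun _ _ => by simp)
      fun t ht => hDN t ⟨hx.1.trans ht.1, ht.2⟩
  have b2 : ∀ x ∈ Icc α β, ‖Complex.exp (-μ * (β - x : ℝ)) * (dy x + μ * y x)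
          - Complex.exp (-(2 * μ) * (β - x : ℝ)) * (dy β + μ * y β)‖ ≤ Q * N := by
    intro x hx
    rw [e2 x hx, norm_neg]
    exact norm_integral_mul_le hx.1 hx.2 le_rfl hq
      (fun t ht => norm_exp_neg_mul_le_one hre2 (sub_nonneg.2 ht.1))
      fun t ht => hDN t ⟨hx.1.trans ht.1, ht.2⟩
  have hNA : N ≤ A / ‖μ‖ := by
    have h1 : 2 * μ * D x₀ = (Complex.exp (-μ * (β - x₀ : ℝ)) * (dy x₀ + μ * y x₀)
          - Complex.exp (-(2 * μ) * (β - x₀ : ℝ)) * (dy β + μ * y β))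
        - (Complex.exp (-μ * (β - x₀ : ℝ)) * (dy x₀ - μ * y x₀) - (dy β - μ * y β))
        - (dy β - μ * y β) + Complex.exp (-(2 * μ) * (β - x₀ : ℝ)) * (dy β + μ * y β) := by
      simp only [hD]; ring
    have h2 : 2 * ‖μ‖ * N ≤ Q * N + Q * N + ‖dy β - μ * y β‖ + 1 * ‖dy β + μ * y β‖ := by
      calc 2 * ‖μ‖ * N = ‖2 * μ * D x₀‖ := by simp [hN]
        _ ≤ _ := by
          rw [h1]
          refine (norm_add_le _ _).trans (add_le_add ((norm_sub_le _ _).trans (add_le_add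
            ((norm_sub_le _ _).trans (add_le_add (b2 x₀ hx₀) (b1 x₀ hx₀))) le_rfl)) ?_)
          rw [norm_mul]
          gcongr
          exact norm_exp_neg_mul_le_one hre2 (sub_nonneg.2 hx₀.2)
    have hN0 : 0 ≤ N := norm_nonneg _
    rw [le_div_iff₀ hμpos]
    nlinarith
  have hQ0 : 0 ≤ Q := intervalIntegral.integral_nonneg hab fun _ _ => norm_nonneg _
  have hfin : Q * N ≤ Q * A / ‖μ‖ := by
    rw [mul_div_assoc]
    gcongr
  exact fun x hx => ⟨(b1 x hx).trans hfin, (b2 x hx).trans hfin⟩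

end

theorem exists_sq_eq_neg_re_nonneg (w : ℂ) : ∃ μ : ℂ, μ ^ 2 = -w ∧ 0 ≤ μ.re := by
  obtain ⟨μ, hμ⟩ := IsAlgClosed.exists_pow_nat_eq (-w) (n := 2) (by norm_num)
  rcases le_total 0 μ.re with h | h
  · exact ⟨μ, hμ, h⟩
  · exact ⟨-μ, by rw [neg_sq, hμ], by simpa using h⟩

section

variable {q : ℝ → ℂ} {α β : ℝ} {w μ : ℂ} {y dy : ℝ → ℂ}

theorem norm_exp_neg_mul (μ : ℂ) (s : ℝ) : ‖Complex.exp (-μ * s)‖ = Real.exp (-(μ.re * s)) := by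
  rw [Complex.norm_exp]
  simp

/-- Growth of solutions away from the left end point. -/
theorem Sol.norm_le (hab : α ≤ β) (hq : IntervalIntegrable q volume α β)
    (h : Sol q w α β y dy) (hμ : μ ^ 2 = -w) (hre : 0 ≤ μ.re) (hμ0 : μ ≠ 0)
    (hQ : 2 * ∫ t in α..β, ‖q t‖ ≤ ‖μ‖) {x : ℝ} (hx : x ∈ Icc α β) :
    ‖μ‖ * ‖y x‖ ≤ 4 * (‖dy α‖ + ‖μ‖ * ‖y α‖) * Real.exp (μ.re * (x - α)) ∧
      ‖dy x‖ ≤ 4 * (‖dy α‖ + ‖μ‖ * ‖y α‖) * Real.exp (μ.re * (x - α)) := by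
  set A := ‖dy α + μ * y α‖ + ‖dy α - μ * y α‖ with hA
  have hμpos : 0 < ‖μ‖ := norm_pos_iff.2 hμ0
  have hA0 : 0 ≤ A := by positivity
  have hA1 : A ≤ 2 * (‖dy α‖ + ‖μ‖ * ‖y α‖) := by
    have h1 := norm_add_le (dy α) (μ * y α)
    have h2 := norm_sub_le (dy α) (μ * y α)
    rw [norm_mul] at h1 h2
    linarith
  obtain ⟨h1, h2⟩ := h.norm_forward_le hab hq hμ hre hμ0 hQ hA x hx
  have hQA : (∫ t in α..β, ‖q t‖) * A / ‖μ‖ ≤ A := by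
    rw [div_le_iff₀ hμpos]
    have hQ0 : 0 ≤ ∫ t in α..β, ‖q t‖ :=
      intervalIntegral.integral_nonneg hab fun _ _ => norm_nonneg _
    nlinarith
  have hs : (0 : ℝ) ≤ x - α := sub_nonneg.2 hx.1
  have hE : ∀ v : ℂ, ‖v‖ = ‖Complex.exp (-μ * (x - α : ℝ)) * v‖ * Real.exp (μ.re * (x - α)) := by
    intro v
    rw [norm_mul, norm_exp_neg_mul, mul_right_comm, ← Real.exp_add]
    simp
  have hg : ‖dy x + μ * y x‖ ≤ 2 * A * Real.exp (μ.re * (x - α)) := by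
    rw [hE]
    gcongr
    have := norm_sub_norm_le (Complex.exp (-μ * (x - α : ℝ)) * (dy x + μ * y x)) (dy α + μ * y α)
    have h3 : ‖dy α + μ * y α‖ ≤ A := by rw [hA]; linarith [norm_nonneg (dy α - μ * y α)]
    linarith
  have he : ‖dy x - μ * y x‖ ≤ 2 * A * Real.exp (μ.re * (x - α)) := by
    rw [hE]
    gcongr
    have := norm_sub_norm_le (Complex.exp (-μ * (x - α : ℝ)) * (dy x - μ * y x))
      (Complex.exp (-(2 * μ) * (x - α : ℝ)) * (dy α - μ * y α))
    have h3 : ‖Complex.exp (-(2 * μ) * (x - α : ℝ)) * (dy α - μ * y α)‖ ≤ A := by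
      rw [norm_mul]
      have h4 := norm_exp_neg_mul_le_one (μ := 2 * μ) (by simpa using hre) hs
      nlinarith [norm_nonneg (dy α + μ * y α), norm_nonneg (dy α - μ * y α)]
    linarith
  have hexp := Real.exp_pos (μ.re * (x - α))
  constructor
  · have h5 : ‖2 * (μ * y x)‖ ≤ ‖dy x + μ * y x‖ + ‖dy x - μ * y x‖ := by
      rw [show 2 * (μ * y x) = (dy x + μ * y x) - (dy x - μ * y x) by ring]
      exact norm_sub_le _ _
    rw [norm_mul, norm_mul, Complex.norm_ofNat] at h5
    nlinarith [mul_le_mul_of_nonneg_right hA1 hexp.le]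
  · have h5 : ‖2 * dy x‖ ≤ ‖dy x + μ * y x‖ + ‖dy x - μ * y x‖ := by
      rw [show 2 * dy x = (dy x + μ * y x) + (dy x - μ * y x) by ring]
      exact norm_add_le _ _
    rw [norm_mul, Complex.norm_ofNat] at h5
    nlinarith [mul_le_mul_of_nonneg_right hA1 hexp.le]

/-- For large `w` the growth estimate applies with `μ = √(-w)`, for which `‖μ‖ = √‖w‖`; the factor
`‖μ‖` multiplying `c₀` is absorbed into the exponential. Bounded `w` are covered by compactness. -/
theorem orderHalf_sol (hab : α ≤ β) (hq : IntervalIntegrable q volume α β) (c₀ c₁ : ℂ) {x : ℝ}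
    (hx : x ∈ Icc α β) : OrderHalf (fun w => solY q α β c₀ c₁ w x) ∧
      OrderHalf (fun w => solD q α β c₀ c₁ w x) := by
  obtain ⟨hd1, hd2⟩ := differentiable_sol hab hq c₀ c₁ hx
  set Q := ∫ t in α..β, ‖q t‖ with hQ
  have hQ0 : 0 ≤ Q := intervalIntegral.integral_nonneg hab fun _ _ => norm_nonneg _
  set R := (2 * Q + 1) ^ 2 with hR
  have hs : (0 : ℝ) ≤ x - α := sub_nonneg.2 hx.1
  have hbig : ∀ w : ℂ, R ≤ ‖w‖ →
      ‖solY q α β c₀ c₁ w x‖ ≤ 4 * (‖c₁‖ + ‖c₀‖) * Real.exp ((x - α + 1) * (1 + √‖w‖)) ∧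
      ‖solD q α β c₀ c₁ w x‖ ≤ 4 * (‖c₁‖ + ‖c₀‖) * Real.exp ((x - α + 1) * (1 + √‖w‖)) := by
    intro w hw
    obtain ⟨μ, hμ, hre⟩ := exists_sq_eq_neg_re_nonneg w
    have hn : ‖μ‖ = √‖w‖ := by
      rw [← norm_neg w, ← hμ, norm_pow, Real.sqrt_sq (norm_nonneg _)]
    have h2 : 2 * Q + 1 ≤ ‖μ‖ := by rw [hn]; exact Real.le_sqrt_of_sq_le hw
    have hμ0 : μ ≠ 0 := norm_pos_iff.1 (by linarith)
    obtain ⟨h, h0, h1⟩ := sol_spec hab hq c₀ c₁ w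
    obtain ⟨e1, e2⟩ := h.norm_le hab hq hμ hre hμ0 (by linarith) hx
    rw [h0, h1] at e1 e2
    have h3 : (‖c₁‖ + ‖μ‖ * ‖c₀‖) * Real.exp (μ.re * (x - α)) ≤
        (‖c₁‖ + ‖c₀‖) * Real.exp ((x - α + 1) * (1 + √‖w‖)) := by
      have h4 : ‖μ‖ ≤ Real.exp ‖μ‖ := by linarith [Real.add_one_le_exp ‖μ‖]
      have h5 : 1 ≤ Real.exp ‖μ‖ := Real.one_le_exp (norm_nonneg _)
      calc (‖c₁‖ + ‖μ‖ * ‖c₀‖) * Real.exp (μ.re * (x - α))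
          ≤ ((‖c₁‖ + ‖c₀‖) * Real.exp ‖μ‖) * Real.exp (‖μ‖ * (x - α)) := by
            gcongr
            · nlinarith [norm_nonneg c₀, norm_nonneg c₁]
            · exact Complex.re_le_norm μ
        _ = (‖c₁‖ + ‖c₀‖) * Real.exp (‖μ‖ + ‖μ‖ * (x - α)) := by rw [Real.exp_add]; ring
        _ ≤ _ := by
          gcongr
          rw [← hn]
          nlinarith [norm_nonneg μ]
    constructor
    · nlinarith [norm_nonneg (solY q α β c₀ c₁ w x)]
    · linarith
  have hsmall : ∀ f : ℂ → ℂ, Differentiable ℂ f → (∀ w : ℂ, R ≤ ‖w‖ →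
      ‖f w‖ ≤ 4 * (‖c₁‖ + ‖c₀‖) * Real.exp ((x - α + 1) * (1 + √‖w‖))) → OrderHalf f := by
    intro f hf hle
    obtain ⟨B, hB⟩ := (isCompact_closedBall (0 : ℂ) R).exists_bound_of_continuousOn
      hf.continuous.continuousOn
    refine OrderHalf.of_le (C := x - α + 1) (D := 4 * (‖c₁‖ + ‖c₀‖) + |B|) hf fun w => ?_
    have he : 1 ≤ Real.exp ((x - α + 1) * (1 + √‖w‖)) :=
      Real.one_le_exp (mul_nonneg (by linarith) (by positivity))
    have hc : 0 ≤ 4 * (‖c₁‖ + ‖c₀‖) := by positivity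
    rcases le_total R ‖w‖ with hw | hw
    · refine (hle w hw).trans ?_
      gcongr
      linarith [abs_nonneg B]
    · have := hB w (by simpa using hw)
      nlinarith [le_abs_self B, abs_nonneg B]
  exact ⟨hsmall _ hd1 fun w hw => (hbig w hw).1, hsmall _ hd2 fun w hw => (hbig w hw).2⟩

end

/-! ### Decaying families along a ray -/

/-- Behaviour along a ray of a family of solutions which decay away from the left end point:
the logarithmic derivative at `α` is asymptotic to `-t ν`, and the solutions decay at the rate
`exp (-t Re ν x)`. -/
structure Decays (ν : ℂ) (α β : ℝ) (y dy : ℝ → ℝ → ℂ) : Prop where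
  ne : ∀ᶠ t in atTop, y t α ≠ 0
  ratio : Tendsto (fun t : ℝ => dy t α / (t * y t α)) atTop (𝓝 (-ν))
  bound : ∃ C : ℝ, ∀ᶠ t in atTop, ∀ x ∈ Icc α β,
    ‖y t x‖ ≤ C * Real.exp (-(t * ν.re * (x - α))) * ‖y t α‖

theorem Decays.mono {ν : ℂ} {α β γ : ℝ} {y dy : ℝ → ℝ → ℂ} (h : Decays ν α β y dy) (hγ : γ ≤ β) :
    Decays ν α γ y dy := by
  obtain ⟨h1, h2, C, h3⟩ := h
  exact ⟨h1, h2, C, h3.mono fun t ht x hx => ht x (Icc_subset_Icc_right hγ hx)⟩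

/-- Going left from `β`, the combination `y' - t ν y` grows like `exp (t ν (β - x))` while the
contribution of the initial value of `y' + t ν y` shrinks. The condition `κ ≠ ν` says that the
growing component is present at `β` at leading order; over the positive length of the interval it
then dominates, whatever `κ` is. -/
theorem decays_of_ratio {q : ℝ → ℂ} {α β : ℝ} {ν κ : ℂ} {y dy : ℝ → ℝ → ℂ} (hab : α < β)
    (hq : IntervalIntegrable q volume α β) (hν : 0 < ν.re)
    (hsol : ∀ᶠ t : ℝ in atTop, Sol q (-(t * ν) ^ 2) α β (y t) (dy t))
    (hne : ∀ᶠ t in atTop, y t β ≠ 0)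
    (hκ : Tendsto (fun t : ℝ => dy t β / (t * y t β)) atTop (𝓝 κ)) (hκν : κ ≠ ν) :
    Decays ν α β y dy := by
  have hν0 : ν ≠ 0 := fun h => by simp [h] at hν
  have hνn : 0 < ‖ν‖ := norm_pos_iff.2 hν0
  set Q := ∫ t in α..β, ‖q t‖ with hQ
  have hQ0 : 0 ≤ Q := intervalIntegral.integral_nonneg hab.le fun _ _ => norm_nonneg _
  set e : ℝ → ℂ := fun t => dy t β - t * ν * y t β with he
  set g : ℝ → ℂ := fun t => dy t β + t * ν * y t β with hg
  have hc : Tendsto (fun t => g t / e t) atTop (𝓝 ((κ + ν) / (κ - ν))) := by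
    refine ((hκ.add_const ν).div (hκ.sub_const ν) (sub_ne_zero.2 hκν)).congr' ?_
    filter_upwards [hne, eventually_gt_atTop 0] with t ht ht0
    have ht' : (t : ℂ) ≠ 0 := by exact_mod_cast ht0.ne'
    have h1 : dy t β / (t * y t β) + ν = g t / (t * y t β) := by
      simp only [hg]; field_simp
    have h2 : dy t β / (t * y t β) - ν = e t / (t * y t β) := by
      simp only [he]; field_simp
    simp only [Pi.div_apply]
    rw [h1, h2, div_div_div_cancel_right₀ (mul_ne_zero ht' ht)]
  have hene : ∀ᶠ t in atTop, e t ≠ 0 := by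
    filter_upwards [(hκ.sub_const ν).eventually_ne (sub_ne_zero.2 hκν), hne,
      eventually_gt_atTop 0] with t h1 ht ht0 h2
    apply h1
    have ht' : (t : ℂ) ≠ 0 := by exact_mod_cast ht0.ne'
    have h3 : dy t β = t * ν * y t β := sub_eq_zero.1 h2
    rw [h3]
    field_simp
    simp
  set K := ‖(κ + ν) / (κ - ν)‖ + 1 with hK
  have hK0 : 0 ≤ K := by positivity
  have hgK : ∀ᶠ t in atTop, ‖g t‖ ≤ K * ‖e t‖ := by
    filter_upwards [hc.norm.eventually (gt_mem_nhds (lt_add_one _)), hene] with t h1 h2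
    rw [norm_div, div_lt_iff₀ (norm_pos_iff.2 h2)] at h1
    exact h1.le
  set δ : ℝ → ℝ := fun t => Q * (K + 1) / (t * ‖ν‖) with hδ
  have hδ0 : Tendsto δ atTop (𝓝 0) :=
    tendsto_const_nhds.div_atTop (tendsto_id.atTop_mul_const hνn)
  have hbasic : ∀ᶠ t : ℝ in atTop, ∀ x ∈ Icc α β,
      ‖Complex.exp (-(t * ν) * (β - x : ℝ)) * (dy t x - t * ν * y t x) / e t - 1‖ ≤ δ t ∧
      ‖Complex.exp (-(t * ν) * (β - x : ℝ)) * (dy t x + t * ν * y t x) / e t‖ ≤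
        K * Real.exp (-(2 * (t * ν.re) * (β - x))) + δ t := by
    filter_upwards [hsol, hene, hgK, eventually_gt_atTop 0,
      eventually_ge_atTop (2 * Q / ‖ν‖)] with t hs he0 hgk ht0 htQ x hx
    have hμn : ‖(t : ℂ) * ν‖ = t * ‖ν‖ := by
      rw [norm_mul, Complex.norm_real, Real.norm_of_nonneg ht0.le]
    have hre : ((t : ℂ) * ν).re = t * ν.re := by simp
    have hepos : 0 < ‖e t‖ := norm_pos_iff.2 he0
    obtain ⟨h1, h2⟩ := hs.norm_backward_le hab.le hq (μ := t * ν) (by ring)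
      (by rw [hre]; positivity) (norm_pos_iff.1 (by rw [hμn]; positivity))
      (by rw [hμn]; rwa [div_le_iff₀ hνn] at htQ) (A := ‖g t‖ + ‖e t‖) rfl x hx
    have hA : Q * (‖g t‖ + ‖e t‖) / ‖(t : ℂ) * ν‖ ≤ δ t * ‖e t‖ := by
      rw [hμn, hδ, div_mul_eq_mul_div, mul_assoc]
      gcongr
      linarith
    constructor
    · rw [div_sub_one he0, norm_div, div_le_iff₀ hepos]
      exact h1.trans hA
    · rw [norm_div, div_le_iff₀ hepos]
      have h3 := norm_sub_norm_le (Complex.exp (-(t * ν) * (β - x : ℝ)) * (dy t x + t * ν * y t x))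
        (Complex.exp (-(2 * (t * ν)) * (β - x : ℝ)) * (dy t β + t * ν * y t β))
      have h4 : ‖Complex.exp (-(2 * (t * ν)) * (β - x : ℝ)) * (dy t β + t * ν * y t β)‖ ≤
          K * Real.exp (-(2 * (t * ν.re) * (β - x))) * ‖e t‖ := by
        rw [norm_mul, norm_exp_neg_mul]
        have : (2 * ((t : ℂ) * ν)).re = 2 * (t * ν.re) := by simp
        rw [this]
        calc _ ≤ Real.exp (-(2 * (t * ν.re) * (β - x))) * (K * ‖e t‖) := by gcongr
          _ = _ := by ring
      rw [add_mul]
      linarith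
  -- `P` and `S` are the two components at `α`, normalized by the growing one at `β`. They tend to
  -- `1` and `0`, and the logarithmic derivative at `α`, divided by `t`, is `ν (S + P) / (S - P)`.
  set P : ℝ → ℂ := fun t => Complex.exp (-(t * ν) * (β - α : ℝ)) * (dy t α - t * ν * y t α) / e t
    with hP
  set S : ℝ → ℂ := fun t => Complex.exp (-(t * ν) * (β - α : ℝ)) * (dy t α + t * ν * y t α) / e t
    with hS
  have hPlim : Tendsto P atTop (𝓝 1) := by
    rw [tendsto_iff_norm_sub_tendsto_zero]
    exact squeeze_zero' (Eventually.of_forall fun _ => norm_nonneg _)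
      (hbasic.mono fun t ht => (ht α (left_mem_Icc.2 hab.le)).1) hδ0
  have hSlim : Tendsto S atTop (𝓝 0) := by
    rw [tendsto_zero_iff_norm_tendsto_zero]
    refine squeeze_zero' (Eventually.of_forall fun _ => norm_nonneg _)
      (hbasic.mono fun t ht => (ht α (left_mem_Icc.2 hab.le)).2) ?_
    have h1 : Tendsto (fun t : ℝ => 2 * (t * ν.re) * (β - α)) atTop atTop :=
      ((tendsto_id.atTop_mul_const hν).const_mul_atTop two_pos).atTop_mul_const (sub_pos.2 hab)
    have h2 := (Real.tendsto_exp_neg_atTop_nhds_zero.comp h1).const_mul K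
    simpa using h2.add hδ0
  have hSP : Tendsto (fun t => S t - P t) atTop (𝓝 (-1)) := by simpa using hSlim.sub hPlim
  have hSPy : ∀ t : ℝ, S t - P t =
      Complex.exp (-(t * ν) * (β - α : ℝ)) * (2 * (t * ν * y t α)) / e t := fun t => by
    simp only [hS, hP]; ring
  have hαne : ∀ᶠ t in atTop, y t α ≠ 0 := by
    filter_upwards [hSP.eventually_ne (neg_ne_zero.2 one_ne_zero)] with t ht h0
    exact ht (by rw [hSPy, h0]; simp)
  refine ⟨hαne, ?_, 2 * (K + 3), ?_⟩
  · have h1 : Tendsto (fun t => ν * (S t + P t) / (S t - P t)) atTop (𝓝 (-ν)) := by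
      have := ((hSlim.add hPlim).const_mul ν).div hSP (neg_ne_zero.2 one_ne_zero)
      rw [zero_add, mul_one, div_neg, div_one] at this
      exact this
    refine h1.congr' ?_
    filter_upwards [hαne, hene, eventually_gt_atTop 0] with t h2 h3 ht0
    have ht' : (t : ℂ) ≠ 0 := by exact_mod_cast ht0.ne'
    have hex := Complex.exp_ne_zero (-(t * ν) * (β - α : ℝ))
    have h4 : S t + P t = Complex.exp (-(t * ν) * (β - α : ℝ)) * (2 * dy t α) / e t := by
      simp only [hS, hP]; ring
    rw [hSPy, h4]
    field_simp
  · filter_upwards [hbasic, hene, eventually_gt_atTop 0, hSP.norm.eventually (lt_mem_nhds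
      (show (1 / 2 : ℝ) < ‖(-1 : ℂ)‖ by norm_num)), hδ0.eventually (gt_mem_nhds one_pos)]
      with t hb he0 ht0 hsp hδ1 x hx
    obtain ⟨h1, h2⟩ := hb x hx
    have hepos : 0 < ‖e t‖ := norm_pos_iff.2 he0
    have h3 : ‖Complex.exp (-(t * ν) * (β - x : ℝ)) * (2 * (t * ν * y t x)) / e t‖ ≤ K + 3 := by
      have e1 : Complex.exp (-(t * ν) * (β - x : ℝ)) * (2 * (t * ν * y t x)) / e t =
          Complex.exp (-(t * ν) * (β - x : ℝ)) * (dy t x + t * ν * y t x) / e t -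
          (Complex.exp (-(t * ν) * (β - x : ℝ)) * (dy t x - t * ν * y t x) / e t - 1) - 1 := by
        ring
      rw [e1]
      have h4 : Real.exp (-(2 * (t * ν.re) * (β - x))) ≤ 1 := by
        apply Real.exp_le_one_iff.2
        have := mul_nonneg (mul_nonneg zero_le_two (mul_nonneg ht0.le hν.le)) (sub_nonneg.2 hx.2)
        linarith
      have h5 : K * Real.exp (-(2 * (t * ν.re) * (β - x))) ≤ K := by nlinarith
      refine (norm_sub_le _ _).trans ?_
      have := norm_sub_le (Complex.exp (-(t * ν) * (β - x : ℝ)) * (dy t x + t * ν * y t x) / e t)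
        (Complex.exp (-(t * ν) * (β - x : ℝ)) * (dy t x - t * ν * y t x) / e t - 1)
      rw [norm_one]
      linarith
    rw [hSPy] at hsp
    have hre : ((t : ℂ) * ν).re = t * ν.re := by simp
    simp only [norm_div, norm_mul, norm_exp_neg_mul, hre, Complex.norm_ofNat] at h3 hsp
    rw [div_le_iff₀ hepos] at h3
    rw [lt_div_iff₀ hepos] at hsp
    set a := ‖(t : ℂ)‖ * ‖ν‖ with ha
    have ha0 : 0 < a := by
      rw [ha, Complex.norm_real, Real.norm_of_nonneg ht0.le]; positivity
    have hx1 : Real.exp (-(t * ν.re * (β - α))) = Real.exp (-(t * ν.re * (β - x))) *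
        Real.exp (-(t * ν.re * (x - α))) := by
      rw [← Real.exp_add]; congr 1; ring
    rw [hx1] at hsp
    set E₁ := Real.exp (-(t * ν.re * (β - x)))
    set E₂ := Real.exp (-(t * ν.re * (x - α)))
    have hE₁ : 0 < E₁ := Real.exp_pos _
    have h6 : E₁ * (2 * (a * ‖y t x‖)) ≤ (K + 3) * (2 * (E₁ * E₂ * (2 * (a * ‖y t α‖)))) :=
      h3.trans (by gcongr; linarith)
    have h7 : (2 * a * E₁) * ‖y t x‖ ≤ (2 * a * E₁) * (2 * (K + 3) * E₂ * ‖y t α‖) := by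
      linarith
    exact le_of_mul_le_mul_left h7 (by positivity)

/-! ### From decaying pairs to the potential -/

/-- If the products `s φ̃` and `φ s̃` of the solutions of two initial value problems agree at one
value of the spectral parameter, then the potentials agree. -/
theorem potential_eq_of_cross_eq {q p : ℝ → ℂ} {α β : ℝ} (hab : α < β) {w h k : ℂ}
    {φ dφ s ds φ' dφ' s' ds' : ℝ → ℂ} (hφ : Sol q w α β φ dφ) (hs : Sol q w α β s ds)
    (hφ' : Sol p w α β φ' dφ') (hs' : Sol p w α β s' ds')
    (hφ0 : φ α = 1) (hφ1 : dφ α = h) (hs0 : s α = 0) (hs1 : ds α = 1)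
    (hφ'0 : φ' α = 1) (hφ'1 : dφ' α = k) (hs'0 : s' α = 0) (hs'1 : ds' α = 1)
    (hcross : ∀ x ∈ Icc α β, s x * φ' x - φ x * s' x = 0) :
    h = k ∧ q =ᵐ[volume.restrict (Ioo α β)] p := by
  have hW := hφ.wronskian hab.le hs
  have hW' := hφ'.wronskian hab.le hs'
  simp only [hφ0, hφ1, hs0, hs1, hφ'0, hφ'1, hs'0, hs'1, zero_mul, mul_one, sub_zero] at hW hW'
  have hd : ∀ x ∈ Ioo α β, ds x * φ' x + s x * dφ' x - (dφ x * s' x + φ x * ds' x) = 0 := by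
    intro x hx
    have h1 := ((hs.hasDerivAt hx).mul (hφ'.hasDerivAt hx)).sub
      ((hφ.hasDerivAt hx).mul (hs'.hasDerivAt hx))
    have h2 : s * φ' - φ * s' =ᶠ[𝓝 x] fun _ => 0 := by
      filter_upwards [Icc_mem_nhds hx.1 hx.2] with z hz
      exact hcross z hz
    exact h1.unique ((hasDerivAt_const x (0 : ℂ)).congr_of_eventuallyEq h2)
  -- Eliminating the derivatives from the relation `s φ' = φ s'` and its derivative, with both
  -- Wronskians equal to `1`, leaves equality of squares. Signs stay undetermined, so only quadratic
  -- relations are used below.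
  have hφsq : ∀ x ∈ Ioo α β, φ x ^ 2 = φ' x ^ 2 := by
    intro x hx
    have hx' := Ioo_subset_Icc_self hx
    linear_combination -(φ x * φ' x) * hd x hx + φ' x ^ 2 * hW x hx' - φ x ^ 2 * hW' x hx'
      + (φ' x * dφ x + φ x * dφ' x) * hcross x hx'
  have hssq : ∀ x ∈ Ioo α β, s x ^ 2 = s' x ^ 2 := by
    intro x hx
    have hx' := Ioo_subset_Icc_self hx
    linear_combination -(s x * s' x) * hd x hx + s' x ^ 2 * hW x hx' - s x ^ 2 * hW' x hx'
      + (s' x * ds x + s x * ds' x) * hcross x hx'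
  have hder : ∀ {y dy z dz : ℝ → ℂ}, Sol q w α β y dy → Sol p w α β z dz →
      (∀ x ∈ Ioo α β, y x ^ 2 = z x ^ 2) → ∀ x ∈ Ioo α β, y x * dy x = z x * dz x := by
    intro y dy z dz hy hz he x hx
    have h2 : (fun x => y x ^ 2) =ᶠ[𝓝 x] fun x => z x ^ 2 := by
      filter_upwards [Ioo_mem_nhds hx.1 hx.2] with u hu
      exact he u hu
    have h3 := ((hy.hasDerivAt hx).pow 2).unique
      (((hz.hasDerivAt hx).pow 2).congr_of_eventuallyEq h2)
    simp only [Nat.cast_ofNat, Nat.add_one_sub_one, pow_one] at h3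
    linear_combination h3 / 2
  -- Differentiating `y ^ 2 = z ^ 2` twice compares the potentials wherever `y ≠ 0`. It is used for
  -- both `φ` and `s`, which have no common zero because their Wronskian is `1`.
  have hder2 : ∀ {y dy z dz : ℝ → ℂ}, Sol q w α β y dy → Sol p w α β z dz →
      (∀ x ∈ Ioo α β, y x ^ 2 = z x ^ 2) →
      ∀ᵐ x ∂(volume.restrict (Ioo α β)), y x ≠ 0 → q x = p x := by
    intro y dy z dz hy hz he
    have hm : ∀ᵐ x ∂(volume.restrict (Ioo α β)), x ∈ Ioo α β := ae_restrict_mem measurableSet_Ioo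
    filter_upwards [hy.equation, hz.equation, hm] with x h1 h2 hx hne
    have h4 : (y * dy) =ᶠ[𝓝 x] (z * dz) := by
      filter_upwards [Ioo_mem_nhds hx.1 hx.2] with u hu
      exact hder hy hz he u hu
    have h5 := ((hy.hasDerivAt hx).mul h1).unique
      (((hz.hasDerivAt hx).mul h2).congr_of_eventuallyEq h4)
    have h6 := he x hx
    have h7 := hder hy hz he x hx
    have h8 : y x ^ 2 * dy x ^ 2 = y x ^ 2 * dz x ^ 2 := by
      linear_combination (y x * dy x + z x * dz x) * h7 - dz x ^ 2 * h6
    have h9 := mul_left_cancel₀ (pow_ne_zero 2 hne) h8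
    have h10 : (q x - p x) * y x ^ 2 = 0 := by
      linear_combination h5 - h9 - (p x - w) * h6
    exact sub_eq_zero.1 ((mul_eq_zero.1 h10).resolve_right (pow_ne_zero 2 hne))
  constructor
  · have hc1 : ContinuousWithinAt (fun x => φ x * dφ x) (Ioo α β) α :=
      ((hφ.continuousOn.mul (hφ.continuousOn_deriv hab.le)) α
        (left_mem_Icc.2 hab.le)).mono Ioo_subset_Icc_self
    have hc2 : ContinuousWithinAt (fun x => φ' x * dφ' x) (Ioo α β) α :=
      ((hφ'.continuousOn.mul (hφ'.continuousOn_deriv hab.le)) α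
        (left_mem_Icc.2 hab.le)).mono Ioo_subset_Icc_self
    have hc3 : Tendsto (fun x => φ' x * dφ' x) (𝓝[Ioo α β] α) (𝓝 (φ α * dφ α)) :=
      hc1.tendsto.congr' (by
        filter_upwards [self_mem_nhdsWithin] with x hx
        exact hder hφ hφ' hφsq x hx)
    have hne : (𝓝[Ioo α β] α).NeBot := by
      rw [nhdsWithin_Ioo_eq_nhdsGT hab]; infer_instance
    have := tendsto_nhds_unique hc3 hc2.tendsto
    simpa [hφ0, hφ1, hφ'0, hφ'1] using this
  · have hm : ∀ᵐ x ∂(volume.restrict (Ioo α β)), x ∈ Ioo α β := ae_restrict_mem measurableSet_Ioo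
    filter_upwards [hder2 hφ hφ' hφsq, hder2 hs hs' hssq, hm] with x h1 h2 hx
    by_cases hz : φ x = 0
    · refine h2 fun hz' => ?_
      have := hW x (Ioo_subset_Icc_self hx)
      simp [hz, hz'] at this
    · exact h1 hz

/-- Two families of solutions along a ray, with potentials `q` and `p`, normalized by
`y'(α) - h y(α) = 1` and `z'(α) - k z(α) = 1`, decaying to the right and equal at `α`. -/
structure RayPair (q p : ℝ → ℂ) (α β : ℝ) (h k ν : ℂ) (Y dY Z dZ : ℝ → ℝ → ℂ) : Prop where
  re_pos : 0 < ν.re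
  sol₁ : ∀ᶠ t : ℝ in atTop, Sol q (-(t * ν) ^ 2) α β (Y t) (dY t)
  sol₂ : ∀ᶠ t : ℝ in atTop, Sol p (-(t * ν) ^ 2) α β (Z t) (dZ t)
  norm₁ : ∀ᶠ t in atTop, dY t α - h * Y t α = 1
  norm₂ : ∀ᶠ t in atTop, dZ t α - k * Z t α = 1
  eq_left : ∀ᶠ t in atTop, Y t α = Z t α
  dec₁ : Decays ν α β Y dY
  dec₂ : Decays ν α β Z dZ

theorem tendsto_const_div_ofReal (c : ℂ) :
    Tendsto (fun t : ℝ => c / (t : ℂ)) atTop (𝓝 0) := by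
  have h := (Complex.continuous_ofReal.tendsto 0).comp tendsto_inv_atTop_zero
  simpa [div_eq_mul_inv, Function.comp_def] using h.const_mul c

/-- The normalization gives `1 / (t y) = y' / (t y) - h / t`, whose limit is `-ν`. -/
theorem Decays.tendsto_mul {ν h : ℂ} {α β : ℝ} {y dy : ℝ → ℝ → ℂ} (hd : Decays ν α β y dy)
    (hν : ν ≠ 0) (hn : ∀ᶠ t in atTop, dy t α - h * y t α = 1) :
    Tendsto (fun t : ℝ => t * y t α) atTop (𝓝 (-ν)⁻¹) := by
  have h1 := tendsto_const_div_ofReal h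
  have h2 := (hd.ratio.sub h1).inv₀ (by simpa using hν)
  rw [sub_zero] at h2
  refine h2.congr' ?_
  filter_upwards [hn, hd.ne, eventually_gt_atTop 0] with t h3 h4 ht0
  have ht' : (t : ℂ) ≠ 0 := by exact_mod_cast ht0.ne'
  have : dy t α = 1 + h * y t α := by linear_combination h3
  rw [this]
  field_simp
  simp

theorem Decays.tendsto_zero {ν h : ℂ} {α β : ℝ} {y dy : ℝ → ℝ → ℂ} (hd : Decays ν α β y dy)
    (hν : ν ≠ 0) (hn : ∀ᶠ t in atTop, dy t α - h * y t α = 1) :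
    Tendsto (fun t : ℝ => y t α) atTop (𝓝 0) := by
  have h := (tendsto_const_div_ofReal 1).mul (hd.tendsto_mul hν hn)
  rw [zero_mul] at h
  refine h.congr' ?_
  filter_upwards [eventually_gt_atTop 0] with t ht0
  have ht' : (t : ℂ) ≠ 0 := by exact_mod_cast ht0.ne'
  field_simp

theorem Sol.eventually_norm_le {q : ℝ → ℂ} {α β : ℝ} {ν h : ℂ} {y dy : ℝ → ℝ → ℂ} (hab : α ≤ β)
    (hq : IntervalIntegrable q volume α β) (hν : 0 < ν.re)
    (hsol : ∀ᶠ t : ℝ in atTop, Sol q (-(t * ν) ^ 2) α β (y t) (dy t))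
    (h0 : ∀ᶠ t in atTop, y t α = 1) (h1 : ∀ᶠ t in atTop, dy t α = h) :
    ∀ᶠ t in atTop, ∀ x ∈ Icc α β, ‖y t x‖ ≤ 8 * Real.exp (t * ν.re * (x - α)) := by
  have hν0 : ν ≠ 0 := fun h => by simp [h] at hν
  have hνn : 0 < ‖ν‖ := norm_pos_iff.2 hν0
  filter_upwards [hsol, h0, h1, eventually_gt_atTop 0, eventually_ge_atTop (‖h‖ / ‖ν‖),
      eventually_ge_atTop ((2 * ∫ t in α..β, ‖q t‖) / ‖ν‖)] with t hs h0 h1 ht0 hth htQ x hx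
  rw [div_le_iff₀ hνn] at hth htQ
  have hμn : ‖(t : ℂ) * ν‖ = t * ‖ν‖ := by
    rw [norm_mul, Complex.norm_real, Real.norm_of_nonneg ht0.le]
  have hre : ((t : ℂ) * ν).re = t * ν.re := by simp
  have hpos : 0 < ‖(t : ℂ) * ν‖ := by rw [hμn]; positivity
  obtain ⟨h2, -⟩ := hs.norm_le hab hq (μ := t * ν) (by ring) (by rw [hre]; positivity)
    (norm_pos_iff.1 hpos) (by rwa [hμn]) hx
  rw [h0, h1, norm_one, mul_one, hre] at h2
  refine le_of_mul_le_mul_left (h2.trans ?_) hpos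
  have : ‖h‖ + ‖(t : ℂ) * ν‖ ≤ 2 * ‖(t : ℂ) * ν‖ := by rw [hμn]; linarith
  nlinarith [mul_le_mul_of_nonneg_right this (Real.exp_pos (t * ν.re * (x - α))).le]

section

variable {q p : ℝ → ℂ} {α β : ℝ} {h k ν : ℂ} {Y dY Z dZ : ℝ → ℝ → ℂ}

/-- With `Y = s + Y(α) φ` and likewise for `Z`, the equality `Y(α) = Z(α)` cancels the terms in `φ
φ'` and the expression becomes `Y φ' - φ Z`. The decay of `Y`, `Z` exactly offsets the growth of
`φ`, `φ'`, and a multiple of `‖Y(α)‖`, which tends to `0`, remains. -/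
theorem RayPair.tendsto_cross (hab : α ≤ β) (hq : IntervalIntegrable q volume α β)
    (hp : IntervalIntegrable p volume α β) (H : RayPair q p α β h k ν Y dY Z dZ) {x : ℝ}
    (hx : x ∈ Icc α β) :
    Tendsto (fun t : ℝ => solY q α β 0 1 (-(t * ν) ^ 2) x * solY p α β 1 k (-(t * ν) ^ 2) x
      - solY q α β 1 h (-(t * ν) ^ 2) x * solY p α β 0 1 (-(t * ν) ^ 2) x) atTop (𝓝 0) := by
  have hν0 : ν ≠ 0 := fun h => by have := H.re_pos; simp [h] at this
  obtain ⟨C, hC⟩ := H.dec₁.bound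
  obtain ⟨D, hD⟩ := H.dec₂.bound
  have hφ := Sol.eventually_norm_le hab hq H.re_pos (y := fun t => solY q α β 1 h (-(t * ν) ^ 2))
    (Eventually.of_forall fun t => (sol_spec hab hq 1 h _).1)
    (Eventually.of_forall fun t => (sol_spec hab hq 1 h _).2.1)
    (Eventually.of_forall fun t => (sol_spec hab hq 1 h _).2.2)
  have hψ := Sol.eventually_norm_le hab hp H.re_pos (y := fun t => solY p α β 1 k (-(t * ν) ^ 2))
    (Eventually.of_forall fun t => (sol_spec hab hp 1 k _).1)
    (Eventually.of_forall fun t => (sol_spec hab hp 1 k _).2.1)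
    (Eventually.of_forall fun t => (sol_spec hab hp 1 k _).2.2)
  have hM := H.dec₁.tendsto_zero hν0 H.norm₁
  rw [tendsto_zero_iff_norm_tendsto_zero]
  have hlim : Tendsto (fun t : ℝ => (8 * C + 8 * D) * ‖Y t α‖) atTop (𝓝 0) := by
    simpa using hM.norm.const_mul (8 * C + 8 * D)
  refine squeeze_zero' (Eventually.of_forall fun _ => norm_nonneg _) ?_ hlim
  filter_upwards [H.sol₁, H.sol₂, H.norm₁, H.norm₂, H.eq_left, hC, hD, hφ, hψ]
    with t s1 s2 n1 n2 el c1 c2 p1 p2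
  obtain ⟨a1, a2, a3⟩ := sol_spec hab hq 1 h (-(t * ν) ^ 2)
  obtain ⟨b1, b2, b3⟩ := sol_spec hab hq 0 1 (-(t * ν) ^ 2)
  obtain ⟨a1', a2', a3'⟩ := sol_spec hab hp 1 k (-(t * ν) ^ 2)
  obtain ⟨b1', b2', b3'⟩ := sol_spec hab hp 0 1 (-(t * ν) ^ 2)
  have e1 := (s1.unique hab hq (b1.lin a1 1 (Y t α)) (left_mem_Icc.2 hab) (by simp [a2, b2])
    (by simp only [a3, b3]; linear_combination n1) x hx).1
  have e2 := (s2.unique hab hp (b1'.lin a1' 1 (Z t α)) (left_mem_Icc.2 hab) (by simp [a2', b2'])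
    (by simp only [a3', b3']; linear_combination n2) x hx).1
  have e3 : solY q α β 0 1 (-(t * ν) ^ 2) x * solY p α β 1 k (-(t * ν) ^ 2) x
      - solY q α β 1 h (-(t * ν) ^ 2) x * solY p α β 0 1 (-(t * ν) ^ 2) x =
      Y t x * solY p α β 1 k (-(t * ν) ^ 2) x - solY q α β 1 h (-(t * ν) ^ 2) x * Z t x := by
    rw [e1, e2, el]; ring
  rw [e3]
  refine (norm_sub_le _ _).trans ?_
  rw [norm_mul, norm_mul]
  have hE : Real.exp (-(t * ν.re * (x - α))) * Real.exp (t * ν.re * (x - α)) = 1 := by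
    rw [← Real.exp_add]; simp
  have f1 : ‖Y t x‖ * ‖solY p α β 1 k (-(t * ν) ^ 2) x‖ ≤
      (C * Real.exp (-(t * ν.re * (x - α))) * ‖Y t α‖) * (8 * Real.exp (t * ν.re * (x - α))) := by
    have := c1 x hx
    exact mul_le_mul this (p2 x hx) (norm_nonneg _) ((norm_nonneg _).trans this)
  have f2 : ‖solY q α β 1 h (-(t * ν) ^ 2) x‖ * ‖Z t x‖ ≤
      (8 * Real.exp (t * ν.re * (x - α))) * (D * Real.exp (-(t * ν.re * (x - α))) * ‖Z t α‖) :=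
    mul_le_mul (p1 x hx) (c2 x hx) (norm_nonneg _) (by positivity)
  rw [← el] at f2
  refine (add_le_add f1 f2).trans (le_of_eq ?_)
  linear_combination (8 * C + 8 * D) * ‖Y t α‖ * hE

/-- Local uniqueness: families of solutions with the same initial values along two opposite rays
determine the potential and the boundary coefficient. -/
theorem RayPair.eq_of_opposite {ν' : ℂ} {Y' dY' Z' dZ' : ℝ → ℝ → ℂ} (hab : α < β)
    (hq : IntervalIntegrable q volume α β) (hp : IntervalIntegrable p volume α β)
    (H : RayPair q p α β h k ν Y dY Z dZ) (H' : RayPair q p α β h k ν' Y' dY' Z' dZ')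
    (hν : ν' ^ 2 = -ν ^ 2) : h = k ∧ q =ᵐ[volume.restrict (Ioo α β)] p := by
  have hν0 : ν ≠ 0 := fun h => by have := H.re_pos; simp [h] at this
  have hcross : ∀ x ∈ Icc α β, ∀ w, solY q α β 0 1 w x * solY p α β 1 k w x
      - solY q α β 1 h w x * solY p α β 0 1 w x = 0 := by
    intro x hx
    have hO : OrderHalf fun w => solY q α β 0 1 w x * solY p α β 1 k w x
        - solY q α β 1 h w x * solY p α β 0 1 w x :=
      ((orderHalf_sol hab.le hq 0 1 hx).1.mul (orderHalf_sol hab.le hp 1 k hx).1).sub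
        ((orderHalf_sol hab.le hq 1 h hx).1.mul (orderHalf_sol hab.le hp 0 1 hx).1)
    -- The two families live at `w = -ν² t²` and, since `ν' ^ 2 = -ν ^ 2`, at `w = ν² t²`.
    refine hO.eq_zero_of_tendsto (u := -ν ^ 2) (neg_ne_zero.2 (pow_ne_zero 2 hν0)) ?_ ?_
    · refine (H.tendsto_cross hab.le hq hp hx).congr fun t => ?_
      rw [show -((t : ℂ) * ν) ^ 2 = -ν ^ 2 * t ^ 2 by ring]
    · refine (H'.tendsto_cross hab.le hq hp hx).congr fun t => ?_
      rw [show -((t : ℂ) * ν') ^ 2 = - -ν ^ 2 * t ^ 2 by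
        rw [mul_pow, hν]; ring]
  obtain ⟨a1, a2, a3⟩ := sol_spec hab.le hq 1 h 0
  obtain ⟨b1, b2, b3⟩ := sol_spec hab.le hq 0 1 0
  obtain ⟨a1', a2', a3'⟩ := sol_spec hab.le hp 1 k 0
  obtain ⟨b1', b2', b3'⟩ := sol_spec hab.le hp 0 1 0
  exact potential_eq_of_cross_eq hab a1 b1 a1' b1' a2 a3 b2 b3 a2' a3' b2' b3'
    fun x hx => hcross x hx 0

theorem RayPair.eventually_eq (hab : α ≤ β) (hp : IntervalIntegrable p volume α β)
    (H : RayPair q p α β h k ν Y dY Z dZ) (hk : h = k)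
    (hqp : q =ᵐ[volume.restrict (Ioo α β)] p) :
    ∀ᶠ t in atTop, ∀ x ∈ Icc α β, Y t x = Z t x ∧ dY t x = dZ t x := by
  filter_upwards [H.sol₁, H.sol₂, H.norm₁, H.norm₂, H.eq_left] with t s1 s2 n1 n2 el
  refine (s1.congr_ae hqp).unique hab hp s2 (left_mem_Icc.2 hab) el ?_
  linear_combination n1 - n2 + h * el + Z t α * hk

end

/-! ### The branch of the square root -/

/-- The square root of `-z ^ 2` with nonnegative real part. -/
noncomputable def nu (z : ℂ) : ℂ := if z.im < 0 then Complex.I * z else -Complex.I * z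

theorem nu_of_neg {z : ℂ} (h : z.im < 0) : nu z = Complex.I * z := by simp [nu, h]

theorem nu_of_pos {z : ℂ} (h : 0 < z.im) : nu z = -Complex.I * z := by simp [nu, h.le]

theorem nu_sq (z : ℂ) : nu z ^ 2 = -z ^ 2 := by
  unfold nu
  split_ifs <;> simp [mul_pow]

theorem nu_re_pos {z : ℂ} (h : z.im ≠ 0) : 0 < (nu z).re := by
  rcases lt_or_gt_of_ne h with h | h
  · rw [nu_of_neg h]; simpa using h
  · rw [nu_of_pos h]; simpa using h

theorem nu_ne_zero {z : ℂ} (h : z.im ≠ 0) : nu z ≠ 0 := fun h0 => by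
  have := nu_re_pos h
  simp [h0] at this

theorem nu_real_mul {z : ℂ} {τ : ℝ} (hτ : 0 < τ) : nu (τ * z) = τ * nu z := by
  unfold nu
  have : ((τ : ℂ) * z).im < 0 ↔ z.im < 0 := by
    rw [Complex.im_ofReal_mul]
    constructor
    · intro h; by_contra h'; push Not at h'; nlinarith [mul_nonneg hτ.le h']
    · intro h; exact mul_neg_of_pos_of_neg hτ h
  simp only [this]
  split_ifs <;> ring

/-! ### Solutions of the jump problem, the characteristic function and the Weyl function -/

namespace BVP

variable {T : ℝ} {L : BVP} {lam : ℂ} {u v : Pieces}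

theorem Admissible.intervalIntegrable (hL : L.Admissible T) {α β : ℝ} (hα : 0 ≤ α) (hαβ : α ≤ β)
    (hβ : β ≤ T) : IntervalIntegrable L.q volume α β := by
  rw [intervalIntegrable_iff_integrableOn_Ioo_of_le hαβ]
  exact hL.q_integrable.mono_set (Ioo_subset_Ioo hα hβ)

theorem Admissible.left (hL : L.Admissible T) : IntervalIntegrable L.q volume 0 L.b :=
  hL.intervalIntegrable le_rfl hL.b_pos.le hL.b_lt.le

theorem Admissible.right (hL : L.Admissible T) : IntervalIntegrable L.q volume L.b T :=
  hL.intervalIntegrable hL.b_pos.le hL.b_lt.le le_rfl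

theorem solvesOn_iff {α β : ℝ} {y dy : ℝ → ℂ} {a : ℂ} (hr : ∀ x ∈ Ioo α β, L.r x = a ^ 2) :
    L.SolvesOn lam α β y dy ↔ Sol L.q (lam * a ^ 2) α β y dy := by
  have hm : ∀ᵐ x ∂(volume.restrict (Ioo α β)), x ∈ Ioo α β := ae_restrict_mem measurableSet_Ioo
  constructor
  · rintro ⟨h1, h2, h3⟩
    refine ⟨h1, h2, ?_⟩
    filter_upwards [h3, hm] with x hx hx'
    rw [hr x hx'] at hx
    exact hx.congr_deriv (by ring)
  · rintro ⟨h1, h2, h3⟩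
    refine ⟨h1, h2, ?_⟩
    filter_upwards [h3, hm] with x hx hx'
    rw [hr x hx']
    exact hx.congr_deriv (by ring)

theorem r_left : ∀ x ∈ Ioo 0 L.b, L.r x = L.a₁ ^ 2 := fun x hx => by simp [r, hx.2]

theorem r_right : ∀ x ∈ Ioo L.b T, L.r x = L.a₂ ^ 2 := fun x hx => by simp [r, hx.1.le]

theorem isSolution_iff : L.IsSolution T lam u ↔
    Sol L.q (lam * L.a₁ ^ 2) 0 L.b u.y u.dy ∧ Sol L.q (lam * L.a₂ ^ 2) L.b T u.Y u.dY ∧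
      u.Y L.b = L.d₁ * u.y L.b ∧ u.dY L.b = u.dy L.b / L.d₁ + L.d₂ * u.y L.b := by
  rw [← solvesOn_iff r_left, ← solvesOn_iff r_right]
  exact ⟨fun h => ⟨h.left, h.right, h.jump, h.jump_deriv⟩, fun h => ⟨h.1, h.2.1, h.2.2.1, h.2.2.2⟩⟩

/-- The linear combination `c u + d v`. -/
def Pieces.lin (u v : Pieces) (c d : ℂ) : Pieces where
  y x := c * u.y x + d * v.y x
  dy x := c * u.dy x + d * v.dy x
  Y x := c * u.Y x + d * v.Y x
  dY x := c * u.dY x + d * v.dY x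

theorem IsSolution.lin (hu : L.IsSolution T lam u) (hv : L.IsSolution T lam v) (c d : ℂ) :
    L.IsSolution T lam (u.lin v c d) := by
  rw [isSolution_iff] at *
  obtain ⟨h1, h2, h3, h4⟩ := hu
  obtain ⟨k1, k2, k3, k4⟩ := hv
  refine ⟨h1.lin k1 c d, h2.lin k2 c d, ?_, ?_⟩
  · simp only [Pieces.lin, h3, k3]; ring
  · simp only [Pieces.lin, h4, k4]; ring

theorem V_lin (c d : ℂ) : L.V T (u.lin v c d) = c * L.V T u + d * L.V T v := by
  simp only [V, Pieces.lin]; ring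

theorem U_lin (c d : ℂ) : L.U (u.lin v c d) = c * L.U u + d * L.U v := by
  simp only [U, Pieces.lin]; ring

/-- The solution with initial values `y(0) = c₀`, `y'(0) = c₁`. -/
noncomputable def pieces (T : ℝ) (L : BVP) (c₀ c₁ lam : ℂ) : Pieces where
  y := solY L.q 0 L.b c₀ c₁ (lam * L.a₁ ^ 2)
  dy := solD L.q 0 L.b c₀ c₁ (lam * L.a₁ ^ 2)
  Y := solY L.q L.b T (L.d₁ * solY L.q 0 L.b c₀ c₁ (lam * L.a₁ ^ 2) L.b)
    (solD L.q 0 L.b c₀ c₁ (lam * L.a₁ ^ 2) L.b / L.d₁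
      + L.d₂ * solY L.q 0 L.b c₀ c₁ (lam * L.a₁ ^ 2) L.b) (lam * L.a₂ ^ 2)
  dY := solD L.q L.b T (L.d₁ * solY L.q 0 L.b c₀ c₁ (lam * L.a₁ ^ 2) L.b)
    (solD L.q 0 L.b c₀ c₁ (lam * L.a₁ ^ 2) L.b / L.d₁
      + L.d₂ * solY L.q 0 L.b c₀ c₁ (lam * L.a₁ ^ 2) L.b) (lam * L.a₂ ^ 2)

theorem pieces_spec (hL : L.Admissible T) (c₀ c₁ lam : ℂ) :
    L.IsSolution T lam (L.pieces T c₀ c₁ lam) ∧ (L.pieces T c₀ c₁ lam).y 0 = c₀ ∧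
      (L.pieces T c₀ c₁ lam).dy 0 = c₁ := by
  obtain ⟨h1, h2, h3⟩ := sol_spec hL.b_pos.le hL.left c₀ c₁ (lam * L.a₁ ^ 2)
  obtain ⟨k1, k2, k3⟩ := sol_spec hL.b_lt.le hL.right
    (L.d₁ * solY L.q 0 L.b c₀ c₁ (lam * L.a₁ ^ 2) L.b)
    (solD L.q 0 L.b c₀ c₁ (lam * L.a₁ ^ 2) L.b / L.d₁
      + L.d₂ * solY L.q 0 L.b c₀ c₁ (lam * L.a₁ ^ 2) L.b) (lam * L.a₂ ^ 2)
  exact ⟨isSolution_iff.2 ⟨h1, k1, k2, k3⟩, h2, h3⟩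

theorem IsSolution.unique (hL : L.Admissible T) (hu : L.IsSolution T lam u)
    (hv : L.IsSolution T lam v) (h0 : u.y 0 = v.y 0) (h1 : u.dy 0 = v.dy 0) :
    ∀ x ∈ Icc L.b T, u.Y x = v.Y x ∧ u.dY x = v.dY x := by
  obtain ⟨a1, a2, a3, a4⟩ := isSolution_iff.1 hu
  obtain ⟨c1, c2, c3, c4⟩ := isSolution_iff.1 hv
  have hb := a1.unique hL.b_pos.le hL.left c1 (left_mem_Icc.2 hL.b_pos.le) h0 h1 L.b
    (right_mem_Icc.2 hL.b_pos.le)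
  exact a2.unique hL.b_lt.le hL.right c2 (left_mem_Icc.2 hL.b_lt.le) (by rw [a3, c3, hb.1])
    (by rw [a4, c4, hb.1, hb.2])

theorem IsSolution.V_eq (hL : L.Admissible T) (hu : L.IsSolution T lam u)
    (hv : L.IsSolution T lam v) (h0 : u.y 0 = v.y 0) (h1 : u.dy 0 = v.dy 0) :
    L.V T u = L.V T v := by
  obtain ⟨e1, e2⟩ := hu.unique hL hv h0 h1 T (right_mem_Icc.2 hL.b_lt.le)
  rw [V, V, e1, e2]

/-- A solution which vanishes at `T` together with its derivative is trivial. -/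
theorem IsSolution.eq_zero_of_right (hL : L.Admissible T) (hu : L.IsSolution T lam u)
    (h0 : u.Y T = 0) (h1 : u.dY T = 0) : u.y 0 = 0 ∧ u.dy 0 = 0 := by
  obtain ⟨a1, a2, a3, a4⟩ := isSolution_iff.1 hu
  have hz : ∀ {w : ℂ} {α β : ℝ}, Sol L.q w α β (fun _ => 0) (fun _ => 0) := fun {w α β} =>
    ⟨fun x _ => hasDerivWithinAt_const x _ _,
      ((LipschitzWith.const (0 : ℂ)).lipschitzOnWith (s := uIcc α β)).absolutelyContinuousOnInterval,
      Eventually.of_forall fun x => (hasDerivAt_const x (0 : ℂ)).congr_deriv (by simp)⟩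
  have hr := a2.unique hL.b_lt.le hL.right hz (right_mem_Icc.2 hL.b_lt.le) h0 h1 L.b
    (left_mem_Icc.2 hL.b_lt.le)
  have hyb : u.y L.b = 0 := by
    have := hr.1
    rw [a3] at this
    exact (mul_eq_zero.1 this).resolve_left hL.d₁_ne
  have hdyb : u.dy L.b = 0 := by
    have := hr.2
    rw [a4, hyb, mul_zero, add_zero, div_eq_zero_iff] at this
    exact this.resolve_right hL.d₁_ne
  exact a1.unique hL.b_pos.le hL.left hz (right_mem_Icc.2 hL.b_pos.le) hyb hdyb 0
    (left_mem_Icc.2 hL.b_pos.le)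

/-- The jump matrix `((d₁, 0), (d₂, 1 / d₁))` has determinant `1`, so the Wronskian passes through
`b` unchanged. -/
theorem IsSolution.wronskian (hL : L.Admissible T) (hu : L.IsSolution T lam u)
    (hv : L.IsSolution T lam v) :
    u.Y T * v.dY T - v.Y T * u.dY T = u.y 0 * v.dy 0 - v.y 0 * u.dy 0 := by
  obtain ⟨a1, a2, a3, a4⟩ := isSolution_iff.1 hu
  obtain ⟨c1, c2, c3, c4⟩ := isSolution_iff.1 hv
  have h1 := a1.wronskian hL.b_pos.le c1 L.b (right_mem_Icc.2 hL.b_pos.le)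
  have h2 := a2.wronskian hL.b_lt.le c2 T (right_mem_Icc.2 hL.b_lt.le)
  rw [h2, ← h1, a3, a4, c3, c4]
  have := hL.d₁_ne
  field_simp
  ring

/-- `V` of the solution with the given initial values, as a function of the spectral parameter. -/
noncomputable def vInit (T : ℝ) (L : BVP) (c₀ c₁ lam : ℂ) : ℂ := L.V T (L.pieces T c₀ c₁ lam)

/-- The right piece is expanded in the fundamental system at `b`, whose initial values do not depend
on the parameter; `V` becomes a sum of products of functions of order `1 / 2`. -/
theorem orderHalf_vInit (hL : L.Admissible T) (c₀ c₁ : ℂ) : OrderHalf (L.vInit T c₀ c₁) := by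
  have hb := right_mem_Icc.2 hL.b_pos.le
  have hT := right_mem_Icc.2 hL.b_lt.le
  have l1 := (orderHalf_sol hL.b_pos.le hL.left c₀ c₁ hb).1.comp_mul (L.a₁ ^ 2)
  have l2 := (orderHalf_sol hL.b_pos.le hL.left c₀ c₁ hb).2.comp_mul (L.a₁ ^ 2)
  have r1 := (orderHalf_sol hL.b_lt.le hL.right 1 0 hT).1.comp_mul (L.a₂ ^ 2)
  have r2 := (orderHalf_sol hL.b_lt.le hL.right 1 0 hT).2.comp_mul (L.a₂ ^ 2)
  have r3 := (orderHalf_sol hL.b_lt.le hL.right 0 1 hT).1.comp_mul (L.a₂ ^ 2)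
  have r4 := (orderHalf_sol hL.b_lt.le hL.right 0 1 hT).2.comp_mul (L.a₂ ^ 2)
  have A := (OrderHalf.const L.d₁).mul l1
  have B := (l2.mul (OrderHalf.const L.d₁⁻¹)).add ((OrderHalf.const L.d₂).mul l1)
  have := ((A.mul r2).add (B.mul r4)).add
    ((OrderHalf.const L.H).mul ((A.mul r1).add (B.mul r3)))
  convert this using 2 with lam
  obtain ⟨k1, k2, k3⟩ := sol_spec hL.b_lt.le hL.right
    (L.d₁ * solY L.q 0 L.b c₀ c₁ (lam * L.a₁ ^ 2) L.b)
    (solD L.q 0 L.b c₀ c₁ (lam * L.a₁ ^ 2) L.b / L.d₁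
      + L.d₂ * solY L.q 0 L.b c₀ c₁ (lam * L.a₁ ^ 2) L.b) (lam * L.a₂ ^ 2)
  obtain ⟨e1, e2⟩ := k1.eq_comb hL.b_lt.le hL.right T hT
  rw [k2, k3] at e1 e2
  simp only [vInit, V, pieces]
  rw [e1, e2]
  simp only [div_eq_mul_inv]

/-- Every solution is `u(0) φ + U(u) s`. Applied to the Weyl solution this gives `M = -V(s) / V(φ)`.
-/
theorem V_eq_comb (hL : L.Admissible T) (hu : L.IsSolution T lam u) :
    L.V T u = u.y 0 * L.vInit T 1 L.h lam + L.U u * L.vInit T 0 1 lam := by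
  obtain ⟨a1, a2, a3⟩ := pieces_spec hL 1 L.h lam
  obtain ⟨b1, b2, b3⟩ := pieces_spec hL 0 1 lam
  rw [hu.V_eq hL (a1.lin b1 (u.y 0) (L.U u)) (by simp [Pieces.lin, a2, b2])
    (by simp only [Pieces.lin, a3, b3, U]; ring), V_lin]
  rfl

theorem charFun_eq (hL : L.Admissible T) (lam : ℂ) : L.charFun T lam = -L.vInit T 1 L.h lam := by
  have h := Classical.epsilon_spec (p := fun u => L.IsSolution T lam u ∧ u.y 0 = 1 ∧ u.dy 0 = L.h)
    ⟨_, pieces_spec hL 1 L.h lam⟩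
  rw [charFun, phi, V_eq_comb hL h.1]
  simp only [U]
  rw [h.2.1, h.2.2]
  simp

theorem charFun_ne_zero_iff (hL : L.Admissible T) :
    L.charFun T lam ≠ 0 ↔ L.vInit T 1 L.h lam ≠ 0 := by
  rw [charFun_eq hL, neg_ne_zero]

theorem weylSol_spec (hL : L.Admissible T) (h : L.vInit T 1 L.h lam ≠ 0) :
    L.IsSolution T lam (L.weylSol T lam) ∧ L.U (L.weylSol T lam) = 1 ∧
      L.V T (L.weylSol T lam) = 0 := by
  obtain ⟨a1, a2, a3⟩ := pieces_spec hL 1 L.h lam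
  obtain ⟨b1, b2, b3⟩ := pieces_spec hL 0 1 lam
  refine Classical.epsilon_spec (p := fun u => L.IsSolution T lam u ∧ L.U u = 1 ∧ L.V T u = 0)
    ⟨_, a1.lin b1 (-L.vInit T 0 1 lam / L.vInit T 1 L.h lam) 1, ?_, ?_⟩
  · rw [U_lin, U, U, a2, a3, b2, b3]; ring
  · rw [V_lin]
    change _ * L.vInit T 1 L.h lam + 1 * L.vInit T 0 1 lam = 0
    field_simp
    ring

theorem weyl_eq (hL : L.Admissible T) (h : L.vInit T 1 L.h lam ≠ 0) :
    L.weyl T lam = -L.vInit T 0 1 lam / L.vInit T 1 L.h lam := by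
  obtain ⟨h1, h2, h3⟩ := weylSol_spec hL h
  rw [V_eq_comb hL h1, h2] at h3
  rw [weyl, eq_div_iff h]
  linear_combination h3

/-- There is always a nontrivial solution of the boundary condition at `T`. -/
theorem exists_rightSol (hL : L.Admissible T) (lam : ℂ) :
    ∃ u, L.IsSolution T lam u ∧ L.V T u = 0 ∧ u.Y T ≠ 0 ∧
      (L.vInit T 1 L.h lam = 0 → L.U u = 0) := by
  have hne : ∀ u, L.IsSolution T lam u → L.V T u = 0 → u.y 0 ≠ 0 ∨ u.dy 0 ≠ 0 → u.Y T ≠ 0 := by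
    intro u hu hV h0 hY
    have hdY : u.dY T = 0 := by rw [V, hY] at hV; simpa using hV
    obtain ⟨e1, e2⟩ := hu.eq_zero_of_right hL hY hdY
    exact h0.elim (fun h => h e1) fun h => h e2
  by_cases h : L.vInit T 1 L.h lam = 0
  · obtain ⟨a1, a2, a3⟩ := pieces_spec hL 1 L.h lam
    exact ⟨_, a1, h, hne _ a1 h (Or.inl (by rw [a2]; exact one_ne_zero)), fun _ => by
      rw [U, a2, a3]; ring⟩
  · obtain ⟨h1, h2, h3⟩ := weylSol_spec hL h
    refine ⟨_, h1, h3, hne _ h1 h3 ?_, fun h' => absurd h' h⟩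
    by_contra hc
    push Not at hc
    rw [U, hc.1, hc.2] at h2
    simp at h2

/-! ### Behaviour along generic rays -/

/-- The direction `ω` is not exceptional: along the ray `lam = (t ω) ^ 2` the exponentials on both
parts of the interval grow. -/
def Generic (L : BVP) (ω : ℂ) : Prop := (ω * L.a₁).im ≠ 0 ∧ (ω * L.a₂).im ≠ 0

/-- The product of the two numbers `d₁ a₂ ± a₁ / d₁` is `((d₁² a₂)² - a₁²) / d₁²`, and squaring
removes the choice of branch in `nu`. One sign lets decay continue from `b` into the left piece, the
other distinguishes `b` from interior points. -/
theorem Admissible.sq_mul_nu_ne (hL : L.Admissible T) {ω : ℂ} (hω : L.Generic ω) :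
    L.d₁ ^ 2 * nu (ω * L.a₂) ≠ nu (ω * L.a₁) ∧ -(L.d₁ ^ 2 * nu (ω * L.a₂)) ≠ nu (ω * L.a₁) := by
  have hω0 : ω ≠ 0 := fun h => by have := hω.1; simp [h] at this
  have hd := hL.d₁_ne
  have key : (L.d₁ ^ 2 * nu (ω * L.a₂)) ^ 2 ≠ nu (ω * L.a₁) ^ 2 := by
    intro h
    rw [mul_pow, nu_sq, nu_sq] at h
    have h1 : (L.d₁ * L.a₂ + L.a₁ / L.d₁) * (L.d₁ * L.a₂ - L.a₁ / L.d₁) = 0 := by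
      have h2 : ω ^ 2 * ((L.d₁ ^ 2 * L.a₂) ^ 2 - L.a₁ ^ 2) = 0 := by linear_combination -h
      have h3 := (mul_eq_zero.1 h2).resolve_left (pow_ne_zero 2 hω0)
      field_simp
      linear_combination h3
    rcases mul_eq_zero.1 h1 with h1 | h1
    · exact hL.omega_plus_ne h1
    · exact hL.omega_minus_ne h1
  exact ⟨fun h => key (by rw [h]), fun h => key (by rw [← h]; ring)⟩

/-- Behaviour along a ray of solutions of the boundary condition at `T`. -/
theorem ray_behaviour (hL : L.Admissible T) {ω : ℂ} (hω : L.Generic ω) {u : ℝ → Pieces}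
    (hs : ∀ᶠ t : ℝ in atTop, L.IsSolution T ((t * ω) ^ 2) (u t))
    (hV : ∀ᶠ t in atTop, L.V T (u t) = 0) (hT : ∀ᶠ t in atTop, (u t).Y T ≠ 0) :
    (∀ γ ∈ Ico L.b T, Decays (nu (ω * L.a₂)) γ T (fun t => (u t).Y) fun t => (u t).dY) ∧
    (∀ γ ∈ Ico 0 L.b, Decays (nu (ω * L.a₁)) γ L.b (fun t => (u t).y) fun t => (u t).dy) ∧
    (∀ᶠ t in atTop, (u t).y L.b ≠ 0) ∧
    Tendsto (fun t : ℝ => (u t).dy L.b / (t * (u t).y L.b)) atTop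
      (𝓝 (-(L.d₁ ^ 2 * nu (ω * L.a₂)))) := by
  have hd := hL.d₁_ne
  have hν₂ := nu_re_pos hω.2
  have hR : ∀ γ ∈ Ico L.b T, Decays (nu (ω * L.a₂)) γ T (fun t => (u t).Y) fun t => (u t).dY := by
    intro γ hγ
    -- The boundary condition fixes the logarithmic derivative at `T` as `-H`, negligible after
    -- division by `t`; hence `κ = 0`.
    refine decays_of_ratio hγ.2 (hL.intervalIntegrable (hL.b_pos.le.trans hγ.1) hγ.2.le le_rfl)
      hν₂ ?_ hT (κ := 0) ?_ (nu_ne_zero hω.2).symm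
    · filter_upwards [hs] with t ht
      have := (isSolution_iff.1 ht).2.1
      rw [show ((t : ℂ) * ω) ^ 2 * L.a₂ ^ 2 = -(t * nu (ω * L.a₂)) ^ 2 by
        rw [mul_pow (t : ℂ) (nu _), nu_sq]; ring] at this
      exact this.mono hγ.1 hγ.2.le le_rfl
    · refine (tendsto_const_div_ofReal (-L.H)).congr' ?_
      filter_upwards [hV, hT, eventually_gt_atTop 0] with t h1 h2 ht0
      have ht' : (t : ℂ) ≠ 0 := by exact_mod_cast ht0.ne'
      have : (u t).dY T = -L.H * (u t).Y T := by rw [V] at h1; linear_combination h1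
      rw [this]
      field_simp
  have hb := hR L.b ⟨le_rfl, hL.b_lt⟩
  have hne : ∀ᶠ t in atTop, (u t).y L.b ≠ 0 := by
    filter_upwards [hb.ne, hs] with t h1 h2 h3
    rw [(isSolution_iff.1 h2).2.2.1, h3, mul_zero] at h1
    exact h1 rfl
  have hlim : Tendsto (fun t : ℝ => (u t).dy L.b / (t * (u t).y L.b)) atTop
      (𝓝 (-(L.d₁ ^ 2 * nu (ω * L.a₂)))) := by
    -- The jump conditions read `y' / y = d₁² Y' / Y - d₁ d₂` at `b`, and the last term disappears
    -- after division by `t`.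
    have h1 := (hb.ratio.const_mul (L.d₁ ^ 2)).sub (tendsto_const_div_ofReal (L.d₁ * L.d₂))
    rw [sub_zero, mul_neg] at h1
    refine h1.congr' ?_
    filter_upwards [hne, hs, eventually_gt_atTop 0] with t h2 h3 ht0
    have ht' : (t : ℂ) ≠ 0 := by exact_mod_cast ht0.ne'
    obtain ⟨-, -, e1, e2⟩ := isSolution_iff.1 h3
    rw [e1, e2]
    field_simp
    ring
  refine ⟨hR, fun γ hγ => ?_, hne, hlim⟩
  refine decays_of_ratio hγ.2 (hL.intervalIntegrable hγ.1 hγ.2.le hL.b_lt.le)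
    (nu_re_pos hω.1) ?_ hne hlim (hL.sq_mul_nu_ne hω).2
  filter_upwards [hs] with t ht
  have := (isSolution_iff.1 ht).1
  rw [show ((t : ℂ) * ω) ^ 2 * L.a₁ ^ 2 = -(t * nu (ω * L.a₁)) ^ 2 by
    rw [mul_pow (t : ℂ) (nu _), nu_sq]; ring] at this
  exact this.mono hγ.1 hγ.2.le le_rfl

/-- At an eigenvalue the solution satisfying the condition at `T` also satisfies the one at `0`, so
its logarithmic derivative there is `h`. Divided by `t` this is small, whereas along the ray the
quotient tends to `-ν(ω a₁) ≠ 0`. -/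
theorem eventually_vInit_ne_zero (hL : L.Admissible T) {ω : ℂ} (hω : L.Generic ω) :
    ∀ᶠ t : ℝ in atTop, L.vInit T 1 L.h ((t * ω) ^ 2) ≠ 0 := by
  choose u h1 h2 h3 h4 using fun t : ℝ => exists_rightSol hL ((t * ω) ^ 2)
  obtain ⟨-, hl, -, -⟩ := ray_behaviour hL hω (Eventually.of_forall h1) (Eventually.of_forall h2)
    (Eventually.of_forall h3)
  have h0 := hl 0 ⟨le_rfl, hL.b_pos⟩
  have hlim := h0.ratio.sub (tendsto_const_div_ofReal L.h)
  rw [sub_zero] at hlim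
  filter_upwards [hlim.eventually_ne (neg_ne_zero.2 (nu_ne_zero hω.1)), h0.ne,
    eventually_gt_atTop 0] with t ht hne ht0 hv
  apply ht
  have ht' : (t : ℂ) ≠ 0 := by exact_mod_cast ht0.ne'
  have h5 := h4 t hv
  rw [U, sub_eq_zero] at h5
  simp only [h5]
  field_simp
  simp

/-- The Weyl solutions along a ray. -/
theorem weylSol_ray (hL : L.Admissible T) {ω : ℂ} (hω : L.Generic ω) :
    ∀ᶠ t : ℝ in atTop, L.IsSolution T ((t * ω) ^ 2) (L.weylSol T ((t * ω) ^ 2)) ∧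
      L.U (L.weylSol T ((t * ω) ^ 2)) = 1 ∧ L.V T (L.weylSol T ((t * ω) ^ 2)) = 0 ∧
      (L.weylSol T ((t * ω) ^ 2)).Y T ≠ 0 := by
  filter_upwards [eventually_vInit_ne_zero hL hω] with t ht
  obtain ⟨h1, h2, h3⟩ := weylSol_spec hL ht
  refine ⟨h1, h2, h3, fun h4 => ?_⟩
  have hdY : (L.weylSol T ((t * ω) ^ 2)).dY T = 0 := by rw [V, h4] at h3; simpa using h3
  obtain ⟨e1, e2⟩ := h1.eq_zero_of_right hL h4 hdY
  rw [U, e1, e2] at h2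
  simp at h2

end BVP

/-! ### Rescaling, and consequences of the conditions on arguments -/

theorem IntervalIntegrable.comp_affine {f : ℝ → ℂ} {α β β' c : ℝ} (hc : c ≠ 0)
    (hβ : c * (β' - α) = β - α) (hf : IntervalIntegrable f volume α β) :
    IntervalIntegrable (fun x => f (α + c * (x - α))) volume α β' := by
  have h := ((hf.comp_add_right (α - c * α)).comp_mul_left (c := c))
  have e1 : (α - (α - c * α)) / c = α := by field_simp; ring
  have e2 : (β - (α - c * α)) / c = β' := by field_simp; linear_combination -hβ
  rw [e1, e2] at h
  refine h.congr fun x _ => ?_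
  ring_nf

/-- Rescaling of the independent variable. -/
theorem Sol.comp_affine {q : ℝ → ℂ} {w : ℂ} {α β β' c : ℝ} {y dy : ℝ → ℂ} (hc : 0 < c)
    (hab : α ≤ β) (hβ : c * (β' - α) = β - α) (hq : IntervalIntegrable q volume α β)
    (h : Sol q w α β y dy) :
    Sol (fun x => (c : ℂ) ^ 2 * q (α + c * (x - α))) ((c : ℂ) ^ 2 * w) α β'
      (fun x => y (α + c * (x - α))) fun x => c * dy (α + c * (x - α)) := by
  have hmaps : MapsTo (fun x => α + c * (x - α)) (Icc α β') (Icc α β) := fun x hx =>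
    ⟨by nlinarith [hx.1, mul_nonneg hc.le (sub_nonneg.2 hx.1)],
      by nlinarith [mul_le_mul_of_nonneg_left hx.2 hc.le]⟩
  have hab' : α ≤ β' := by
    have : 0 ≤ c * (β' - α) := by rw [hβ]; linarith
    linarith [nonneg_of_mul_nonneg_right this hc]
  have haff : ∀ x : ℝ, HasDerivAt (fun x => α + c * (x - α)) c x := fun x => by
    simpa using (((hasDerivAt_id' x).sub_const α).const_mul c).const_add α
  have hgi := h.intervalIntegrable hab hq
  have hgi' := (hgi.comp_affine hc.ne' hβ).const_mul ((c : ℂ) ^ 2)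
  have hdy : ∀ x ∈ Icc α β', c * dy α + ∫ t in α..x, (c : ℂ) ^ 2 *
      ((q (α + c * (t - α)) - w) * y (α + c * (t - α))) = c * dy (α + c * (x - α)) := by
    intro x hx
    rw [h.deriv_eq hab hq _ (hmaps hx), intervalIntegral.integral_const_mul]
    have := intervalIntegral.smul_integral_comp_mul_add (E := ℂ) (fun t => (q t - w) * y t) c (α - c * α)
      (a := α) (b := x)
    rw [show c * α + (α - c * α) = α by ring, show c * x + (α - c * α) = α + c * (x - α) by ring,
      Complex.real_smul] at this
    rw [← this, mul_add, pow_two, mul_assoc]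
    simp only [show ∀ t : ℝ, c * t + (α - c * α) = α + c * (t - α) from fun t => by ring]
  refine ⟨fun x hx => ?_, ?_, ?_⟩
  · have := (h.hasDeriv _ (hmaps hx)).scomp x (haff x).hasDerivWithinAt hmaps
    simpa [Function.comp_def] using this
  · exact (hgi'.absolutelyContinuousOnInterval_complex (c * dy α)).congr fun x hx =>
      hdy x (by rwa [← uIcc_of_le hab'])
  · have hm : ∀ᵐ x ∂(volume.restrict (Ioo α β')), x ∈ Ioo α β' := ae_restrict_mem measurableSet_Ioo
    filter_upwards [hgi'.ae_hasDerivAt_add_integral hab' (c * dy α), hm] with x hx hx'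
    refine (hx.congr_of_eventuallyEq ?_).congr_deriv (by ring)
    filter_upwards [Ioo_mem_nhds hx'.1 hx'.2] with z hz
    exact (hdy z (Ioo_subset_Icc_self hz)).symm

theorem Decays.mul {ν : ℂ} {α β : ℝ} {y dy : ℝ → ℝ → ℂ} (h : Decays ν α β y dy) {c : ℝ → ℂ}
    (hc : ∀ᶠ t in atTop, c t ≠ 0) :
    Decays ν α β (fun t x => c t * y t x) fun t x => c t * dy t x := by
  obtain ⟨h1, h2, C, h3⟩ := h
  refine ⟨?_, h2.congr' ?_, C, ?_⟩
  · filter_upwards [h1, hc] with t h4 h5 using mul_ne_zero h5 h4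
  · filter_upwards [hc] with t h5
    rw [mul_left_comm, mul_div_mul_left _ _ h5]
  · filter_upwards [h3] with t h4 x hx
    rw [norm_mul, norm_mul, mul_left_comm]
    exact mul_le_mul_of_nonneg_left (h4 x hx) (norm_nonneg _)

theorem eventually_im_ne_zero {c : ℂ} (hc : c ≠ 0) :
    ∀ᶠ θ : ℝ in 𝓝[≠] 0, (c * (1 + θ * Complex.I)).im ≠ 0 := by
  have e : ∀ θ : ℝ, (c * (1 + θ * Complex.I)).im = c.im + θ * c.re := fun θ => by
    simp [Complex.mul_im]; ring
  simp only [e]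
  by_cases h : c.im = 0
  · have hr : c.re ≠ 0 := fun hr => hc (Complex.ext hr h)
    filter_upwards [self_mem_nhdsWithin] with θ hθ
    rw [h, zero_add]
    exact mul_ne_zero hθ hr
  · have : Tendsto (fun θ : ℝ => c.im + θ * c.re) (𝓝 0) (𝓝 c.im) := by
      have h : Continuous fun θ : ℝ => c.im + θ * c.re := by fun_prop
      simpa using h.tendsto 0
    exact (this.mono_left nhdsWithin_le_nhds).eventually_ne h

theorem upper_of_arg {a : ℂ} (h0 : a ≠ 0) (h1 : 0 ≤ a.arg) (h2 : a.arg < Real.pi) :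
    0 < a.im ∨ a.im = 0 ∧ 0 < a.re := by
  rw [Complex.arg_nonneg_iff] at h1
  rw [Complex.arg_lt_pi_iff] at h2
  rcases h1.lt_or_eq with h | h
  · exact Or.inl h
  · refine Or.inr ⟨h.symm, ?_⟩
    rcases h2 with h2 | h2
    · exact lt_of_le_of_ne h2 fun hr => h0 (Complex.ext hr.symm h.symm)
    · exact absurd h.symm h2

/-- Nonzero numbers with argument in `[0, π)` form a half-plane containing only one of its two
boundary rays, so it never contains both a number and a negative multiple of it. -/
theorem pos_of_arg {a a' : ℂ} {τ : ℝ} (h0 : a ≠ 0) (h1 : 0 ≤ a.arg) (h2 : a.arg < Real.pi)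
    (h0' : a' ≠ 0) (h1' : 0 ≤ a'.arg) (h2' : a'.arg < Real.pi) (h : a' = τ * a) : 0 < τ := by
  have hτ : τ ≠ 0 := fun hτ => h0' (by rw [h, hτ]; simp)
  by_contra hneg
  have hneg : τ < 0 := lt_of_le_of_ne (not_lt.1 hneg) hτ
  have e1 : a'.im = τ * a.im := by rw [h]; simp
  have e2 : a'.re = τ * a.re := by rw [h]; simp
  rcases upper_of_arg h0 h1 h2 with k | ⟨k, k'⟩ <;>
  rcases upper_of_arg h0' h1' h2' with m | ⟨m, m'⟩
  · nlinarith
  · rw [m] at e1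
    exact (mul_ne_zero hτ k.ne') e1.symm
  · rw [e1, k] at m; simp at m
  · nlinarith

theorem eq_of_sq_eq_of_arg {a a' : ℂ} (h0 : a ≠ 0) (h1 : 0 ≤ a.arg) (h2 : a.arg < Real.pi)
    (h0' : a' ≠ 0) (h1' : 0 ≤ a'.arg) (h2' : a'.arg < Real.pi) (h : a ^ 2 = a' ^ 2) : a = a' := by
  rcases sq_eq_sq_iff_eq_or_eq_neg.1 h with h | h
  · exact h
  · have := pos_of_arg (τ := -1) h0 h1 h2 h0' h1' h2' (by rw [h]; simp)
    norm_num at this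

/-! ### Recovering `a₁`, the left piece and `b` -/

namespace BVP

variable {T : ℝ} {L L' : BVP} {lam : ℂ}

theorem Admissible.eventually_generic (hL : L.Admissible T) {c : ℂ} (hc : c ≠ 0) :
    ∀ᶠ θ : ℝ in 𝓝[≠] 0, L.Generic (c * (1 + θ * Complex.I)) := by
  filter_upwards [eventually_im_ne_zero (mul_ne_zero hc hL.a₁_ne),
    eventually_im_ne_zero (mul_ne_zero hc hL.a₂_ne)] with θ h1 h2
  constructor
  · rwa [mul_right_comm]
  · rwa [mul_right_comm]

/-- Since `(i ω) ^ 2 = -ω ^ 2`, the directions `ω` and `i ω` give opposite rays in the plane of the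
spectral parameter. All small nonzero tilts `1 + i θ` avoid the finitely many exceptional lines. -/
theorem exists_generic (hL : L.Admissible T) (hL' : L'.Admissible T) :
    ∃ ω : ℂ, (L.Generic ω ∧ L'.Generic ω) ∧
      L.Generic (Complex.I * ω) ∧ L'.Generic (Complex.I * ω) := by
  obtain ⟨θ, h1, h2, h3, h4⟩ := ((hL.eventually_generic one_ne_zero).and
    ((hL'.eventually_generic one_ne_zero).and ((hL.eventually_generic Complex.I_ne_zero).and
      (hL'.eventually_generic Complex.I_ne_zero)))).exists
  refine ⟨1 * (1 + θ * Complex.I), ⟨h1, h2⟩, ?_⟩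
  rw [one_mul]
  exact ⟨h3, h4⟩

/-- The Weyl solutions on the ray in the direction `ω`. -/
noncomputable def rayWeyl (T : ℝ) (L : BVP) (ω : ℂ) (t : ℝ) : Pieces := L.weylSol T ((t * ω) ^ 2)

theorem rayWeyl_decays (hL : L.Admissible T) {ω : ℂ} (hω : L.Generic ω) :
    (∀ γ ∈ Ico L.b T, Decays (nu (ω * L.a₂)) γ T (fun t => (L.rayWeyl T ω t).Y)
      fun t => (L.rayWeyl T ω t).dY) ∧
    (∀ γ ∈ Ico 0 L.b, Decays (nu (ω * L.a₁)) γ L.b (fun t => (L.rayWeyl T ω t).y)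
      fun t => (L.rayWeyl T ω t).dy) ∧
    (∀ᶠ t in atTop, (L.rayWeyl T ω t).y L.b ≠ 0) ∧
    Tendsto (fun t : ℝ => (L.rayWeyl T ω t).dy L.b / (t * (L.rayWeyl T ω t).y L.b)) atTop
      (𝓝 (-(L.d₁ ^ 2 * nu (ω * L.a₂)))) :=
  ray_behaviour hL hω ((weylSol_ray hL hω).mono fun _ h => h.1)
    ((weylSol_ray hL hω).mono fun _ h => h.2.2.1) ((weylSol_ray hL hω).mono fun _ h => h.2.2.2)

theorem mul_nu_sq (t : ℝ) (ω a : ℂ) : ((t : ℂ) * ω) ^ 2 * a ^ 2 = -(t * nu (ω * a)) ^ 2 := by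
  rw [mul_pow (t : ℂ) (nu _), nu_sq]; ring

theorem rayWeyl_left (hL : L.Admissible T) {ω : ℂ} (hω : L.Generic ω) :
    ∀ᶠ t : ℝ in atTop, Sol L.q (-(t * nu (ω * L.a₁)) ^ 2) 0 L.b (L.rayWeyl T ω t).y
      (L.rayWeyl T ω t).dy := by
  filter_upwards [weylSol_ray hL hω] with t ht
  rw [← mul_nu_sq]
  exact (isSolution_iff.1 ht.1).1

theorem rayWeyl_right (hL : L.Admissible T) {ω : ℂ} (hω : L.Generic ω) :
    ∀ᶠ t : ℝ in atTop, Sol L.q (-(t * nu (ω * L.a₂)) ^ 2) L.b T (L.rayWeyl T ω t).Y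
      (L.rayWeyl T ω t).dY := by
  filter_upwards [weylSol_ray hL hω] with t ht
  rw [← mul_nu_sq]
  exact (isSolution_iff.1 ht.1).2.1

theorem SameWeyl.symm (h : SameWeyl T L L') : SameWeyl T L' L :=
  fun lam h1 h2 => (h lam h2 h1).symm

theorem SameWeyl.eventually_eq (hM : SameWeyl T L L') (hL : L.Admissible T)
    (hL' : L'.Admissible T) {ω : ℂ} (hω : L.Generic ω) (hω' : L'.Generic ω) :
    ∀ᶠ t in atTop, (L.rayWeyl T ω t).y 0 = (L'.rayWeyl T ω t).y 0 := by
  filter_upwards [eventually_vInit_ne_zero hL hω, eventually_vInit_ne_zero hL' hω'] with t h1 h2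
  exact hM _ ((charFun_ne_zero_iff hL).2 h1) ((charFun_ne_zero_iff hL').2 h2)

/-- On a generic ray `t M` tends to `-1 / ν(ω a₁)`, which determines `a₁²`, and the range of the
argument determines the sign. -/
theorem SameWeyl.a₁_eq (hM : SameWeyl T L L') (hL : L.Admissible T) (hL' : L'.Admissible T) :
    L.a₁ = L'.a₁ := by
  obtain ⟨ω, ⟨hω, hω'⟩, -⟩ := exists_generic hL hL'
  have hω0 : ω ≠ 0 := fun h => by have := hω.1; simp [h] at this
  have h1 := ((rayWeyl_decays hL hω).2.1 0 ⟨le_rfl, hL.b_pos⟩).tendsto_mul (nu_ne_zero hω.1)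
    (h := L.h) ((weylSol_ray hL hω).mono fun _ h => h.2.1)
  have h2 := ((rayWeyl_decays hL' hω').2.1 0 ⟨le_rfl, hL'.b_pos⟩).tendsto_mul (nu_ne_zero hω'.1)
    (h := L'.h) ((weylSol_ray hL' hω').mono fun _ h => h.2.1)
  have h3 := tendsto_nhds_unique h1 (h2.congr' ((hM.eventually_eq hL hL' hω hω').mono
    fun t ht => by simp only [ht]))
  have h4 : nu (ω * L.a₁) = nu (ω * L'.a₁) := by simpa using h3
  have h5 : ω ^ 2 * (L.a₁ ^ 2 - L'.a₁ ^ 2) = 0 := by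
    have := congrArg (· ^ 2) h4
    simp only [nu_sq] at this
    linear_combination -this
  exact eq_of_sq_eq_of_arg hL.a₁_ne (hL.arg_a₂_nonneg.trans hL.arg_a₂_lt.le) hL.arg_a₁_lt
    hL'.a₁_ne (hL'.arg_a₂_nonneg.trans hL'.arg_a₂_lt.le) hL'.arg_a₁_lt
    (sub_eq_zero.1 ((mul_eq_zero.1 h5).resolve_left (pow_ne_zero 2 hω0)))

theorem SameWeyl.rayPair_left (hM : SameWeyl T L L') (hL : L.Admissible T)
    (hL' : L'.Admissible T) (hb : L.b ≤ L'.b) {ω : ℂ} (hω : L.Generic ω) (hω' : L'.Generic ω) :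
    RayPair L.q L'.q 0 L.b L.h L'.h (nu (ω * L.a₁)) (fun t => (L.rayWeyl T ω t).y)
      (fun t => (L.rayWeyl T ω t).dy) (fun t => (L'.rayWeyl T ω t).y)
      fun t => (L'.rayWeyl T ω t).dy where
  re_pos := nu_re_pos hω.1
  sol₁ := rayWeyl_left hL hω
  sol₂ := by
    rw [hM.a₁_eq hL hL']
    exact (rayWeyl_left hL' hω').mono fun t h => h.mono le_rfl hL.b_pos.le hb
  norm₁ := (weylSol_ray hL hω).mono fun _ h => h.2.1
  norm₂ := (weylSol_ray hL' hω').mono fun _ h => h.2.1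
  eq_left := hM.eventually_eq hL hL' hω hω'
  dec₁ := (rayWeyl_decays hL hω).2.1 0 ⟨le_rfl, hL.b_pos⟩
  dec₂ := by
    rw [hM.a₁_eq hL hL']
    exact ((rayWeyl_decays hL' hω').2.1 0 ⟨le_rfl, hL'.b_pos⟩).mono hb

theorem nu_I_mul_sq (ω a : ℂ) : nu (Complex.I * ω * a) ^ 2 = -nu (ω * a) ^ 2 := by
  rw [nu_sq, nu_sq]
  linear_combination (-(ω * a) ^ 2) * Complex.I_sq

theorem SameWeyl.left_eq (hM : SameWeyl T L L') (hL : L.Admissible T) (hL' : L'.Admissible T)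
    (hb : L.b ≤ L'.b) : L.h = L'.h ∧ L.q =ᵐ[volume.restrict (Ioo 0 L.b)] L'.q := by
  obtain ⟨ω, ⟨h1, h2⟩, h3, h4⟩ := exists_generic hL hL'
  exact (hM.rayPair_left hL hL' hb h1 h2).eq_of_opposite hL.b_pos hL.left
    (hL'.intervalIntegrable le_rfl hL.b_pos.le (hL.b_lt.le))
    (hM.rayPair_left hL hL' hb h3 h4) (nu_I_mul_sq _ _)

theorem SameWeyl.eventually_eq_left (hM : SameWeyl T L L') (hL : L.Admissible T)
    (hL' : L'.Admissible T) (hb : L.b ≤ L'.b) {ω : ℂ} (hω : L.Generic ω) (hω' : L'.Generic ω) :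
    ∀ᶠ t in atTop, ∀ x ∈ Icc 0 L.b, (L.rayWeyl T ω t).y x = (L'.rayWeyl T ω t).y x ∧
      (L.rayWeyl T ω t).dy x = (L'.rayWeyl T ω t).dy x :=
  (hM.rayPair_left hL hL' hb hω hω').eventually_eq hL.b_pos.le
    (hL'.intervalIntegrable le_rfl hL.b_pos.le hL.b_lt.le) (hM.left_eq hL hL' hb).1
    (hM.left_eq hL hL' hb).2

/-- If `b < b'`, the two Weyl solutions agree on `[0, b]`. At `b` the logarithmic derivative over
`t` would tend to `-d₁² ν(ω a₂)` for the first problem, and to `-ν(ω a₁)` for the second, where `b`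
is interior to the left piece. -/
theorem SameWeyl.b_le (hM : SameWeyl T L L') (hL : L.Admissible T) (hL' : L'.Admissible T) :
    L'.b ≤ L.b := by
  by_contra! hb
  obtain ⟨ω, ⟨hω, hω'⟩, -⟩ := exists_generic hL hL'
  have h1 := (rayWeyl_decays hL hω).2.2.2
  have h2 := ((rayWeyl_decays hL' hω').2.1 L.b ⟨hL.b_pos.le, hb⟩).ratio
  have h3 := tendsto_nhds_unique h1 (h2.congr' ((hM.eventually_eq_left hL hL' hb.le hω hω').mono
    fun t ht => by
      obtain ⟨e1, e2⟩ := ht L.b (right_mem_Icc.2 hL.b_pos.le)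
      simp only [e1, e2]))
  rw [← hM.a₁_eq hL hL'] at h3
  exact (hL.sq_mul_nu_ne hω).1 (neg_injective h3)

theorem SameWeyl.b_eq (hM : SameWeyl T L L') (hL : L.Admissible T) (hL' : L'.Admissible T) :
    L.b = L'.b :=
  le_antisymm (hM.symm.b_le hL' hL) (hM.b_le hL hL')

theorem SameWeyl.sq_mul_nu_eq (hM : SameWeyl T L L') (hL : L.Admissible T)
    (hL' : L'.Admissible T) {ω : ℂ} (hω : L.Generic ω) (hω' : L'.Generic ω) :
    L.d₁ ^ 2 * nu (ω * L.a₂) = L'.d₁ ^ 2 * nu (ω * L'.a₂) := by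
  have hb := hM.b_eq hL hL'
  have h1 := (rayWeyl_decays hL hω).2.2.2
  have h2 := (rayWeyl_decays hL' hω').2.2.2
  exact neg_injective (tendsto_nhds_unique h1 (h2.congr'
    ((hM.eventually_eq_left hL hL' hb.le hω hω').mono fun t ht => by
      obtain ⟨e1, e2⟩ := ht L.b (right_mem_Icc.2 hL.b_pos.le)
      simp only [← hb, e1, e2])))

end BVP

/-! ### The ratio of the two values of `a₂` -/

theorem eventually_nu_eq {z : ℂ} (hz : z.im ≠ 0) :
    ∃ σ : ℂ, ∀ᶠ θ : ℝ in 𝓝 0, nu (z * (1 + θ * Complex.I)) = σ * (z * (1 + θ * Complex.I)) := by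
  have hcont : Tendsto (fun θ : ℝ => (z * (1 + θ * Complex.I)).im) (𝓝 0) (𝓝 z.im) := by
    have h : Continuous fun θ : ℝ => (z * (1 + θ * Complex.I)).im := by fun_prop
    simpa using h.tendsto 0
  rcases lt_or_gt_of_ne hz with h | h
  · exact ⟨Complex.I, (hcont.eventually_lt_const h).mono fun θ hθ => nu_of_neg hθ⟩
  · exact ⟨-Complex.I, (hcont.eventually_const_lt h).mono fun θ hθ => nu_of_pos hθ⟩

namespace BVP

variable {T : ℝ} {L L' : BVP} {lam : ℂ}

theorem Admissible.arg_a₂_lt_pi (hL : L.Admissible T) : L.a₂.arg < Real.pi :=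
  hL.arg_a₂_lt.trans hL.arg_a₁_lt

/-- Take `ω = conj a₂ (1 + i θ)`, so that `ω a₂` crosses the real axis at `θ = 0` and `ν(ω a₂)`
switches between `i ω a₂` and `-i ω a₂`. If `conj a₂ * a₂'` were not real, `ν(ω a₂')` would keep the
same branch for small `θ` of both signs, contradicting the equality of `d₁² ν(ω a₂)` with its
counterpart. -/
theorem SameWeyl.im_conj_mul_eq_zero (hM : SameWeyl T L L') (hL : L.Admissible T)
    (hL' : L'.Admissible T) : ((starRingEnd ℂ) L.a₂ * L'.a₂).im = 0 := by
  by_contra hz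
  obtain ⟨σ, hσ⟩ := eventually_nu_eq hz
  have hc : (starRingEnd ℂ) L.a₂ ≠ 0 := (map_ne_zero _).2 hL.a₂_ne
  have hgen := (hL.eventually_generic hc).and ((hL'.eventually_generic hc).and
    (hσ.filter_mono nhdsWithin_le_nhds))
  have hN : 0 < Complex.normSq L.a₂ := Complex.normSq_pos.2 hL.a₂_ne
  have him : ∀ θ : ℝ, ((starRingEnd ℂ) L.a₂ * (1 + θ * Complex.I) * L.a₂).im
      = Complex.normSq L.a₂ * θ := fun θ => by
    rw [show (starRingEnd ℂ) L.a₂ * (1 + θ * Complex.I) * L.a₂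
      = L.a₂ * (starRingEnd ℂ) L.a₂ * (1 + θ * Complex.I) by ring, Complex.mul_conj]
    simp
  have key : ∀ θ : ℝ, L.Generic ((starRingEnd ℂ) L.a₂ * (1 + θ * Complex.I)) →
      L'.Generic ((starRingEnd ℂ) L.a₂ * (1 + θ * Complex.I)) →
      nu ((starRingEnd ℂ) L.a₂ * L'.a₂ * (1 + θ * Complex.I))
        = σ * ((starRingEnd ℂ) L.a₂ * L'.a₂ * (1 + θ * Complex.I)) → ∀ ρ : ℂ,
      nu ((starRingEnd ℂ) L.a₂ * (1 + θ * Complex.I) * L.a₂)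
        = ρ * ((starRingEnd ℂ) L.a₂ * (1 + θ * Complex.I) * L.a₂) →
      ρ * (L.d₁ ^ 2 * L.a₂) = σ * (L'.d₁ ^ 2 * L'.a₂) := by
    intro θ h1 h2 h3 ρ h4
    have h5 := hM.sq_mul_nu_eq hL hL' h1 h2
    have hω : (starRingEnd ℂ) L.a₂ * (1 + θ * Complex.I) ≠ 0 := fun h => by
      have := h1.1
      simp [h] at this
    rw [h4, mul_right_comm _ _ L'.a₂, h3] at h5
    refine mul_left_cancel₀ hω ?_
    linear_combination h5
  obtain ⟨θ, ⟨h1, h2, h3⟩, hθ⟩ := ((hgen.filter_mono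
    (nhdsGT_le_nhdsNE 0)).and self_mem_nhdsWithin).exists
  obtain ⟨η, ⟨k1, k2, k3⟩, hη⟩ := ((hgen.filter_mono
    (nhdsLT_le_nhdsNE 0)).and self_mem_nhdsWithin).exists
  have e1 := key θ h1 h2 h3 _ (nu_of_pos (by rw [him]; exact mul_pos hN hθ))
  have e2 := key η k1 k2 k3 _ (nu_of_neg (by rw [him]; exact mul_neg_of_pos_of_neg hN hη))
  have e3 : Complex.I * (L.d₁ ^ 2 * L.a₂) = 0 := by linear_combination (e2 - e1) / 2
  exact mul_ne_zero Complex.I_ne_zero (mul_ne_zero (pow_ne_zero 2 hL.d₁_ne) hL.a₂_ne) e3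

/-- A real value of `conj a₂ * a₂'` makes `a₂' / a₂` real, and the arguments make it positive. Since
`nu` is positively homogeneous, the relation for `d₁ ^ 2` follows. -/
theorem SameWeyl.exists_ratio (hM : SameWeyl T L L') (hL : L.Admissible T)
    (hL' : L'.Admissible T) :
    ∃ τ : ℝ, 0 < τ ∧ L'.a₂ = τ * L.a₂ ∧ L.d₁ ^ 2 = τ * L'.d₁ ^ 2 := by
  have hN : Complex.normSq L.a₂ ≠ 0 := (Complex.normSq_pos.2 hL.a₂_ne).ne'
  have hz : ((((starRingEnd ℂ) L.a₂ * L'.a₂).re : ℝ) : ℂ) = (starRingEnd ℂ) L.a₂ * L'.a₂ :=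
    Complex.ext rfl (by rw [hM.im_conj_mul_eq_zero hL hL', Complex.ofReal_im])
  have hτ : L'.a₂ = ((((starRingEnd ℂ) L.a₂ * L'.a₂).re / Complex.normSq L.a₂ : ℝ) : ℂ) * L.a₂ := by
    have hN' : (Complex.normSq L.a₂ : ℂ) ≠ 0 := by exact_mod_cast hN
    rw [Complex.ofReal_div, hz, div_mul_eq_mul_div, eq_div_iff hN', ← Complex.mul_conj]
    ring
  have hpos := pos_of_arg hL.a₂_ne hL.arg_a₂_nonneg hL.arg_a₂_lt_pi hL'.a₂_ne hL'.arg_a₂_nonneg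
    hL'.arg_a₂_lt_pi hτ
  refine ⟨_, hpos, hτ, ?_⟩
  obtain ⟨ω, ⟨hω, hω'⟩, -⟩ := exists_generic hL hL'
  have h := hM.sq_mul_nu_eq hL hL' hω hω'
  rw [hτ, mul_left_comm, nu_real_mul hpos, ← mul_assoc] at h
  rw [mul_right_cancel₀ (nu_ne_zero hω.2) h, mul_comm]

end BVP

/-! ### The right piece: stretching and removal of the scale factor -/

theorem Sol.mul {q : ℝ → ℂ} {w : ℂ} {α β : ℝ} {y dy : ℝ → ℂ} (h : Sol q w α β y dy) (c : ℂ) :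
    Sol q w α β (fun x => c * y x) fun x => c * dy x := by
  simpa using h.lin h c 0

namespace BVP

variable {T : ℝ} {L L' : BVP} {lam : ℂ}

theorem rayWeyl_dy_ne_zero (hL : L.Admissible T) {ω : ℂ} (hω : L.Generic ω) :
    ∀ᶠ t in atTop, (L.rayWeyl T ω t).dy L.b ≠ 0 := by
  have h := (rayWeyl_decays hL hω).2.2.2
  filter_upwards [h.eventually_ne (neg_ne_zero.2 (mul_ne_zero (pow_ne_zero 2 hL.d₁_ne)
    (nu_ne_zero hω.2)))] with t ht h0
  rw [h0, zero_div] at ht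
  exact ht rfl

theorem add_div_sub_mem {b c : ℝ} (hc : 1 ≤ c) (hbT : b ≤ T) : b + (T - b) / c ≤ T := by
  have := div_le_self (sub_nonneg.2 hbT) hc
  linarith

/-- The map `x ↦ b + c (x - b)` carries `[b, b + (T - b) / c]` onto `[b, T]` and turns `a₂'` into `c
a₂' = a₂`; `c ≥ 1` keeps the shorter interval inside the domain of the first problem. Dividing by
the common value of `Φ'(b - 0)` gives the normalization with `d₂ / d₁` as boundary coefficient, and
equality at `b` is exactly `d₁' ^ 2 = c d₁ ^ 2`. -/
theorem SameWeyl.rayPair_right (hM : SameWeyl T L L') (hL : L.Admissible T)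
    (hL' : L'.Admissible T) {c : ℝ} (hc : 1 ≤ c) (ha : L.a₂ = c * L'.a₂)
    (hd : L'.d₁ ^ 2 = c * L.d₁ ^ 2) {ω : ℂ} (hω : L.Generic ω) (hω' : L'.Generic ω) :
    RayPair L.q (fun x => (c : ℂ) ^ 2 * L'.q (L.b + c * (x - L.b))) L.b (L.b + (T - L.b) / c)
      (L.d₂ / L.d₁) (c * L'.d₂ / L'.d₁) (nu (ω * L.a₂))
      (fun t x => L.d₁ / (L.rayWeyl T ω t).dy L.b * (L.rayWeyl T ω t).Y x)
      (fun t x => L.d₁ / (L.rayWeyl T ω t).dy L.b * (L.rayWeyl T ω t).dY x)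
      (fun t x => L'.d₁ / (c * (L.rayWeyl T ω t).dy L.b)
        * (L'.rayWeyl T ω t).Y (L.b + c * (x - L.b)))
      fun t x => L'.d₁ / (c * (L.rayWeyl T ω t).dy L.b)
        * (c * (L'.rayWeyl T ω t).dY (L.b + c * (x - L.b))) := by
  have hb := hM.b_eq hL hL'
  have hc0 : 0 < c := one_pos.trans_le hc
  have hcc : (c : ℂ) ≠ 0 := by exact_mod_cast hc0.ne'
  have hd0 := hL.d₁_ne
  have hd0' := hL'.d₁_ne
  have hbT := hL.b_lt
  have hT1 : L.b + (T - L.b) / c ≤ T := add_div_sub_mem hc hbT.le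
  have hbT1 : L.b < L.b + (T - L.b) / c := by
    have := div_pos (sub_pos.2 hbT) hc0
    linarith
  have hβ : c * (L.b + (T - L.b) / c - L.b) = T - L.b := by field_simp; ring
  have hβ' : L.b + c * (L.b + (T - L.b) / c - L.b) = T := by rw [hβ]; ring
  have hdy := rayWeyl_dy_ne_zero hL hω
  have hq' : IntervalIntegrable L'.q volume L.b T := by rw [hb]; exact hL'.right
  have hνc : nu (ω * L.a₂) = c * nu (ω * L'.a₂) := by
    rw [ha, mul_left_comm, nu_real_mul hc0]
  have hleft := hM.eventually_eq_left hL hL' hb.le hω hω'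
  have hs₂ : ∀ᶠ t : ℝ in atTop, Sol (fun x => (c : ℂ) ^ 2 * L'.q (L.b + c * (x - L.b)))
      (-(t * nu (ω * L.a₂)) ^ 2) L.b (L.b + (T - L.b) / c)
      (fun x => L'.d₁ / (c * (L.rayWeyl T ω t).dy L.b)
        * (L'.rayWeyl T ω t).Y (L.b + c * (x - L.b)))
      fun x => L'.d₁ / (c * (L.rayWeyl T ω t).dy L.b)
        * (c * (L'.rayWeyl T ω t).dY (L.b + c * (x - L.b))) := by
    filter_upwards [rayWeyl_right hL' hω'] with t ht
    rw [← hb] at ht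
    have := (ht.comp_affine hc0 hbT.le hβ hq').mul (L'.d₁ / (c * (L.rayWeyl T ω t).dy L.b))
    rwa [show (c : ℂ) ^ 2 * -(t * nu (ω * L'.a₂)) ^ 2 = -(t * nu (ω * L.a₂)) ^ 2 by
      rw [hνc]; ring] at this
  refine ⟨nu_re_pos hω.2, ?_, hs₂, ?_, ?_, ?_, ?_, ?_⟩
  · filter_upwards [rayWeyl_right hL hω] with t ht
    exact (ht.mono le_rfl hbT1.le hT1).mul _
  · filter_upwards [weylSol_ray hL hω, hdy] with t ht h0
    obtain ⟨-, -, e1, e2⟩ := isSolution_iff.1 ht.1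
    change L.d₁ / (L.rayWeyl T ω t).dy L.b * (L.weylSol T ((t * ω) ^ 2)).dY L.b - L.d₂ / L.d₁ *
      (L.d₁ / (L.rayWeyl T ω t).dy L.b * (L.weylSol T ((t * ω) ^ 2)).Y L.b) = 1
    rw [e1, e2, ← rayWeyl]
    field_simp
    ring
  · filter_upwards [weylSol_ray hL' hω', hdy, hleft] with t ht h0 hl
    obtain ⟨-, -, e1, e2⟩ := isSolution_iff.1 ht.1
    obtain ⟨e3, e4⟩ := hl L.b (right_mem_Icc.2 hL.b_pos.le)
    rw [← rayWeyl, ← hb, ← e3] at e1 e2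
    rw [← e4] at e2
    rw [sub_self, mul_zero, add_zero, e1, e2]
    field_simp
    ring
  · filter_upwards [weylSol_ray hL' hω', weylSol_ray hL hω, hdy, hleft] with t ht ht' h0 hl
    obtain ⟨-, -, e1, -⟩ := isSolution_iff.1 ht.1
    obtain ⟨-, -, e2, -⟩ := isSolution_iff.1 ht'.1
    obtain ⟨e3, e4⟩ := hl L.b (right_mem_Icc.2 hL.b_pos.le)
    rw [← rayWeyl, ← hb, ← e3] at e1
    rw [← rayWeyl] at e2
    rw [sub_self, mul_zero, add_zero, e1, e2]
    field_simp
    linear_combination (-(L.rayWeyl T ω t).y L.b) * hd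
  · refine (((rayWeyl_decays hL hω).1 L.b ⟨le_rfl, hbT⟩).mono hT1).mul ?_
    filter_upwards [hdy] with t h0 using div_ne_zero hd0 h0
  · refine decays_of_ratio hbT1 ((hq'.comp_affine hc0.ne' hβ).const_mul _) (nu_re_pos hω.2) hs₂
      ?_ (κ := 0) ?_ (nu_ne_zero hω.2).symm
    · filter_upwards [weylSol_ray hL' hω', hdy] with t ht h0
      rw [hβ']
      exact mul_ne_zero (div_ne_zero hd0' (mul_ne_zero hcc h0)) ht.2.2.2
    · refine (tendsto_const_div_ofReal (-(c * L'.H))).congr' ?_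
      filter_upwards [weylSol_ray hL' hω', hdy, eventually_gt_atTop 0] with t ht h0 ht0
      have ht' : (t : ℂ) ≠ 0 := by exact_mod_cast ht0.ne'
      have h1 : (L'.rayWeyl T ω t).dY T = -L'.H * (L'.rayWeyl T ω t).Y T := by
        have := ht.2.2.1
        rw [V] at this
        rw [rayWeyl]
        linear_combination this
      have h2 : (L'.rayWeyl T ω t).Y T ≠ 0 := ht.2.2.2
      rw [hβ', h1]
      field_simp

theorem SameWeyl.right_eq (hM : SameWeyl T L L') (hL : L.Admissible T)
    (hL' : L'.Admissible T) {c : ℝ} (hc : 1 ≤ c) (ha : L.a₂ = c * L'.a₂)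
    (hd : L'.d₁ ^ 2 = c * L.d₁ ^ 2) :
    L.q =ᵐ[volume.restrict (Ioo L.b T)] L'.q ∧ L.a₂ = L'.a₂ ∧ L.H = L'.H ∧ L.d₁ = L'.d₁ ∧
      L.d₂ = L'.d₂ := by
  obtain ⟨ω, ⟨hω, hω'⟩, hI, hI'⟩ := exists_generic hL hL'
  have hb := hM.b_eq hL hL'
  have hc0 : 0 < c := one_pos.trans_le hc
  have hcc : (c : ℂ) ≠ 0 := by exact_mod_cast hc0.ne'
  have hbT := hL.b_lt
  have hT1 : L.b + (T - L.b) / c ≤ T := add_div_sub_mem hc hbT.le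
  have hbT1 : L.b < L.b + (T - L.b) / c := by
    have := div_pos (sub_pos.2 hbT) hc0
    linarith
  have hβ : c * (L.b + (T - L.b) / c - L.b) = T - L.b := by field_simp; ring
  have hβ' : L.b + c * (L.b + (T - L.b) / c - L.b) = T := by rw [hβ]; ring
  have hq' : IntervalIntegrable (fun x => (c : ℂ) ^ 2 * L'.q (L.b + c * (x - L.b))) volume L.b
      (L.b + (T - L.b) / c) := by
    refine (IntervalIntegrable.comp_affine (β := T) hc0.ne' hβ ?_).const_mul _
    rw [hb]; exact hL'.right
  have hP := hM.rayPair_right hL hL' hc ha hd hω hω'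
  obtain ⟨hd₂, hq⟩ := hP.eq_of_opposite hbT1
    (hL.intervalIntegrable hL.b_pos.le hbT1.le hT1) hq'
    (hM.rayPair_right hL hL' hc ha hd hI hI') (nu_I_mul_sq _ _)
  -- The coincidence of the two families transports the condition at `T` of the second problem to
  -- the point `b + (T - b) / c` of the first, with coefficient `c H'`.
  have hdY : ∀ᶠ t in atTop, (L.rayWeyl T ω t).dY (L.b + (T - L.b) / c)
      = -(c * L'.H) * (L.rayWeyl T ω t).Y (L.b + (T - L.b) / c) := by
    filter_upwards [hP.eventually_eq hbT1.le hq' hd₂ hq, weylSol_ray hL' hω',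
      rayWeyl_dy_ne_zero hL hω] with t h1 h2 h0
    obtain ⟨e1, e2⟩ := h1 _ (right_mem_Icc.2 hbT1.le)
    have h3 : (L'.rayWeyl T ω t).dY T = -L'.H * (L'.rayWeyl T ω t).Y T := by
      have := h2.2.2.1
      rw [V] at this
      rw [rayWeyl]
      linear_combination this
    rw [hβ'] at e1 e2
    rw [h3] at e2
    refine mul_left_cancel₀ (div_ne_zero hL.d₁_ne h0) ?_
    linear_combination e2 + c * L'.H * e1
  -- For `c > 1` that point is interior: the logarithmic derivative there is of exact order `t` by
  -- decay, yet it would be the constant `-c H'`.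
  have hc1 : c = 1 := by
    by_contra hne
    have hlt : L.b + (T - L.b) / c < T := by
      have := div_lt_self (sub_pos.2 hbT) (lt_of_le_of_ne hc (Ne.symm hne))
      linarith
    have hD := (rayWeyl_decays hL hω).1 _ ⟨hbT1.le, hlt⟩
    refine neg_ne_zero.2 (nu_ne_zero hω.2) (tendsto_nhds_unique hD.ratio
      ((tendsto_const_div_ofReal (-(c * L'.H))).congr' ?_))
    filter_upwards [hdY, hD.ne, eventually_gt_atTop 0] with t h1 h2 ht0
    have ht' : (t : ℂ) ≠ 0 := by exact_mod_cast ht0.ne'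
    rw [h1, mul_div_mul_right _ _ h2]
  subst hc1
  have hd₁ : L.d₁ = L'.d₁ := by
    refine eq_of_sq_eq_of_arg hL.d₁_ne hL.arg_d₁_nonneg hL.arg_d₁_lt hL'.d₁_ne
      hL'.arg_d₁_nonneg hL'.arg_d₁_lt ?_
    rw [hd]; simp
  refine ⟨?_, by simpa using ha, ?_, hd₁, ?_⟩
  · simpa using hq
  · obtain ⟨t, h1, h2⟩ := (hdY.and (weylSol_ray hL hω)).exists
    rw [div_one, add_sub_cancel, Complex.ofReal_one, one_mul] at h1
    have h3 := h2.2.2.1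
    rw [V, ← rayWeyl, h1] at h3
    have h4 : (L.H - L'.H) * (L.rayWeyl T ω t).Y T = 0 := by linear_combination h3
    exact sub_eq_zero.1 ((mul_eq_zero.1 h4).resolve_right h2.2.2.2)
  · have := hL'.d₁_ne
    rw [hd₁, Complex.ofReal_one, one_mul] at hd₂
    field_simp at hd₂
    exact hd₂

/-- The Weyl function determines the boundary value problem. -/
theorem SameWeyl.eq (hM : SameWeyl T L L') (hL : L.Admissible T) (hL' : L'.Admissible T) :
    L.q =ᵐ[volume.restrict (Ioo 0 T)] L'.q ∧ L.b = L'.b ∧ L.a₁ = L'.a₁ ∧ L.a₂ = L'.a₂ ∧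
      L.h = L'.h ∧ L.H = L'.H ∧ L.d₁ = L'.d₁ ∧ L.d₂ = L'.d₂ := by
  have hb := hM.b_eq hL hL'
  obtain ⟨hh, hq₁⟩ := hM.left_eq hL hL' hb.le
  obtain ⟨τ, hτ, ha, hd⟩ := hM.exists_ratio hL hL'
  have hright : L.q =ᵐ[volume.restrict (Ioo L.b T)] L'.q ∧ L.a₂ = L'.a₂ ∧ L.H = L'.H ∧
      L.d₁ = L'.d₁ ∧ L.d₂ = L'.d₂ := by
    -- The stretching factor has to be at least `1`; for `τ ≥ 1` the two problems exchange roles.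
    rcases le_total 1 τ with h | h
    · obtain ⟨e1, e2, e3, e4, e5⟩ := hM.symm.right_eq hL' hL h ha hd
      rw [hb]
      exact ⟨e1.symm, e2.symm, e3.symm, e4.symm, e5.symm⟩
    · have hτ' : (τ : ℂ) ≠ 0 := by exact_mod_cast hτ.ne'
      refine hM.right_eq hL hL' (c := τ⁻¹) ((one_le_inv₀ hτ).2 h) ?_ ?_
      · rw [ha]; push_cast; field_simp
      · rw [hd]; push_cast; field_simp
  obtain ⟨hq₂, e2, e3, e4, e5⟩ := hright
  refine ⟨?_, hb, hM.a₁_eq hL hL', e2, hh, e3, e4, e5⟩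
  have h1 := ae_restrict_union_iff (μ := volume) (Ioo 0 L.b) (Ioo L.b T)
    (fun x => L.q x = L'.q x) |>.2 ⟨hq₁, hq₂⟩
  have hset : (Ioo 0 L.b ∪ Ioo L.b T : Set ℝ) =ᵐ[volume] Ioo 0 T := by
    have : Ioo 0 T = (Ioo 0 L.b ∪ Ioo L.b T) ∪ {L.b} := by
      ext x
      simp only [mem_union, mem_Ioo, mem_singleton_iff]
      have := hL.b_pos
      have := hL.b_lt
      constructor
      · rintro ⟨h1, h2⟩
        rcases lt_trichotomy x L.b with h | h | h <;> tauto
      · rintro ((⟨h1, h2⟩ | ⟨h1, h2⟩) | h)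
        · exact ⟨h1, by linarith⟩
        · exact ⟨by linarith, h2⟩
        · subst h; exact ⟨hL.b_pos, hL.b_lt⟩
    rw [this]
    exact (union_ae_eq_left_of_ae_eq_empty (ae_eq_empty.2
      (measure_singleton L.b))).symm
  rw [Filter.EventuallyEq, ← Measure.restrict_congr_set hset]
  exact h1

end BVP

/-! ### Enumeration of eigenvalues and principal parts -/

/-- Blocks of prescribed lengths, one for each point of an infinite countable set, can be arranged
in a sequence, together with prescribed data in each block. -/
theorem exists_block_enumeration {Z : Set ℂ} (hZ : Z.Infinite) (hc : Z.Countable) {m : ℂ → ℕ}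
    (hm : ∀ z, 0 < m z ↔ z ∈ Z) (c : ℂ → ℕ → ℂ) :
    ∃ ev M : ℕ → ℂ, (∀ μ, {k | ev k = μ}.encard = m μ) ∧
      (∀ i j k, i ≤ j → j ≤ k → ev i = ev k → ev j = ev i) ∧
      ∀ k, (k = 0 ∨ ev (k - 1) ≠ ev k) →
        ev k ∈ Z ∧ ∀ ν < m (ev k), M (k + ν) = c (ev k) ν := by
  have := hZ.to_subtype
  have := hc.to_subtype
  obtain ⟨_⟩ := nonempty_denumerable Z
  let e : ℕ ≃ Z := (Denumerable.eqv Z).symm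
  -- `s n` is the starting index of the `n`-th block; below, `n k` is the number of the block
  -- containing `k`.
  let s : ℕ → ℕ := fun n => ∑ i ∈ Finset.range n, m (e i)
  have hs : ∀ n, s (n + 1) = s n + m (e n) := fun n => Finset.sum_range_succ _ n
  have hpos : ∀ n, 0 < m (e n) := fun n => (hm _).2 (e n).2
  have hmono : StrictMono s := strictMono_nat_of_lt_succ fun n => by
    rw [hs]; exact Nat.lt_add_of_pos_right (hpos n)
  have hex : ∀ k, ∃ n, s n ≤ k ∧ k < s (n + 1) := by
    intro k
    have h : ∃ n, k < s (n + 1) := ⟨k, (Nat.lt_succ_self k).trans_le (hmono.id_le (k + 1))⟩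
    classical
    refine ⟨Nat.find h, ?_, Nat.find_spec h⟩
    rcases Nat.eq_zero_or_pos (Nat.find h) with h0 | h0
    · rw [h0]; simp [s]
    · have := Nat.find_min h (Nat.sub_lt h0 one_pos)
      rwa [not_lt, Nat.sub_add_cancel (Nat.one_le_iff_ne_zero.2 h0.ne')] at this
  choose n hn₁ hn₂ using hex
  have huniq : ∀ {k i}, s i ≤ k → k < s (i + 1) → n k = i := by
    intro k i h1 h2
    refine le_antisymm ?_ ?_
    · by_contra! h
      exact absurd ((hmono.monotone h).trans (hn₁ k)) (not_le.2 h2)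
    · by_contra! h
      exact absurd ((hmono.monotone h).trans h1) (not_le.2 (hn₂ k))
  have hnmono : Monotone n := by
    intro i j hij
    by_contra! h
    exact absurd ((hmono.monotone h).trans (hn₁ i)) (not_le.2 (hij.trans_lt (hn₂ j)))
  have hinj : ∀ {i j}, (e (n i) : ℂ) = e (n j) ↔ n i = n j := by
    intro i j
    rw [Subtype.coe_inj, e.injective.eq_iff]
  refine ⟨fun k => e (n k), fun k => c (e (n k)) (k - s (n k)), fun μ => ?_, ?_, ?_⟩
  · by_cases hμ : μ ∈ Z
    · obtain ⟨i, hi⟩ := e.surjective ⟨μ, hμ⟩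
      have hset : {k | (e (n k) : ℂ) = μ} = (Finset.Ico (s i) (s (i + 1)) : Finset ℕ) := by
        ext k
        rw [mem_ofPred_eq, show μ = (e i : ℂ) by rw [hi], Subtype.coe_inj, e.injective.eq_iff,
          Finset.coe_Ico, mem_Ico]
        exact ⟨fun h => h ▸ ⟨hn₁ k, hn₂ k⟩, fun h => huniq h.1 h.2⟩
      rw [hset, encard_coe_eq_coe_finsetCard, Nat.card_Ico, hs, Nat.add_sub_cancel_left, hi]
    · have h0 : m μ = 0 := by
        by_contra h
        exact hμ ((hm μ).1 (Nat.pos_of_ne_zero h))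
      rw [h0, Nat.cast_zero, encard_eq_zero, eq_empty_iff_forall_notMem]
      rintro k rfl
      exact hμ (e (n k)).2
  · intro i j k hij hjk h
    exact hinj.2 (le_antisymm ((hnmono hjk).trans (hinj.1 h).symm.le) (hnmono hij))
  · intro k hk
    refine ⟨(e (n k)).2, fun ν hν => ?_⟩
    have hstart : s (n k) = k := by
      refine le_antisymm (hn₁ k) ?_
      by_contra! h
      rcases hk with rfl | hk
      · exact absurd h (Nat.not_lt_zero _)
      · exact hk (hinj.2 (huniq (Nat.le_sub_one_of_lt h) ((Nat.sub_le k 1).trans_lt (hn₂ k))))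
    have h1 : n (k + ν) = n k := huniq ((hn₁ k).trans (Nat.le_add_right k ν)) (by
      rw [hs, hstart]; exact Nat.add_lt_add_left hν k)
    simp only [h1, hstart, Nat.add_sub_cancel_left]

/-- The principal part of a quotient of analytic functions. -/
theorem exists_principal_part {f g : ℂ → ℂ} {μ : ℂ} (hf : AnalyticAt ℂ f μ)
    (hg : AnalyticAt ℂ g μ) (h : analyticOrderAt g μ ≠ ⊤) :
    ∃ (c : ℕ → ℂ) (R : ℂ → ℂ), AnalyticAt ℂ R μ ∧ ∀ᶠ z in 𝓝[≠] μ,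
      f z / g z = (∑ ν ∈ Finset.range (analyticOrderNatAt g μ), c ν / (z - μ) ^ (ν + 1)) + R z := by
  set m := analyticOrderNatAt g μ
  obtain ⟨G, hG, hG0, hgG⟩ := (hg.analyticOrderAt_ne_top).1 h
  have hF : AnalyticAt ℂ (fun z => f (z + μ) / G (z + μ)) 0 := by
    have h1 : AnalyticAt ℂ (fun z => f z / G z) (0 + μ) := by
      rw [zero_add]; exact hf.div hG hG0
    exact h1.fun_comp (f := fun z => z + μ) (by fun_prop)
  obtain ⟨R, hR, hsum⟩ := hF.exists_eq_sum_add_pow_mul m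
  -- With `g = (z - μ) ^ m * G`, the coefficient of `(z - μ) ^ (-(ν + 1))` is the Taylor coefficient
  -- of `f / G` of degree `m - 1 - ν`.
  refine ⟨fun ν => iteratedDeriv (m - 1 - ν) (fun z => f (z + μ) / G (z + μ)) 0
    / (m - 1 - ν).factorial, fun z => R (z - μ), ?_, ?_⟩
  · have h1 : AnalyticAt ℂ R (μ - μ) := by rwa [sub_self]
    exact h1.fun_comp (f := fun z => z - μ) (by fun_prop)
  · filter_upwards [hgG.filter_mono nhdsWithin_le_nhds, self_mem_nhdsWithin] with z hz hzμ
    have hzμ' : z - μ ≠ 0 := sub_ne_zero.2 hzμ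
    have h1 := hsum (z - μ)
    rw [sub_add_cancel] at h1
    rw [hz, smul_eq_mul, mul_comm, ← div_div, h1, add_div, smul_eq_mul,
      mul_div_cancel_left₀ _ (pow_ne_zero _ hzμ'), Finset.sum_div, ← Finset.sum_range_reflect]
    congr 1
    refine Finset.sum_congr rfl fun ν hν => ?_
    have hν := Finset.mem_range.1 hν
    rw [smul_eq_mul, show (z - μ) ^ m = (z - μ) ^ (m - 1 - ν) * (z - μ) ^ (ν + 1) by
      rw [← pow_add]; congr 1; omega]
    field_simp

/-- A function which is locally a quotient of entire functions is entire. -/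
theorem exists_entire_quotient {N D : ℂ → ℂ} (hD : ∀ μ, ∀ᶠ z in 𝓝[≠] μ, D z ≠ 0)
    (h : ∀ μ, ∃ e : ℂ → ℂ, AnalyticAt ℂ e μ ∧ ∀ᶠ z in 𝓝 μ, N z = e z * D z) :
    ∃ E : ℂ → ℂ, Differentiable ℂ E ∧ ∀ z, N z = E z * D z := by
  choose e he hN using h
  refine ⟨fun μ => e μ μ, fun μ => ?_, fun z => (hN z).self_of_nhds⟩
  refine ((he μ).differentiableAt).congr_of_eventuallyEq ?_
  have h1 := eventually_nhdsWithin_iff.1 (hD μ)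
  filter_upwards [h1, hN μ] with z hz1 hz2
  by_cases hzμ : z = μ
  · rw [hzμ]
  · exact mul_right_cancel₀ (hz1 hzμ) ((hN z).self_of_nhds.symm.trans hz2)

/-- If two quotients have the same principal parts, their difference is entire. -/
theorem exists_entire_sub_of_principal_part {f g f' g' : ℂ → ℂ} (hf : Differentiable ℂ f)
    (hg : Differentiable ℂ g) (hf' : Differentiable ℂ f') (hg' : Differentiable ℂ g')
    (hgz : ∀ μ, ∀ᶠ z in 𝓝[≠] μ, g z ≠ 0) (hgz' : ∀ μ, ∀ᶠ z in 𝓝[≠] μ, g' z ≠ 0)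
    (h : ∀ μ, (g μ ≠ 0 ∧ g' μ ≠ 0) ∨ ∃ (P R R' : ℂ → ℂ), AnalyticAt ℂ R μ ∧ AnalyticAt ℂ R' μ ∧
      (∀ᶠ z in 𝓝[≠] μ, f z / g z = P z + R z) ∧ ∀ᶠ z in 𝓝[≠] μ, f' z / g' z = P z + R' z) :
    ∃ E : ℂ → ℂ, Differentiable ℂ E ∧ ∀ z, f z * g' z - f' z * g z = E z * (g z * g' z) := by
  refine exists_entire_quotient (fun μ => ?_) fun μ => ?_
  · filter_upwards [hgz μ, hgz' μ] with z h1 h2 using mul_ne_zero h1 h2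
  · rcases h μ with ⟨h1, h2⟩ | ⟨P, R, R', hR, hR', hP, hP'⟩
    · refine ⟨fun z => f z / g z - f' z / g' z, ((hf.analyticAt μ).div (hg.analyticAt μ) h1).sub
        ((hf'.analyticAt μ).div (hg'.analyticAt μ) h2), ?_⟩
      filter_upwards [hg.continuous.continuousAt.eventually_ne h1,
        hg'.continuous.continuousAt.eventually_ne h2] with z h3 h4
      field_simp
    · refine ⟨fun z => R z - R' z, hR.sub hR', ?_⟩
      have h1 : AnalyticAt ℂ (fun z => f z * g' z - f' z * g z) μ :=
        ((hf.analyticAt μ).mul (hg'.analyticAt μ)).sub ((hf'.analyticAt μ).mul (hg.analyticAt μ))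
      have h2 : AnalyticAt ℂ (fun z => (R z - R' z) * (g z * g' z)) μ :=
        (hR.sub hR').mul ((hg.analyticAt μ).mul (hg'.analyticAt μ))
      -- The identity is known only on a punctured neighbourhood; both sides are analytic at `μ`, so
      -- it extends to the center.
      refine (h1.frequently_eq_iff_eventually_eq h2).1 (Eventually.frequently ?_)
      filter_upwards [hP, hP', hgz μ, hgz' μ] with z k1 k2 k3 k4
      have : R z - R' z = f z / g z - f' z / g' z := by rw [k1, k2]; ring
      rw [this]
      field_simp

/-! ### Equivalence of the Weyl function and the spectral data -/

namespace BVP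

variable {T : ℝ} {L L' : BVP} {lam : ℂ}

theorem orderHalf_charFun (hL : L.Admissible T) : OrderHalf (L.charFun T) := by
  have : L.charFun T = fun z => -L.vInit T 1 L.h z := funext fun z => charFun_eq hL z
  rw [this]
  exact (orderHalf_vInit hL 1 L.h).neg

theorem weyl_eq_div (hL : L.Admissible T) (h : L.charFun T lam ≠ 0) :
    L.weyl T lam = L.vInit T 0 1 lam / L.charFun T lam := by
  rw [weyl_eq hL ((charFun_ne_zero_iff hL).1 h), charFun_eq hL, neg_div, div_neg]

/-- The Wronskian of `φ` and `Φ` is `1` at `0`, and at `T` the condition `V(Φ) = 0` reduces it to `Δ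
Φ(T)`. Decay of `Φ(T)` is thus growth of `Δ`. -/
theorem charFun_mul_weylSol (hL : L.Admissible T) (h : L.charFun T lam ≠ 0) :
    L.charFun T lam * (L.weylSol T lam).Y T = 1 := by
  obtain ⟨h1, h2, h3⟩ := weylSol_spec hL ((charFun_ne_zero_iff hL).1 h)
  obtain ⟨a1, a2, a3⟩ := pieces_spec hL 1 L.h lam
  have hw := a1.wronskian hL h1
  rw [a2, a3] at hw
  rw [charFun_eq hL, vInit]
  rw [V] at h3 ⊢
  rw [U] at h2
  linear_combination h2 + hw - (L.pieces T 1 L.h lam).Y T * h3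

theorem eventually_charFun_ne_zero (hL : L.Admissible T) {ω : ℂ} (hω : L.Generic ω) :
    ∀ᶠ t : ℝ in atTop, L.charFun T ((t * ω) ^ 2) ≠ 0 :=
  (eventually_vInit_ne_zero hL hω).mono fun _ h => (charFun_ne_zero_iff hL).2 h

theorem rayWeyl_tendsto_zero (hL : L.Admissible T) {ω : ℂ} (hω : L.Generic ω) :
    Tendsto (fun t => (L.rayWeyl T ω t).y 0) atTop (𝓝 0) :=
  ((rayWeyl_decays hL hω).2.1 0 ⟨le_rfl, hL.b_pos⟩).tendsto_zero (nu_ne_zero hω.1) (h := L.h)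
    ((weylSol_ray hL hω).mono fun _ h => h.2.1)

/-- The characteristic function grows faster than any polynomial along generic rays. -/
theorem tendsto_pow_div_charFun (hL : L.Admissible T) {ω : ℂ} (hω : L.Generic ω) (n : ℕ) :
    Tendsto (fun t : ℝ => (t : ℂ) ^ n / L.charFun T ((t * ω) ^ 2)) atTop (𝓝 0) := by
  obtain ⟨C, hC⟩ := ((rayWeyl_decays hL hω).1 L.b ⟨le_rfl, hL.b_lt⟩).bound
  obtain ⟨D, hD⟩ := ((rayWeyl_decays hL hω).2.1 0 ⟨le_rfl, hL.b_pos⟩).bound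
  have hc : 0 < (nu (ω * L.a₂)).re * (T - L.b) := mul_pos (nu_re_pos hω.2) (sub_pos.2 hL.b_lt)
  -- The decay over the right piece alone beats every power of `t`; on the left piece the
  -- exponential is merely bounded by `1`.
  have h1 := tendsto_rpow_mul_exp_neg_mul_atTop_nhds_zero n _ hc
  have h2 := (h1.mul (rayWeyl_tendsto_zero hL hω).norm).const_mul (|C| * ‖L.d₁‖ * |D|)
  rw [norm_zero, mul_zero, mul_zero] at h2
  refine squeeze_zero_norm' ?_ h2
  filter_upwards [hC, hD, eventually_charFun_ne_zero hL hω, weylSol_ray hL hω,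
    eventually_ge_atTop 0] with t hC hD h0 hs ht0
  have e1 := hC T (right_mem_Icc.2 hL.b_lt.le)
  have e2 := hD L.b (right_mem_Icc.2 hL.b_pos.le)
  have e3 : (L.rayWeyl T ω t).Y L.b = L.d₁ * (L.rayWeyl T ω t).y L.b :=
    (isSolution_iff.1 hs.1).2.2.1
  have e4 : (t : ℂ) ^ n / L.charFun T ((t * ω) ^ 2) = t ^ n * (L.rayWeyl T ω t).Y T := by
    rw [div_eq_iff h0, rayWeyl]
    linear_combination (-(t : ℂ) ^ n) * charFun_mul_weylSol hL h0
  have e5 : ‖(L.rayWeyl T ω t).y L.b‖ ≤ |D| * ‖(L.rayWeyl T ω t).y 0‖ := by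
    refine e2.trans ?_
    refine mul_le_mul_of_nonneg_right ?_ (norm_nonneg _)
    refine (mul_le_mul_of_nonneg_right (le_abs_self D) (Real.exp_pos _).le).trans ?_
    refine mul_le_of_le_one_right (abs_nonneg D) (Real.exp_le_one_iff.2 ?_)
    have := mul_nonneg (mul_nonneg ht0 (nu_re_pos hω.1).le) (sub_nonneg.2 hL.b_pos.le)
    linarith
  rw [e4, norm_mul, norm_pow, Complex.norm_real, Real.norm_of_nonneg ht0, Real.rpow_natCast]
  rw [e3, norm_mul] at e1
  have hE : -(t * (nu (ω * L.a₂)).re * (T - L.b)) = -((nu (ω * L.a₂)).re * (T - L.b)) * t := by ring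
  rw [hE] at e1
  set E := Real.exp (-((nu (ω * L.a₂)).re * (T - L.b)) * t)
  have hE0 : 0 < E := Real.exp_pos _
  have e6 : ‖(L.rayWeyl T ω t).Y T‖ ≤ |C| * E * (‖L.d₁‖ * (|D| * ‖(L.rayWeyl T ω t).y 0‖)) := by
    refine e1.trans ?_
    have := le_abs_self C
    gcongr
  calc t ^ n * ‖(L.rayWeyl T ω t).Y T‖
      ≤ t ^ n * (|C| * E * (‖L.d₁‖ * (|D| * ‖(L.rayWeyl T ω t).y 0‖))) :=
        mul_le_mul_of_nonneg_left e6 (pow_nonneg ht0 n)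
    _ = _ := by ring

theorem charFun_ne_zero (hL : L.Admissible T) : L.charFun T ≠ 0 := by
  obtain ⟨ω, ⟨hω, -⟩, -⟩ := exists_generic hL hL
  obtain ⟨t, ht⟩ := (eventually_charFun_ne_zero hL hω).exists
  exact fun h => ht (by rw [h]; rfl)

/-- A sequence indexed by `ℕ` can list the eigenvalues with their finite multiplicities only if
there are infinitely many of them. -/
theorem infinite_eigenvalues (hL : L.Admissible T) : {z | L.charFun T z = 0}.Infinite := by
  obtain ⟨ω, ⟨hω, -⟩, hI, -⟩ := exists_generic hL hL
  have hω0 : ω ≠ 0 := fun h => by have := hω.1; simp [h] at this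
  refine (orderHalf_charFun hL).infinite_zeros (pow_ne_zero 2 hω0) (fun n => ?_) (fun n => ?_)
    (charFun_ne_zero hL)
  · refine (tendsto_pow_div_charFun hL hω n).congr fun t => ?_
    rw [mul_pow, mul_comm]
  · refine (tendsto_pow_div_charFun hL hI n).congr fun t => ?_
    congr 2
    rw [mul_pow, mul_pow, Complex.I_sq]
    ring

theorem analyticAt_charFun (hL : L.Admissible T) (μ : ℂ) : AnalyticAt ℂ (L.charFun T) μ :=
  (orderHalf_charFun hL).differentiable.analyticAt μ

theorem analyticOrderAt_charFun_ne_top (hL : L.Admissible T) (μ : ℂ) :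
    analyticOrderAt (L.charFun T) μ ≠ ⊤ := by
  intro h
  refine charFun_ne_zero hL (AnalyticOnNhd.eq_of_eventuallyEq (z₀ := μ)
    (fun z _ => analyticAt_charFun hL z) (fun z _ => analyticAt_const)
    (analyticOrderAt_eq_top.1 h))

theorem eventually_nhdsNE_charFun_ne_zero (hL : L.Admissible T) (μ : ℂ) :
    ∀ᶠ z in 𝓝[≠] μ, L.charFun T z ≠ 0 :=
  (analyticAt_charFun hL μ).eventually_eq_zero_or_eventually_ne_zero.resolve_left fun h =>
    analyticOrderAt_charFun_ne_top hL μ (analyticOrderAt_eq_top.2 h)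

theorem countable_eigenvalues (hL : L.Admissible T) : {z | L.charFun T z = 0}.Countable := by
  have h := fun n : ℕ => (finite_zeros_inter_closedBall (orderHalf_charFun hL).differentiable
    (charFun_ne_zero hL) n).countable
  refine (countable_iUnion h).mono fun z hz => ?_
  obtain ⟨n, hn⟩ := exists_nat_ge ‖z‖
  exact mem_iUnion.2 ⟨n, by simp_all⟩

theorem eventually_weyl_eq (hL : L.Admissible T) (μ : ℂ) :
    ∀ᶠ z in 𝓝[≠] μ, L.weyl T z = L.vInit T 0 1 z / L.charFun T z :=
  (eventually_nhdsNE_charFun_ne_zero hL μ).mono fun _ h => weyl_eq_div hL h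

theorem analyticOrderNatAt_pos_iff (hL : L.Admissible T) (μ : ℂ) :
    0 < analyticOrderNatAt (L.charFun T) μ ↔ L.charFun T μ = 0 := by
  rw [Nat.pos_iff_ne_zero, ← Nat.cast_ne_zero (R := ℕ∞), Nat.cast_analyticOrderNatAt
    (analyticOrderAt_charFun_ne_top hL μ), (analyticAt_charFun hL μ).analyticOrderAt_ne_zero]

/-- Every admissible problem has spectral data. -/
theorem exists_isSpectralData (hL : L.Admissible T) : ∃ ev M : ℕ → ℂ, L.IsSpectralData T ev M := by
  choose c R hR hc using fun μ => exists_principal_part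
    ((orderHalf_vInit hL 0 1).differentiable.analyticAt μ) (analyticAt_charFun hL μ)
    (analyticOrderAt_charFun_ne_top hL μ)
  obtain ⟨ev, M, h1, h2, h3⟩ := exists_block_enumeration (infinite_eigenvalues hL)
    (countable_eigenvalues hL) (analyticOrderNatAt_pos_iff hL) c
  refine ⟨ev, M, fun μ => ?_, h2, fun k hk => ⟨R (ev k), hR _, ?_⟩⟩
  · rw [h1, Nat.cast_analyticOrderNatAt (analyticOrderAt_charFun_ne_top hL μ)]
  · filter_upwards [hc (ev k), eventually_weyl_eq hL (ev k)] with z hz1 hz2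
    rw [hz2, hz1]
    congr 1
    exact Finset.sum_congr rfl fun ν hν => by rw [(h3 k hk).2 ν (Finset.mem_range.1 hν)]

/-- The poles cancel with their principal parts, so `M - M'` extends to an entire function `E`. It
is a quotient of functions of order `1 / 2` and tends to `0` on two opposite rays because both Weyl
functions do; hence it vanishes. -/
theorem SameSpectralData.sameWeyl (h : SameSpectralData T L L') (hL : L.Admissible T)
    (hL' : L'.Admissible T) : SameWeyl T L L' := by
  obtain ⟨ev, M, hW, hW'⟩ := h
  have hord : ∀ μ, analyticOrderAt (L.charFun T) μ = analyticOrderAt (L'.charFun T) μ := fun μ => by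
    rw [← hW.multiplicity, ← hW'.multiplicity]
  have hordN : ∀ μ, analyticOrderNatAt (L.charFun T) μ = analyticOrderNatAt (L'.charFun T) μ :=
    fun μ => by rw [analyticOrderNatAt, hord, analyticOrderNatAt]
  obtain ⟨E, hE, hEeq⟩ := exists_entire_sub_of_principal_part
    (orderHalf_vInit hL 0 1).differentiable (orderHalf_charFun hL).differentiable
    (orderHalf_vInit hL' 0 1).differentiable (orderHalf_charFun hL').differentiable
    (eventually_nhdsNE_charFun_ne_zero hL) (eventually_nhdsNE_charFun_ne_zero hL') (by
    intro μ
    by_cases hμ : L.charFun T μ = 0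
    · right
      have hne : {k | ev k = μ}.Nonempty := by
        rw [← encard_ne_zero, hW.multiplicity]
        exact (analyticAt_charFun hL μ).analyticOrderAt_ne_zero.2 hμ
      classical
      -- The first index carrying `μ` starts its block, so both principal parts at `μ` are given by
      -- the same coefficients.
      have hk : ev (Nat.find hne) = μ := Nat.find_spec hne
      have hstart : Nat.find hne = 0 ∨ ev (Nat.find hne - 1) ≠ ev (Nat.find hne) := by
        rw [or_iff_not_imp_left]
        intro h0 h1
        exact Nat.find_min hne (Nat.sub_lt (Nat.pos_of_ne_zero h0) one_pos) (h1.trans hk)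
      obtain ⟨R, hR, hsum⟩ := hW.principal_part _ hstart
      obtain ⟨R', hR', hsum'⟩ := hW'.principal_part _ hstart
      rw [hk] at hR hsum hR' hsum'
      rw [← hordN] at hsum'
      refine ⟨fun z => ∑ ν ∈ Finset.range (analyticOrderNatAt (L.charFun T) μ),
        M (Nat.find hne + ν) / (z - μ) ^ (ν + 1), R, R', hR, hR', ?_, ?_⟩
      · filter_upwards [hsum, eventually_weyl_eq hL μ] with z h1 h2
        rw [← h2, h1]
      · filter_upwards [hsum', eventually_weyl_eq hL' μ] with z h1 h2
        rw [← h2, h1]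
    · left
      refine ⟨hμ, fun h' => ?_⟩
      have h1 := (analyticAt_charFun hL' μ).analyticOrderAt_ne_zero.2 h'
      rw [← hord] at h1
      exact hμ ((analyticAt_charFun hL μ).analyticOrderAt_ne_zero.1 h1))
  have hval : ∀ z, L.charFun T z ≠ 0 → L'.charFun T z ≠ 0 → L.weyl T z - L'.weyl T z = E z := by
    intro z h1 h2
    rw [weyl_eq_div hL h1, weyl_eq_div hL' h2, div_sub_div _ _ h1 h2,
      div_eq_iff (mul_ne_zero h1 h2), ← hEeq]
    ring
  have hO : OrderHalf E := OrderHalf.of_mul_eq hE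
    (((orderHalf_vInit hL 0 1).mul (orderHalf_charFun hL')).sub
      ((orderHalf_vInit hL' 0 1).mul (orderHalf_charFun hL)))
    ((orderHalf_charFun hL).mul (orderHalf_charFun hL')) hEeq (by
      obtain ⟨z, h1, h2⟩ := ((eventually_nhdsNE_charFun_ne_zero hL 0).and
        (eventually_nhdsNE_charFun_ne_zero hL' 0)).exists
      exact fun h => mul_ne_zero h1 h2 (congrFun h z))
  have hray : ∀ ω, L.Generic ω → L'.Generic ω →
      Tendsto (fun t : ℝ => E ((t * ω) ^ 2)) atTop (𝓝 0) := by
    intro ω h1 h2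
    have h3 := (rayWeyl_tendsto_zero hL h1).sub (rayWeyl_tendsto_zero hL' h2)
    rw [sub_zero] at h3
    refine h3.congr' ?_
    filter_upwards [eventually_charFun_ne_zero hL h1, eventually_charFun_ne_zero hL' h2]
      with t k1 k2 using hval _ k1 k2
  obtain ⟨ω, ⟨h1, h2⟩, h3, h4⟩ := exists_generic hL hL'
  have hω0 : ω ≠ 0 := fun h => by have := h1.1; simp [h] at this
  have hE0 := hO.eq_zero_of_tendsto (pow_ne_zero 2 hω0)
    ((hray ω h1 h2).congr fun t => by rw [mul_pow, mul_comm])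
    ((hray _ h3 h4).congr fun t => by
      congr 1
      rw [mul_pow, mul_pow, Complex.I_sq]
      ring)
  intro z k1 k2
  rw [← sub_eq_zero, hval z k1 k2, hE0]

theorem isSolution_congr (hL : L.Admissible T) {q : ℝ → ℂ}
    (hq : L.q =ᵐ[volume.restrict (Ioo 0 T)] q) {u : Pieces} :
    L.IsSolution T lam u ↔ { L with q := q }.IsSolution T lam u := by
  have h1 : L.q =ᵐ[volume.restrict (Ioo 0 L.b)] q :=
    ae_mono (Measure.restrict_mono (Ioo_subset_Ioo le_rfl hL.b_lt.le) le_rfl) hq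
  have h2 : L.q =ᵐ[volume.restrict (Ioo L.b T)] q :=
    ae_mono (Measure.restrict_mono (Ioo_subset_Ioo hL.b_pos.le le_rfl) le_rfl) hq
  rw [isSolution_iff, isSolution_iff]
  exact and_congr ⟨fun h => h.congr_ae h1, fun h => h.congr_ae h1.symm⟩
    (and_congr ⟨fun h => h.congr_ae h2, fun h => h.congr_ae h2.symm⟩ Iff.rfl)

/-- By uniqueness the problems differ only by a change of `q` on a null set. They have literally the
same solutions, so the choices defining `φ` and `Φ`, and with them `Δ` and `M`, are the same, and
any spectral data of one problem serve the other. -/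
theorem SameWeyl.sameSpectralData (h : SameWeyl T L L') (hL : L.Admissible T)
    (hL' : L'.Admissible T) : SameSpectralData T L L' := by
  obtain ⟨hq, hb, ha₁, ha₂, hh, hH, hd₁, hd₂⟩ := h.eq hL hL'
  obtain ⟨ev, M, hW⟩ := exists_isSpectralData hL
  have hL'_eq : L' = { L with q := L'.q } := by
    cases L; cases L'; simp_all
  have hsol : ∀ lam u, L'.IsSolution T lam u ↔ L.IsSolution T lam u := fun lam u => by
    rw [hL'_eq]; exact (isSolution_congr hL hq).symm
  have hV : L'.V T = L.V T := by funext u; rw [V, V, hH]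
  have hU : L'.U = L.U := by funext u; rw [U, U, hh]
  have hchar : L'.charFun T = L.charFun T := by
    funext lam
    simp only [charFun, phi, hsol, hh, hV]
  have hweyl : L'.weyl T = L.weyl T := by
    funext lam
    simp only [weyl, weylSol, hsol, hU, hV]
  refine ⟨ev, M, hW, ?_⟩
  constructor
  · rw [hchar]; exact hW.multiplicity
  · exact hW.adjacent
  · rw [hchar, hweyl]; exact hW.principal_part

end BVP

theorem theorem3p1 (T : ℝ) (L L' : BVP) (hL : L.Admissible T) (hL' : L'.Admissible T) :
    (BVP.SameWeyl T L L' ↔ BVP.SameSpectralData T L L') ∧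
    (BVP.SameWeyl T L L' ∨ BVP.SameSpectralData T L L' →
      L.q =ᵐ[volume.restrict (Ioo 0 T)] L'.q ∧
      (∀ x ∈ Ioo 0 T, L.r x = L'.r x) ∧
      L.b = L'.b ∧ L.a₁ = L'.a₁ ∧ L.a₂ = L'.a₂ ∧
      L.h = L'.h ∧ L.H = L'.H ∧ L.d₁ = L'.d₁ ∧ L.d₂ = L'.d₂) := by
  refine ⟨⟨fun h => h.sameSpectralData hL hL', fun h => h.sameWeyl hL hL'⟩, fun h => ?_⟩
  obtain ⟨hq, hb, ha₁, ha₂, hrest⟩ := (h.elim id fun h => h.sameWeyl hL hL').eq hL hL'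
  exact ⟨hq, fun x _ => by rw [BVP.r, BVP.r, hb, ha₁, ha₂], hb, ha₁, ha₂, hrest⟩
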